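/- Let $\mathbb M_2^{\mathbb R}=\mathbb F_2[\tau,\rho]$, bigraded with $|\tau|=(0,1)$ and $|\rho|=(1,1)$, be the mod $2$ $\mathbb R$-motivic cohomology of a point. Let $\mathcal A^{\mathbb R}$ be the mod $2$ $\mathbb R$-motivic Steenrod algebra: the associative $\mathbb F_2$-algebra generated by $\mathbb M_2^{\mathbb R}$ and the Steenrod squares $\mathrm{Sq}^n$ ($n\ge 0$, $\mathrm{Sq}^0=1$) in bidegrees $|\mathrm{Sq}^{2i}|=(2i,i)$, $|\mathrm{Sq}^{2i+1}|=(2i+1,i)$, subject to the commutation rules $\mathrm{Sq}^n\rho=\rho\,\mathrm{Sq}^n$, $\mathrm{Sq}^{2i}\tau=\tau\,\mathrm{Sq}^{2i}+\rho\tau\,\mathrm{Sq}^{2i-1}$ $(i\ge1)$, $\mathrm{Sq}^{2i+1}\tau=\tau\,\mathrm{Sq}^{2i+1}+\rho\,\mathrm{Sq}^{2i}+\rho^2\,\mathrm{Sq}^{2i-1}$ $(i\ge0$, where $\mathrm{Sq}^{-1}=0)$, and the $\mathbb R$-motivic Adem relations. Let $\mathcal A(1)^{\mathbb R}\subset\mathcal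 A^{\mathbb R}$ be the subalgebra generated by $\mathbb M_2^{\mathbb R}$, $\mathrm{Sq}^1$ and $\mathrm{Sq}^2$, and put $Q_0=\mathrm{Sq}^1$, $Q_1=\mathrm{Sq}^1\mathrm{Sq}^2+\mathrm{Sq}^2\mathrm{Sq}^1$. Let $\mathcal C$ be the category of bigraded left $\mathcal A(1)^{\mathbb R}$-modules whose underlying $\mathbb M_2^{\mathbb R}$-module is finitely generated and projective (equivalently, free of finite rank), with the $\mathcal A(1)^{\mathbb R}$-linear maps preserving bidegrees as morphisms. A morphism $f\colon M\to N$ of $\mathcal C$ is a *stable equivalence* if it becomes an isomorphism in the stable module category, i.e. if there is a morphism $g\colon N\to M$ in $\mathcal C$ such that each of $g f-\mathrm{id}_M$ and $f g-\mathrm{id}_N$ factors in $\mathcal C$ through a projective $\mathcal A(1)^{\mathbb R}$-module. For $M$ in $\mathcal C$ put $M/(\rho,\tau)=\mathbb F_2\otimes_{\mathbb M_2^{\mathbb R}}M=M/(\rho M+\tau M)$, which is a module over $\mathcal A(1)^{\mathbb R}/(\rho,\tau)$; the elements $Q_0,Q_1,\mathrm{Sq}^2$ have square zero there. For such an element $\alpha$,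 the Margolis homology is $$H(M/(\rho,\tau);\alpha)=\{x\in M/(\rho,\tau): \alpha x=0\}\,/\,\alpha\cdot M/(\rho,\tau).$$ **Statement.** Let $f\colon M\to N$ be a morphism of $\mathcal C$. Then $f$ is a stable equivalence if and only if, for every $\alpha\in\{Q_0,Q_1,\mathrm{Sq}^2\}$, the map $$H(M/(\rho,\tau);\alpha)\longrightarrow H(N/(\rho,\tau);\alpha)$$ induced by $f/(\rho,\tau)$ is an isomorphism. -/

import Mathlib

universe u

namespace RMotivic

/-- Generators of the mod 2 `ℝ`-motivic Steenrod algebra: the classes `τ`, `ρ` of the coefficient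
ring and the Steenrod squares `Sq^n`. -/
inductive Gen : Type
  | tau : Gen
  | rho : Gen
  | sq (n : ℕ) : Gen

/-- The free associative `𝔽₂`-algebra on the generators. -/
abbrev FreeSteenrod : Type := FreeAlgebra (ZMod 2) Gen

/-- `τ` in the free algebra. -/
abbrev fτ : FreeSteenrod := FreeAlgebra.ι (ZMod 2) Gen.tau

/-- `ρ` in the free algebra. -/
abbrev fρ : FreeSteenrod := FreeAlgebra.ι (ZMod 2) Gen.rho

/-- `Sq^n` in the free algebra. -/
abbrev fSq (n : ℕ) : FreeSteenrod := FreeAlgebra.ι (ZMod 2) (Gen.sq n)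

open Finset in
/-- The defining relations of the mod 2 `ℝ`-motivic Steenrod algebra: `τ` and `ρ` commute,
`Sq^0 = 1`, the commutation rules of the squares with `ρ` and `τ` given by the motivic Cartan
formula with `Sq^1 τ = ρ`, and the `ℝ`-motivic Adem relations for `0 < a < 2 b`.
(The subtractions of natural numbers are never truncated in the terms that occur.) -/
inductive Rel : FreeSteenrod → FreeSteenrod → Prop
  | tau_rho : Rel (fτ * fρ) (fρ * fτ)
  | sq_zero : Rel (fSq 0) 1
  | sq_rho (n : ℕ) : Rel (fSq n * fρ) (fρ * fSq n)
  | sq_one_tau : Rel (fSq 1 * fτ) (fτ * fSq 1 + fρ)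
  | sq_even_tau (i : ℕ) :
      Rel (fSq (2 * i + 2) * fτ) (fτ * fSq (2 * i + 2) + fρ * fτ * fSq (2 * i + 1))
  | sq_odd_tau (i : ℕ) :
      Rel (fSq (2 * i + 3) * fτ)
        (fτ * fSq (2 * i + 3) + fρ * fSq (2 * i + 2) + fρ ^ 2 * fSq (2 * i + 1))
  | adem_even_even (a b : ℕ) (ha : 0 < a) (hab : a < 2 * b) (hae : Even a) (hbe : Even b) :
      Rel (fSq a * fSq b)
        (∑ c ∈ range (a / 2 + 1),
          ((b - 1 - c).choose (a - 2 * c)) • (fτ ^ (c % 2) * fSq (a + b - c) * fSq c))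
  | adem_even_odd (a b : ℕ) (ha : 0 < a) (hab : a < 2 * b) (hae : Even a) (hbo : Odd b) :
      Rel (fSq a * fSq b)
        (∑ c ∈ range (a / 2 + 1),
            ((b - 1 - c).choose (a - 2 * c)) • (fSq (a + b - c) * fSq c)
          + ∑ c ∈ range (a / 2 + 1) with Odd c,
            ((b - 1 - c).choose (a - 2 * c)) • (fρ * fSq (a + b - c - 1) * fSq c))
  | adem_odd_even (a b : ℕ) (ha : 0 < a) (hab : a < 2 * b) (hao : Odd a) (hbe : Even b) :
      Rel (fSq a * fSq b)
        (∑ c ∈ range (a / 2 + 1) with Even c,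
            ((b - 1 - c).choose (a - 2 * c)) • (fSq (a + b - c) * fSq c)
          + ∑ c ∈ range (a / 2 + 1) with Odd c,
            ((b - 1 - c).choose (a - 1 - 2 * c)) • (fρ * fSq (a + b - c - 1) * fSq c))
  | adem_odd_odd (a b : ℕ) (ha : 0 < a) (hab : a < 2 * b) (hao : Odd a) (hbo : Odd b) :
      Rel (fSq a * fSq b)
        (∑ c ∈ range (a / 2 + 1) with Odd c,
          ((b - 1 - c).choose (a - 2 * c)) • (fSq (a + b - c) * fSq c))

/-- The mod 2 `ℝ`-motivic Steenrod algebra `𝒜^ℝ`. -/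
def Steenrod : Type := RingQuot Rel

noncomputable instance : Ring Steenrod := inferInstanceAs (Ring (RingQuot Rel))

noncomputable instance : Algebra (ZMod 2) Steenrod :=
  inferInstanceAs (Algebra (ZMod 2) (RingQuot Rel))

/-- The quotient map from the free algebra. -/
noncomputable def toSteenrod : FreeSteenrod →ₐ[ZMod 2] Steenrod :=
  RingQuot.mkAlgHom (ZMod 2) Rel

theorem toSteenrod_rel {x y : FreeSteenrod} (h : Rel x y) : toSteenrod x = toSteenrod y :=
  RingQuot.mkAlgHom_rel (ZMod 2) h

/-- `𝒜(1)^ℝ`: the subalgebra of `𝒜^ℝ` generated over the coefficients by `Sq^1` and `Sq^2`. -/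
noncomputable def A1 : Subalgebra (ZMod 2) Steenrod :=
  Algebra.adjoin (ZMod 2)
    {toSteenrod fτ, toSteenrod fρ, toSteenrod (fSq 1), toSteenrod (fSq 2)}

/-- `τ ∈ 𝒜(1)^ℝ`. -/
noncomputable def τ : A1 := ⟨toSteenrod fτ, Algebra.subset_adjoin (by simp)⟩

/-- `ρ ∈ 𝒜(1)^ℝ`. -/
noncomputable def ρ : A1 := ⟨toSteenrod fρ, Algebra.subset_adjoin (by simp)⟩

/-- `Sq^1 ∈ 𝒜(1)^ℝ`. -/
noncomputable def Sq1 : A1 := ⟨toSteenrod (fSq 1), Algebra.subset_adjoin (by simp)⟩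

/-- `Sq^2 ∈ 𝒜(1)^ℝ`. -/
noncomputable def Sq2 : A1 := ⟨toSteenrod (fSq 2), Algebra.subset_adjoin (by simp)⟩

/-- The Milnor primitive `Q₀ = Sq^1`. -/
noncomputable def Q0 : A1 := Sq1

/-- The Milnor primitive `Q₁ = Sq^1 Sq^2 + Sq^2 Sq^1`. -/
noncomputable def Q1 : A1 := Sq1 * Sq2 + Sq2 * Sq1

theorem τ_mul_ρ : τ * ρ = ρ * τ := by
  apply Subtype.ext
  simpa [τ, ρ] using toSteenrod_rel Rel.tau_rho

theorem Sq1_mul_ρ : Sq1 * ρ = ρ * Sq1 := by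
  apply Subtype.ext
  simpa [Sq1, ρ] using toSteenrod_rel (Rel.sq_rho 1)

theorem Sq2_mul_ρ : Sq2 * ρ = ρ * Sq2 := by
  apply Subtype.ext
  simpa [Sq2, ρ] using toSteenrod_rel (Rel.sq_rho 2)

theorem Sq1_mul_τ : Sq1 * τ = τ * Sq1 + ρ := by
  apply Subtype.ext
  simpa [Sq1, τ, ρ] using toSteenrod_rel Rel.sq_one_tau

theorem Sq2_mul_τ : Sq2 * τ = τ * Sq2 + ρ * τ * Sq1 := by
  apply Subtype.ext
  simpa [Sq1, Sq2, τ, ρ] using toSteenrod_rel (Rel.sq_even_tau 0)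

/-- The coefficient ring `𝕄₂^ℝ = 𝔽₂[τ, ρ]`; the variable `0` is `τ` and the variable `1` is `ρ`. -/
abbrev M2R : Type := MvPolynomial (Fin 2) (ZMod 2)

/-- The (non-central) ring homomorphism `𝕄₂^ℝ → 𝒜(1)^ℝ` sending the monomial with exponents
`(i, j)` to `τ ^ i * ρ ^ j`. -/
noncomputable def coeff : M2R →ₐ[ZMod 2] A1 :=
  AddMonoidAlgebra.lift (ZMod 2) A1 (Fin 2 →₀ ℕ)
    { toFun := fun m => τ ^ (m.toAdd 0) * ρ ^ (m.toAdd 1)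
      map_one' := by simp
      map_mul' := fun m n => by
        have h : Commute τ ρ := τ_mul_ρ
        simp only [toAdd_mul, Finsupp.add_apply, pow_add, mul_assoc]
        congr 1
        rw [← mul_assoc, ← mul_assoc, (h.pow_pow _ _).eq] }

/-- The objects of the category of `𝕄₂^ℝ`-free `𝒜(1)^ℝ`-modules: bigraded left `𝒜(1)^ℝ`-modules
whose underlying `𝕄₂^ℝ`-module is finitely generated and projective (equivalently, free). The
bidegrees of `τ`, `ρ`, `Sq^1`, `Sq^2` are `(0,1)`, `(1,1)`, `(1,0)`, `(2,1)`. -/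
structure FreeMod : Type (u + 1) where
  /-- the underlying module -/
  carrier : Type u
  [addCommGroup : AddCommGroup carrier]
  [module : Module A1 carrier]
  /-- the homogeneous components -/
  deg : ℤ × ℤ → AddSubgroup carrier
  isInternal : DirectSum.IsInternal deg
  τ_smul_mem : ∀ d, ∀ x ∈ deg d, τ • x ∈ deg (d + (0, 1))
  ρ_smul_mem : ∀ d, ∀ x ∈ deg d, ρ • x ∈ deg (d + (1, 1))
  Sq1_smul_mem : ∀ d, ∀ x ∈ deg d, Sq1 • x ∈ deg (d + (1, 0))
  Sq2_smul_mem : ∀ d, ∀ x ∈ deg d, Sq2 • x ∈ deg (d + (2, 1))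
  finite : letI := Module.compHom carrier coeff.toRingHom; Module.Finite M2R carrier
  projective : letI := Module.compHom carrier coeff.toRingHom; Module.Projective M2R carrier

instance : CoeSort FreeMod.{u} (Type u) := ⟨FreeMod.carrier⟩

instance (M : FreeMod.{u}) : AddCommGroup M := M.addCommGroup

instance (M : FreeMod.{u}) : Module A1 M := M.module

/-- Morphisms: `𝒜(1)^ℝ`-linear maps preserving the bidegree. -/
structure FreeMod.Hom (M N : FreeMod.{u}) : Type u where
  /-- the underlying linear map -/
  toLin : M →ₗ[A1] N
  map_deg : ∀ d, ∀ x ∈ M.deg d, toLin x ∈ N.deg d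

/-- A map factors through a projective object, i.e. it represents zero in the stable module
category. -/
def IsStablyZero {M N : FreeMod.{u}} (h : M →ₗ[A1] N) : Prop :=
  ∃ (P : FreeMod.{u}) (i : FreeMod.Hom M P) (p : FreeMod.Hom P N),
    Module.Projective A1 P ∧ h = p.toLin ∘ₗ i.toLin

/-- A morphism is a stable equivalence if it has a two-sided inverse in the stable module category,
where morphisms are identified when their difference factors through a projective object. -/
def IsStableEquivalence {M N : FreeMod.{u}} (f : FreeMod.Hom M N) : Prop :=
  ∃ g : FreeMod.Hom N M,
    IsStablyZero (g.toLin ∘ₗ f.toLin - LinearMap.id) ∧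
    IsStablyZero (f.toLin ∘ₗ g.toLin - LinearMap.id)

section Reduction

variable (M : Type u) [AddCommGroup M] [Module A1 M]

/-- The subset `(ρ, τ) M = ρ M + τ M` of an `𝒜(1)^ℝ`-module; it is an `𝒜(1)^ℝ`-submodule. -/
def rhoTau : Submodule A1 M where
  carrier := {x | ∃ y z : M, x = ρ • y + τ • z}
  add_mem' := by
    rintro _ _ ⟨y, z, rfl⟩ ⟨y', z', rfl⟩
    exact ⟨y + y', z + z', by simp only [smul_add]; abel⟩
  zero_mem' := ⟨0, 0, by simp⟩
  smul_mem' := by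
    rintro ⟨a, ha⟩ x hx
    induction ha using Algebra.adjoin_induction generalizing x with
    | mem a h =>
      obtain ⟨y, z, rfl⟩ := hx
      rcases h with rfl | rfl | rfl | rfl
      · exact ⟨0, ρ • y + τ • z, by rw [smul_zero, zero_add]; rfl⟩
      · exact ⟨ρ • y + τ • z, 0, by rw [smul_zero, add_zero]; rfl⟩
      · refine ⟨Sq1 • y + z, Sq1 • z, ?_⟩
        change Sq1 • _ = _
        simp only [smul_add, ← mul_smul, Sq1_mul_ρ, Sq1_mul_τ, add_smul]
        abel
      · refine ⟨Sq2 • y + (τ * Sq1) • z, Sq2 • z, ?_⟩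
        change Sq2 • _ = _
        simp only [smul_add, ← mul_smul, Sq2_mul_ρ, Sq2_mul_τ, add_smul, mul_assoc]
        abel
    | algebraMap r =>
      obtain ⟨y, z, rfl⟩ := hx
      change ∃ _ _, algebraMap (ZMod 2) A1 r • _ = _
      obtain rfl | rfl : r = 0 ∨ r = 1 := by revert r; decide
      · exact ⟨0, 0, by simp⟩
      · exact ⟨y, z, by simp⟩
    | add a b ha hb iha ihb =>
      obtain ⟨y, z, h⟩ := iha hx
      obtain ⟨y', z', h'⟩ := ihb hx
      refine ⟨y + y', z + z', ?_⟩
      have : (⟨a + b, add_mem ha hb⟩ : A1) • x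
          = (⟨a, ha⟩ : A1) • x + (⟨b, hb⟩ : A1) • x := by
        rw [← add_smul]; rfl
      refine this.trans ?_
      rw [h, h']
      simp only [smul_add]; abel
    | mul a b ha hb iha ihb =>
      have : (⟨a * b, mul_mem ha hb⟩ : A1) • x = (⟨a, ha⟩ : A1) • (⟨b, hb⟩ : A1) • x := by
        rw [← mul_smul]; rfl
      have h := iha (ihb hx)
      rw [← this] at h
      exact h

/-- The base change `M/(ρ, τ) = 𝔽₂ ⊗ M` along `𝕄₂^ℝ → 𝔽₂`, `ρ, τ ↦ 0`. The algebra `𝒜(1)^ℝ`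
acts on it through `𝒜(1)^ℝ/(ρ, τ)`. -/
abbrev Red : Type u := M ⧸ rhoTau M

variable {M} {N : Type u} [AddCommGroup N] [Module A1 N]

/-- The base change `f/(ρ, τ)` of a linear map. -/
noncomputable def redMap (f : M →ₗ[A1] N) : Red M →ₗ[A1] Red N :=
  (rhoTau M).mapQ (rhoTau N) f (by
    rintro _ ⟨y, z, rfl⟩
    exact ⟨f y, f z, by simp⟩)

/-- Multiplication by `a` as an additive endomorphism. -/
noncomputable def mulBy (M : Type u) [AddCommGroup M] [Module A1 M] (a : A1) : M →+ M :=
  DistribSMul.toAddMonoidHom M a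

/-- Margolis homology `H(M; a)`: the annihilator of `a` in `M` modulo `a M`
(for `a` acting on `M` with square zero). -/
abbrev Margolis (M : Type u) [AddCommGroup M] [Module A1 M] (a : A1) : Type u :=
  (mulBy M a).ker ⧸ (mulBy M a).range.addSubgroupOf (mulBy M a).ker

/-- The map induced by a linear map on annihilators of `a`. -/
noncomputable def kerMap (f : M →ₗ[A1] N) (a : A1) : (mulBy M a).ker →+ (mulBy N a).ker :=
  (f.toAddMonoidHom.comp (mulBy M a).ker.subtype).codRestrict _ (by
    rintro ⟨x, hx⟩
    have hx' : a • x = 0 := hx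
    change a • f x = 0
    rw [← map_smul, hx', map_zero])

/-- The map induced by a linear map on Margolis homology. -/
noncomputable def margolisMap (f : M →ₗ[A1] N) (a : A1) : Margolis M a →+ Margolis N a :=
  QuotientAddGroup.map _ _ (kerMap f a) (by
    rintro ⟨x, hx⟩ ⟨y, hy⟩
    refine ⟨f y, ?_⟩
    have hy' : a • y = x := hy
    change a • f y = f x
    rw [← map_smul, hy'])

end Reduction

end RMotivic

/-! Margolis homology detects projectivity, and a stable equivalence is a map whose cone is
projective.

A projective module is a summand of a free one, and `A1` modulo `(ρ, τ)` has no Margolis homology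
for `Q0`, `Q1`, `Sq2` (`isExactMod_A1`, `isExactMod_of_projective`). So a map factoring through a
projective vanishes on Margolis homology, and a stable equivalence induces isomorphisms.

Conversely, replace `f` by `(f, ι) : M → N ⊕ I`, with `I = Hom(A1, M)` coinduced from the
coefficients and `ι` the unit. Evaluation at `1` splits `ι` over the coefficients, so the cokernel
`C` is again an object; `I` is projective because `A1` is a Frobenius extension of the coefficients
(`Coind.frobenius_bijective`). If `f` induces isomorphisms, a diagram chase shows that `C/(ρ, τ)`
has no Margolis homology (`isExactMod_cokernel`), hence `C` is projective
(`FreeMod.projective_of_isExactMod`). The sequence `0 → M → N ⊕ I → C → 0` then splits by graded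
maps, and the retraction restricted to `N` is the stable inverse of `f`.

The detection theorem rests on a filtration of the augmentation ideal. Modulo `(ρ, τ)` the class
`Q1` is central, and modulo `Q1` the classes `Sq1` and `Sq2` commute. Dividing out `Q1`, then `Sq1`,
then `Sq2` preserves exactness of the remaining operators by a zigzag argument
(`IsExactMod.addMul`). Minimal generators of `C` give a map from a free module that is surjective
and injective modulo the augmentation ideal; exactness lifts injectivity back through the three
quotients (`comap_le_of_comap_addMul_le`), and Nakayama's lemma over the coefficients, where `C` is
projective, removes `(ρ, τ)`.

All this needs `A1`, given by generators and relations, to be free over the coefficients on eight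
words. Spanning is rewriting. Independence needs a representation of the whole Steenrod algebra: the
free module on `u`, `v` with `Sq^2 u = v`. Its Adem relations are proved for all integer indices at
once, since in that form they are inherited under multiplication by `τ` (`SquareAction.adem_tau`)
and need checking only on `u` and `v`. -/

namespace RMotivic

/-! ### Binomial coefficients mod 2 with integer entries. -/

/-- The binomial coefficient mod 2 with arbitrary integral entries; it is `0` for negative lower
entry. -/
noncomputable def bin (m k : ℤ) : ZMod 2 :=
  if k < 0 then 0 else ((Ring.choose m k.toNat : ℤ) : ZMod 2)

theorem bin_of_neg (m : ℤ) {k : ℤ} (hk : k < 0) : bin m k = 0 := if_pos hk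

theorem bin_zero_right (m : ℤ) : bin m 0 = 1 := by simp [bin]

theorem bin_natCast (m k : ℕ) : bin m k = (m.choose k : ZMod 2) := by
  simp [bin, Ring.choose_natCast]

theorem bin_pascal (m k : ℤ) : bin (m + 1) k = bin m k + bin m (k - 1) := by
  rcases lt_trichotomy k 0 with hk | rfl | hk
  · rw [bin_of_neg _ hk, bin_of_neg _ hk, bin_of_neg _ (by lia), add_zero]
  · rw [bin_zero_right, bin_zero_right, bin_of_neg _ (by lia), add_zero]
  · obtain ⟨j, rfl⟩ : ∃ j : ℕ, k = (j + 1 : ℕ) := ⟨(k - 1).toNat, by lia⟩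
    have h : ((j + 1 : ℕ) : ℤ) - 1 = (j : ℕ) := by lia
    rw [h, bin, bin, bin, if_neg (by lia), if_neg (by lia), if_neg (by lia)]
    simp only [Int.toNat_natCast]
    rw [Ring.choose_succ_succ, Int.cast_add, add_comm]

theorem zmod_two_add_self (x : ZMod 2) : x + x = 0 := CharTwo.add_self_eq_zero x

/-- Reflects `(1 + x)^2 = 1 + x^2` in characteristic 2. -/
theorem bin_add_two (m k : ℤ) : bin (m + 2) k = bin m k + bin m (k - 2) := by
  have h1 := bin_pascal (m + 1) k
  have h2 := bin_pascal m k
  have h3 := bin_pascal m (k - 1)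
  rw [show m + 1 + 1 = m + 2 by ring] at h1
  rw [show k - 1 - 1 = k - 2 by ring] at h3
  rw [h1, h2, h3]
  linear_combination zmod_two_add_self (bin m (k - 1))

theorem bin_zero_left {k : ℤ} (hk : k ≠ 0) : bin 0 k = 0 := by
  rcases lt_or_gt_of_ne hk with h | h
  · exact bin_of_neg _ h
  · obtain ⟨j, rfl⟩ : ∃ j : ℕ, k = (j + 1 : ℕ) := ⟨(k - 1).toNat, by lia⟩
    simpa using bin_natCast 0 (j + 1)

/-- The power `(1 + x)^(2p) = (1 + x^2)^p` has no odd terms. With Pascal's rule this is the only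
binomial input to the parity cases of the Adem relations. -/
theorem bin_even_odd {m k : ℤ} (hm : Even m) (hk : Odd k) : bin m k = 0 := by
  obtain ⟨p, rfl⟩ := hm
  by_cases hk0 : k < 0
  · exact bin_of_neg _ hk0
  obtain ⟨j, rfl⟩ : ∃ j : ℕ, k = 2 * (j : ℤ) + 1 := by
    obtain ⟨i, rfl⟩ := hk
    exact ⟨i.toNat, by lia⟩
  clear hk hk0
  induction j generalizing p with
  | zero =>
    have h (m : ℤ) : bin (m + 2) 1 = bin m 1 := by
      rw [bin_add_two, bin_of_neg (k := 1 - 2) m (by norm_num), add_zero]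
    induction p using Int.induction_on with
    | zero => exact bin_zero_left (by norm_num)
    | succ i hi =>
      rw [← hi, show (i : ℤ) + 1 + (i + 1) = (i + i) + 2 by ring]
      simpa using h (i + i)
    | pred i hi =>
      rw [← hi, show -(i : ℤ) + -i = (-i - 1 + (-i - 1)) + 2 by ring]
      simpa using (h _).symm
  | succ j ih =>
    have h (p : ℤ) : bin (p + p + 2) (2 * ((j + 1 : ℕ) : ℤ) + 1) =
        bin (p + p) (2 * ((j + 1 : ℕ) : ℤ) + 1) := by
      rw [bin_add_two, show 2 * ((j + 1 : ℕ) : ℤ) + 1 - 2 = 2 * (j : ℤ) + 1 by push_cast; ring,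
        ih, add_zero]
    induction p using Int.induction_on with
    | zero => exact bin_zero_left (by lia)
    | succ i hi =>
      rw [← hi, ← h i]
      congr 1; ring
    | pred i hi =>
      rw [← hi, ← h (-i - 1)]
      congr 1; ring

/-- Up to sign this is the central binomial coefficient of `2a` over `a`, which is even for `a > 0`.
-/
theorem bin_central {a : ℤ} (ha : 0 < a) : bin (-1 - a) a = 0 := by
  obtain ⟨j, rfl⟩ : ∃ j : ℕ, a = (j + 1 : ℕ) := ⟨(a - 1).toNat, by lia⟩
  rw [bin, if_neg (by lia), Int.toNat_natCast,
    show -1 - ((j + 1 : ℕ) : ℤ) = -((j + 2 : ℕ) : ℤ) by push_cast; ring, Ring.choose_neg,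
    show ((j + 2 : ℕ) : ℤ) + ((j + 1 : ℕ) : ℤ) - 1 = ((2 * (j + 1) : ℕ) : ℤ) by push_cast; ring,
    Ring.choose_natCast]
  have h : ((2 * (j + 1)).choose (j + 1) : ZMod 2) = 0 := by
    rw [ZMod.natCast_eq_zero_iff]
    exact Nat.two_dvd_centralBinom_succ j
  rw [Units.smul_def, smul_eq_mul, Int.cast_mul, Int.cast_natCast, h, mul_zero]

/-- By `bin_add_two` and the vanishing of central coefficients, both summands equal `bin (-1 - a) (a
- 2)`. The sum is the coefficient of `v` in the Adem expansion of `Sq^a Sq^(2-a) u`. -/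
theorem bin_central_sub {a : ℤ} (h0 : a ≠ 0) (h2 : a ≠ 2) :
    bin (1 - a) a + bin (-1 - a) (a - 4) = 0 := by
  rcases lt_or_gt_of_ne h0 with h | h
  · rw [bin_of_neg _ h, bin_of_neg _ (by lia), add_zero]
  have e1 := bin_add_two (-1 - a) a
  have e2 := bin_add_two (-1 - a) (a - 2)
  have e3 := bin_central h
  rw [show -1 - a + 2 = 1 - a by ring] at e1 e2
  rw [show a - 2 - 2 = a - 4 by ring] at e2
  rcases lt_or_gt_of_ne h2 with h' | h'
  · obtain rfl : a = 1 := by lia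
    rw [show (1 : ℤ) - 1 = 0 by ring, bin_zero_left (by norm_num), bin_of_neg _ (by norm_num),
      add_zero]
  · have e4 := bin_central (a := a - 2) (by lia)
    rw [show -1 - (a - 2) = 1 - a by ring] at e4
    rw [e1, e3]
    rw [e4] at e2
    rw [zero_add, ← e2]

/-! ### Sums of composites of two squares. -/

section CompSum

variable {V : Type*} [AddCommGroup V] [Module (ZMod 2) V]

/-- The restriction of a function on `ℤ` to the even integers. -/
def evenPart (f : ℤ → ZMod 2) (c : ℤ) : ZMod 2 := if Even c then f c else 0

/-- The restriction of a function on `ℤ` to the odd integers. -/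
def oddPart (f : ℤ → ZMod 2) (c : ℤ) : ZMod 2 := if Even c then 0 else f c

/-- The sum of `f c • Q (n - c) (Q c m)` over all integers `c` with `0 ≤ c ≤ n`. -/
noncomputable def compSum (Q : ℤ → Module.End (ZMod 2) V) (f : ℤ → ZMod 2) (n : ℤ) (m : V) : V :=
  ∑ c ∈ Finset.Icc 0 n, f c • Q (n - c) (Q c m)

theorem compSum_add (Q : ℤ → Module.End (ZMod 2) V) (f g : ℤ → ZMod 2) (n : ℤ) (m : V) :
    compSum Q (f + g) n m = compSum Q f n m + compSum Q g n m := by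
  simp [compSum, add_smul, Finset.sum_add_distrib]

theorem compSum_map_add (Q : ℤ → Module.End (ZMod 2) V) (f : ℤ → ZMod 2) (n : ℤ) (m m' : V) :
    compSum Q f n (m + m') = compSum Q f n m + compSum Q f n m' := by
  simp [compSum, Finset.sum_add_distrib]

/-- After reindexing, the surplus terms carry an operator of negative index on one side or the
other. This lets sums with different totals be compared over one range. -/
theorem sum_comp_shift {Q : ℤ → Module.End (ZMod 2) V} (hQ : ∀ n, n < 0 → Q n = 0) (f : ℤ → ZMod 2) (n n' i : ℤ) (hi : 0 ≤ i) (hn : n' + i ≤ n)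
    (m : V) :
    ∑ c ∈ Finset.Icc 0 n, f c • Q (n' + i - c) (Q (c - i) m) =
      compSum Q (fun c => f (c + i)) n' m := by
  have h1 : ∑ c ∈ Finset.Icc 0 n, f c • Q (n' + i - c) (Q (c - i) m) =
      ∑ c ∈ Finset.Icc (-i) (n - i), f (c + i) • Q (n' - c) (Q c m) := by
    refine Finset.sum_bij' (fun c _ => c - i) (fun c _ => c + i) ?_ ?_ ?_ ?_ ?_
    · intro c hc; simp only [Finset.mem_Icc] at *; lia
    · intro c hc; simp only [Finset.mem_Icc] at *; lia
    · intro c _; simp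
    · intro c _; simp
    · intro c _
      rw [sub_add_cancel, show n' - (c - i) = n' + i - c by ring]
  rw [h1, compSum]
  refine (Finset.sum_subset ?_ ?_).symm
  · intro c hc; simp only [Finset.mem_Icc] at *; lia
  · intro c _ hc
    simp only [Finset.mem_Icc, not_and_or, not_le] at hc
    rcases hc with hc | hc
    · simp [hQ c hc]
    · simp [hQ (n' - c) (by lia)]

end CompSum

/-! ### Moving `τ` and `ρ` through composites of squares. -/

section SquareAction

variable {R V : Type*} [CommRing R] [AddCommGroup V] [Module R V] [Algebra (ZMod 2) R]
  [Module (ZMod 2) V] [IsScalarTower (ZMod 2) R V]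

/-- Operators `Q n` (`n ∈ ℤ`) on an `R`-module that satisfy the commutation rules of the motivic
Steenrod squares with the elements `T`, `r` of `R`. -/
structure SquareAction (T r : R) (Q : ℤ → Module.End (ZMod 2) V) : Prop where
  of_neg : ∀ n, n < 0 → Q n = 0
  map_rho : ∀ n m, Q n (r • m) = r • Q n m
  map_tau_even : ∀ n m, Even n → Q n (T • m) = T • Q n m + (r * T) • Q (n - 1) m
  map_tau_odd : ∀ n m, Odd n →
    Q n (T • m) = T • Q n m + r • Q (n - 1) m + r ^ 2 • Q (n - 2) m

variable {T r : R} {Q : ℤ → Module.End (ZMod 2) V}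

theorem SquareAction.compSum_rho (h : SquareAction T r Q) (f : ℤ → ZMod 2) (n : ℤ) (m : V) :
    compSum Q f n (r • m) = r • compSum Q f n m := by
  simp only [compSum, h.map_rho, Finset.smul_sum, smul_comm r]

/-- Once the parities of `c` and `n` are fixed, `Q c` and `Q (n - c)` each follow a known rule.
Lowering the outer index only lowers the total; lowering the inner index also shifts the coefficient
function. The next three lemmas are the other parities. -/
theorem SquareAction.compSum_even_tau_even (h : SquareAction T r Q)
    (f : ℤ → ZMod 2) (n : ℤ) (hn : Even n) (m : V) :
    compSum Q (evenPart f) n (T • m) = T • compSum Q (evenPart f) n m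
      + (r * T) • compSum Q (evenPart f) (n - 1) m
      + (r * T) • compSum Q (fun c => evenPart f (c + 1)) (n - 1) m
      + (r ^ 2 * T) • compSum Q (fun c => evenPart f (c + 1)) (n - 2) m := by
  rw [← sum_comp_shift h.of_neg (evenPart f) n (n - 1) 1 (by lia) (by lia),
    ← sum_comp_shift h.of_neg (evenPart f) n (n - 2) 1 (by lia) (by lia)]
  have h0 := sum_comp_shift h.of_neg (evenPart f) n (n - 1) 0 (by lia) (by lia) m
  simp only [add_zero, sub_zero] at h0
  rw [← h0]
  simp only [compSum, Finset.smul_sum, ← Finset.sum_add_distrib]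
  refine Finset.sum_congr rfl fun c _ => ?_
  by_cases hc : Even c
  · have hnc : Even (n - c) := hn.sub hc
    rw [h.map_tau_even c m hc]
    simp only [map_add, mul_smul, h.map_rho, h.map_tau_even _ _ hnc, pow_two]
    rw [show n - 1 + 1 - c = n - c by ring, show n - 2 + 1 - c = n - c - 1 by ring,
      show n - 1 - c = n - c - 1 by ring]
    simp only [smul_add, smul_comm (evenPart f c)]
    module
  · simp [evenPart, hc]

theorem SquareAction.compSum_odd_tau_even (h : SquareAction T r Q)
    (f : ℤ → ZMod 2) (n : ℤ) (hn : Even n) (m : V) :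
    compSum Q (oddPart f) n (T • m) = T • compSum Q (oddPart f) n m
      + r • compSum Q (oddPart f) (n - 1) m
      + r ^ 2 • compSum Q (oddPart f) (n - 2) m
      + r • compSum Q (fun c => oddPart f (c + 1)) (n - 1) m
      + r ^ 2 • compSum Q (fun c => oddPart f (c + 2)) (n - 2) m := by
  rw [← sum_comp_shift h.of_neg (oddPart f) n (n - 1) 1 (by lia) (by lia),
    ← sum_comp_shift h.of_neg (oddPart f) n (n - 2) 2 (by lia) (by lia)]
  have h0 := sum_comp_shift h.of_neg (oddPart f) n (n - 1) 0 (by lia) (by lia) m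
  have h1 := sum_comp_shift h.of_neg (oddPart f) n (n - 2) 0 (by lia) (by lia) m
  simp only [add_zero, sub_zero] at h0 h1
  rw [← h0, ← h1]
  simp only [compSum, Finset.smul_sum, ← Finset.sum_add_distrib]
  refine Finset.sum_congr rfl fun c _ => ?_
  by_cases hc : Even c
  · simp [oddPart, hc]
  · rw [Int.not_even_iff_odd] at hc
    have hnc : Odd (n - c) := hn.sub_odd hc
    rw [h.map_tau_odd c m hc]
    simp only [map_add, h.map_rho, h.map_tau_odd _ _ hnc, pow_two, mul_smul]
    rw [show n - 1 + 1 - c = n - c by ring, show n - 2 + 2 - c = n - c by ring,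
      show n - 1 - c = n - c - 1 by ring, show n - 2 - c = n - c - 2 by ring]
    simp only [smul_add, smul_comm (oddPart f c)]

theorem SquareAction.compSum_even_tau_odd (h : SquareAction T r Q)
    (f : ℤ → ZMod 2) (n : ℤ) (hn : Odd n) (m : V) :
    compSum Q (evenPart f) n (T • m) = T • compSum Q (evenPart f) n m
      + r • compSum Q (evenPart f) (n - 1) m
      + r ^ 2 • compSum Q (evenPart f) (n - 2) m
      + (r * T) • compSum Q (fun c => evenPart f (c + 1)) (n - 1) m
      + r ^ 2 • compSum Q (fun c => evenPart f (c + 1)) (n - 2) m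
      + r ^ 3 • compSum Q (fun c => evenPart f (c + 1)) (n - 3) m := by
  rw [← sum_comp_shift h.of_neg (evenPart f) n (n - 1) 1 (by lia) (by lia),
    ← sum_comp_shift h.of_neg (evenPart f) n (n - 2) 1 (by lia) (by lia),
    ← sum_comp_shift h.of_neg (evenPart f) n (n - 3) 1 (by lia) (by lia)]
  have h0 := sum_comp_shift h.of_neg (evenPart f) n (n - 1) 0 (by lia) (by lia) m
  have h1 := sum_comp_shift h.of_neg (evenPart f) n (n - 2) 0 (by lia) (by lia) m
  simp only [add_zero, sub_zero] at h0 h1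
  rw [← h0, ← h1]
  simp only [compSum, Finset.smul_sum, ← Finset.sum_add_distrib]
  refine Finset.sum_congr rfl fun c _ => ?_
  by_cases hc : Even c
  · have hnc : Odd (n - c) := hn.sub_even hc
    rw [h.map_tau_even c m hc]
    simp only [map_add, mul_smul, h.map_rho, h.map_tau_odd _ _ hnc, pow_succ, pow_zero, one_mul]
    rw [show n - 1 + 1 - c = n - c by ring, show n - 2 + 1 - c = n - c - 1 by ring,
      show n - 3 + 1 - c = n - c - 2 by ring,
      show n - 1 - c = n - c - 1 by ring, show n - 2 - c = n - c - 2 by ring]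
    simp only [smul_add, smul_comm (evenPart f c)]
    module
  · simp [evenPart, hc]

theorem SquareAction.compSum_odd_tau_odd (h : SquareAction T r Q)
    (f : ℤ → ZMod 2) (n : ℤ) (hn : Odd n) (m : V) :
    compSum Q (oddPart f) n (T • m) = T • compSum Q (oddPart f) n m
      + (r * T) • compSum Q (oddPart f) (n - 1) m
      + r • compSum Q (fun c => oddPart f (c + 1)) (n - 1) m
      + r ^ 2 • compSum Q (fun c => oddPart f (c + 2)) (n - 2) m := by
  rw [← sum_comp_shift h.of_neg (oddPart f) n (n - 1) 1 (by lia) (by lia),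
    ← sum_comp_shift h.of_neg (oddPart f) n (n - 2) 2 (by lia) (by lia)]
  have h0 := sum_comp_shift h.of_neg (oddPart f) n (n - 1) 0 (by lia) (by lia) m
  simp only [add_zero, sub_zero] at h0
  rw [← h0]
  simp only [compSum, Finset.smul_sum, ← Finset.sum_add_distrib]
  refine Finset.sum_congr rfl fun c _ => ?_
  by_cases hc : Even c
  · simp [oddPart, hc]
  · rw [Int.not_even_iff_odd] at hc
    have hnc : Even (n - c) := hn.sub_odd hc
    rw [h.map_tau_odd c m hc]
    simp only [map_add, h.map_rho, h.map_tau_even _ _ hnc, pow_two, mul_smul]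
    rw [show n - 1 + 1 - c = n - c by ring, show n - 2 + 2 - c = n - c by ring,
      show n - 1 - c = n - c - 1 by ring]
    simp only [smul_add, smul_comm (oddPart f c)]

end SquareAction
set_option linter.unusedSimpArgs false

/-! ### Adem relations for all integer indices, and their propagation along `τ` and `ρ`. -/

section Adem

variable {R V : Type*} [CommRing R] [AddCommGroup V] [Module R V] [Algebra (ZMod 2) R]
  [Module (ZMod 2) V] [IsScalarTower (ZMod 2) R V]

/-- The coefficients of the Adem relation for `Sq^a Sq^b`, for arbitrary integers `a`, `b`. -/
noncomputable def ademCoeff (a b c : ℤ) : ZMod 2 := bin (b - 1 - c) (a - 2 * c)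

/-- The right hand side of the Adem relation for `Q a (Q b m)`, for arbitrary integers `a`, `b`. -/
noncomputable def ademSum (T r : R) (Q : ℤ → Module.End (ZMod 2) V) (a b : ℤ) (m : V) : V :=
  if Even a then
    if Even b then
      compSum Q (evenPart (ademCoeff a b)) (a + b) m
        + T • compSum Q (oddPart (ademCoeff a b)) (a + b) m
    else
      compSum Q (evenPart (ademCoeff a b)) (a + b) m
        + compSum Q (oddPart (ademCoeff a b)) (a + b) m
        + r • compSum Q (oddPart (ademCoeff a b)) (a + b - 1) m
  else
    if Even b then
      compSum Q (evenPart (ademCoeff a b)) (a + b) m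
        + r • compSum Q (oddPart (ademCoeff (a - 1) b)) (a + b - 1) m
    else
      compSum Q (oddPart (ademCoeff a b)) (a + b) m

theorem compSum_congr {Q : ℤ → Module.End (ZMod 2) V} {f g : ℤ → ZMod 2} (n : ℤ) (m : V)
    (h : ∀ c, f c = g c) : compSum Q f n m = compSum Q g n m := by
  rw [funext h]

variable {T r : R} {Q : ℤ → Module.End (ZMod 2) V}

/-- Moving `T` out of `Q a (Q b _)` lowers the indices, so the hypothesis is used at neighbouring
pairs such as `(a - 1, b)`, which need not satisfy `0 < a < 2 * b`. Hence the relations are stated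
for all integers. -/
theorem SquareAction.adem_tau_even_even (h : SquareAction T r Q) {m : V}
    (hm : ∀ a b, Q a (Q b m) = ademSum T r Q a b m) {a b : ℤ} (ha : Even a) (hb : Even b) :
    Q a (Q b (T • m)) = ademSum T r Q a b (T • m) := by
  have ha1 : ¬ Even (a - 1) := by grind
  have ha2 : Even (a - 2) := by grind
  have hb1 : ¬ Even (b - 1) := by grind
  have hb2 : Even (b - 2) := by grind
  have hn : Even (a + b) := by grind
  rw [h.map_tau_even _ _ hb]
  simp only [map_add, mul_smul, pow_two, h.map_rho, h.map_tau_even _ _ ha, hm]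
  simp only [ademSum, ha, hb, ha1, hb1, ha2, hb2, if_true, if_false, h.compSum_rho, h.compSum_even_tau_even _ _ hn, h.compSum_odd_tau_even _ _ hn]
  simp only [show a + (b - 1) = a + b - 1 by ring, show a - 1 + b = a + b - 1 by ring, show a + (b - 2) = a + b - 2 by ring, show a - 2 + b = a + b - 2 by ring, show a - 1 + (b - 1) = a + b - 2 by ring, show a - 2 + (b - 1) = a + b - 3 by ring, show a + b - 1 - 1 = a + b - 2 by ring, show a + b - 1 - 2 = a + b - 3 by ring, show a + b - 2 - 1 = a + b - 3 by ring, show a - 1 - 1 = a - 2 by ring, show a - 2 - 1 = a - 3 by ring, show b - 1 - 1 = b - 2 by ring]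
  generalize hN : a + b = n
  -- `e1` compares the coefficients of `r * T`, in total `n - 1`, and `e2` those of `r ^ 2 * T`, in
  -- total `n - 2`; the coefficients of `T` agree already.
  have e1 : compSum Q (evenPart (ademCoeff a b) + (fun c => evenPart (ademCoeff a b) (c + 1)) + oddPart (ademCoeff a b) + (fun c => oddPart (ademCoeff a b) (c + 1))) (n - 1) m =
      compSum Q (evenPart (ademCoeff (a - 1) b) + evenPart (ademCoeff a (b - 1)) + oddPart (ademCoeff a (b - 1))) (n - 1) m := by
    refine compSum_congr _ _ fun c => ?_
    have p0 := bin_pascal (b - 2 - c) (a - 2 * c)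
    have p1 := bin_pascal (b - 2 - c) (a - 2 * c - 1)
    have q0 := fun hc : ¬ Even c => bin_even_odd (m := b - 1 - c) (k := a - 2 * c - 1)
      (by grind) (by grind)
    by_cases hc : Even c <;> simp [evenPart, oddPart, ademCoeff, hc, Int.even_add_one, -Int.not_even_iff_odd] <;> grind
  have e2 : compSum Q ((fun c => evenPart (ademCoeff a b) (c + 1)) + oddPart (ademCoeff a b) + (fun c => oddPart (ademCoeff a b) (c + 2))) (n - 2) m =
      compSum Q (oddPart (ademCoeff (a - 2) b) + oddPart (ademCoeff a (b - 1)) + oddPart (ademCoeff (a - 1) (b - 1))) (n - 2) m := by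
    refine compSum_congr _ _ fun c => ?_
    have p0 := bin_pascal (b - 2 - c) (a - 2 * c)
    have p1 := bin_pascal (b - 2 - c) (a - 2 * c - 1)
    have p2 := bin_pascal (b - 2 - c) (a - 2 * c - 2)
    have p3 := bin_pascal (b - 3 - c) (a - 2 * c - 3)
    have q0 := fun hc : ¬ Even c => bin_even_odd (m := b - 3 - c) (k := a - 2 * c - 3)
      (by grind) (by grind)
    by_cases hc : Even c <;> simp [evenPart, oddPart, ademCoeff, hc, Int.even_add_one, -Int.not_even_iff_odd] <;> grind
  simp only [compSum_add] at e1 e2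
  linear_combination (norm := module) -(r * T) • e1 - (r ^ 2 * T) • e2

theorem SquareAction.adem_tau_odd_odd (h : SquareAction T r Q) {m : V}
    (hm : ∀ a b, Q a (Q b m) = ademSum T r Q a b m) {a b : ℤ} (ha : ¬ Even a) (hb : ¬ Even b) :
    Q a (Q b (T • m)) = ademSum T r Q a b (T • m) := by
  have ha1 : Even (a - 1) := by grind
  have ha2 : ¬ Even (a - 2) := by grind
  have hb1 : Even (b - 1) := by grind
  have hb2 : ¬ Even (b - 2) := by grind
  have hn : Even (a + b) := by grind
  have hao : Odd a := by grind
  have hbo : Odd b := by grind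
  rw [h.map_tau_odd _ _ hbo]
  simp only [map_add, mul_smul, pow_two, h.map_rho, h.map_tau_odd _ _ hao, hm]
  simp only [ademSum, ha, hb, ha1, hb1, ha2, hb2, if_true, if_false, h.compSum_rho, h.compSum_odd_tau_even _ _ hn]
  simp only [show a + (b - 1) = a + b - 1 by ring, show a - 1 + b = a + b - 1 by ring, show a + (b - 2) = a + b - 2 by ring, show a - 2 + b = a + b - 2 by ring, show a - 1 + (b - 1) = a + b - 2 by ring, show a - 2 + (b - 1) = a + b - 3 by ring, show a + b - 1 - 1 = a + b - 2 by ring, show a + b - 1 - 2 = a + b - 3 by ring, show a + b - 2 - 1 = a + b - 3 by ring, show a - 1 - 1 = a - 2 by ring, show a - 2 - 1 = a - 3 by ring, show b - 1 - 1 = b - 2 by ring]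
  generalize hN : a + b = n
  have e1 : compSum Q (oddPart (ademCoeff a b) + (fun c => oddPart (ademCoeff a b) (c + 1))) (n - 1) m =
      compSum Q (evenPart (ademCoeff (a - 1) b) + oddPart (ademCoeff (a - 1) b) + evenPart (ademCoeff a (b - 1))) (n - 1) m := by
    refine compSum_congr _ _ fun c => ?_
    have p0 := bin_pascal (b - 2 - c) (a - 2 * c)
    have p2 := bin_pascal (b - 2 - c) (a - 2 * c - 1)
    have p1 := bin_pascal (b - 1 - c) (a - 2 * c)
    have q0 := fun hc : Even c => bin_even_odd (m := b - 1 - c) (k := a - 2 * c)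
      (by grind) (by grind)
    have q1 := fun hc : ¬ Even c => bin_even_odd (m := b - c) (k := a - 2 * c)
      (by grind) (by grind)
    by_cases hc : Even c <;> simp [evenPart, oddPart, ademCoeff, hc, Int.even_add_one, -Int.not_even_iff_odd] <;> grind
  have e2 : compSum Q (oddPart (ademCoeff a b) + (fun c => oddPart (ademCoeff a b) (c + 2))) (n - 2) m =
      compSum Q (oddPart (ademCoeff (a - 1) b) + oddPart (ademCoeff (a - 2) b) + oddPart (ademCoeff (a - 1) (b - 1)) + oddPart (ademCoeff a (b - 2))) (n - 2) m := by
    refine compSum_congr _ _ fun c => ?_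
    have p0 := bin_pascal (b - 2 - c) (a - 2 * c)
    have p1 := bin_pascal (b - 2 - c) (a - 2 * c - 1)
    have p2 := bin_pascal (b - 2 - c) (a - 2 * c - 2)
    have p3 := bin_pascal (b - 3 - c) (a - 2 * c)
    have p4 := bin_pascal (b - 3 - c) (a - 2 * c - 1)
    have p5 := bin_pascal (b - 3 - c) (a - 2 * c - 2)
    have p6 := bin_pascal (b - 3 - c) (a - 2 * c - 3)
    have q0 := fun hc : ¬ Even c => bin_even_odd (m := b - 2 - c) (k := a - 2 * c - 2)
      (by grind) (by grind)
    by_cases hc : Even c <;> simp [evenPart, oddPart, ademCoeff, hc, Int.even_add_one, -Int.not_even_iff_odd] <;> grind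
  simp only [compSum_add] at e1 e2
  linear_combination (norm := module) -r • e1 - r ^ 2 • e2

theorem SquareAction.adem_tau_even_odd (h : SquareAction T r Q) {m : V}
    (hm : ∀ a b, Q a (Q b m) = ademSum T r Q a b m) {a b : ℤ} (ha : Even a) (hb : ¬ Even b) :
    Q a (Q b (T • m)) = ademSum T r Q a b (T • m) := by
  have ha1 : ¬ Even (a - 1) := by grind
  have ha2 : Even (a - 2) := by grind
  have hb1 : Even (b - 1) := by grind
  have hb2 : ¬ Even (b - 2) := by grind
  have hn : Odd (a + b) := by grind
  have hn1 : Even (a + b - 1) := by grind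
  have hbo : Odd b := by grind
  rw [h.map_tau_odd _ _ hbo]
  simp only [map_add, mul_smul, pow_two, h.map_rho, h.map_tau_even _ _ ha, hm]
  simp only [ademSum, ha, hb, ha1, hb1, ha2, hb2, if_true, if_false, h.compSum_rho, h.compSum_even_tau_odd _ _ hn, h.compSum_odd_tau_odd _ _ hn, h.compSum_odd_tau_even _ _ hn1]
  simp only [show a + (b - 1) = a + b - 1 by ring, show a - 1 + b = a + b - 1 by ring, show a + (b - 2) = a + b - 2 by ring, show a - 2 + b = a + b - 2 by ring, show a - 1 + (b - 1) = a + b - 2 by ring, show a - 2 + (b - 1) = a + b - 3 by ring, show a + b - 1 - 1 = a + b - 2 by ring, show a + b - 1 - 2 = a + b - 3 by ring, show a + b - 2 - 1 = a + b - 3 by ring, show a - 1 - 1 = a - 2 by ring, show a - 2 - 1 = a - 3 by ring, show b - 1 - 1 = b - 2 by ring]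
  generalize hN : a + b = n
  -- Mixed parities produce four comparisons: the coefficients of `r * T`, `r`, `r ^ 2` and `r ^ 3`.
  have e1 : compSum Q ((fun c => evenPart (ademCoeff a b) (c + 1)) + oddPart (ademCoeff a b)) (n - 1) m =
      compSum Q (oddPart (ademCoeff (a - 1) b) + oddPart (ademCoeff a (b - 1))) (n - 1) m := by
    refine compSum_congr _ _ fun c => ?_
    have p0 := bin_pascal (b - 2 - c) (a - 2 * c)
    have p1 := bin_pascal (b - 2 - c) (a - 2 * c - 1)
    by_cases hc : Even c <;> simp [evenPart, oddPart, ademCoeff, hc, Int.even_add_one, -Int.not_even_iff_odd] <;> grind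
  have e2 : compSum Q (evenPart (ademCoeff a b) + (fun c => oddPart (ademCoeff a b) (c + 1))) (n - 1) m =
      compSum Q (evenPart (ademCoeff a (b - 1))) (n - 1) m := by
    refine compSum_congr _ _ fun c => ?_
    have p0 := bin_pascal (b - 2 - c) (a - 2 * c)
    have p1 := bin_pascal (b - 2 - c) (a - 2 * c - 1)
    have q0 := fun hc : Even c => bin_even_odd (m := b - 1 - c) (k := a - 2 * c - 1)
      (by grind) (by grind)
    by_cases hc : Even c <;> simp [evenPart, oddPart, ademCoeff, hc, Int.even_add_one, -Int.not_even_iff_odd] <;> grind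
  have e3 : compSum Q (evenPart (ademCoeff a b) + (fun c => evenPart (ademCoeff a b) (c + 1)) + (fun c => oddPart (ademCoeff a b) (c + 2)) + oddPart (ademCoeff a b) + (fun c => oddPart (ademCoeff a b) (c + 1))) (n - 2) m =
      compSum Q (evenPart (ademCoeff a (b - 2)) + oddPart (ademCoeff a (b - 2))) (n - 2) m := by
    refine compSum_congr _ _ fun c => ?_
    have p0 := bin_pascal (b - 2 - c) (a - 2 * c)
    have p1 := bin_pascal (b - 2 - c) (a - 2 * c - 1)
    have p2 := bin_pascal (b - 2 - c) (a - 2 * c - 2)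
    have p3 := bin_pascal (b - 3 - c) (a - 2 * c)
    have p4 := bin_pascal (b - 3 - c) (a - 2 * c - 1)
    have p5 := bin_pascal (b - 3 - c) (a - 2 * c - 2)
    have p6 := bin_pascal (b - 3 - c) (a - 2 * c - 3)
    have q0 := fun hc : Even c => bin_even_odd (m := b - 3 - c) (k := a - 2 * c - 3)
      (by grind) (by grind)
    have q1 := fun hc : ¬ Even c => bin_even_odd (m := b - 2 - c) (k := a - 2 * c - 3)
      (by grind) (by grind)
    by_cases hc : Even c <;> simp [evenPart, oddPart, ademCoeff, hc, Int.even_add_one, -Int.not_even_iff_odd] <;> grind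
  have e4 : compSum Q ((fun c => evenPart (ademCoeff a b) (c + 1)) + oddPart (ademCoeff a b) + (fun c => oddPart (ademCoeff a b) (c + 2))) (n - 3) m =
      compSum Q (oddPart (ademCoeff a (b - 2))) (n - 3) m := by
    refine compSum_congr _ _ fun c => ?_
    have p0 := bin_pascal (b - 2 - c) (a - 2 * c)
    have p1 := bin_pascal (b - 2 - c) (a - 2 * c - 1)
    have p2 := bin_pascal (b - 2 - c) (a - 2 * c - 2)
    have p3 := bin_pascal (b - 3 - c) (a - 2 * c)
    have p4 := bin_pascal (b - 3 - c) (a - 2 * c - 1)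
    have p5 := bin_pascal (b - 3 - c) (a - 2 * c - 2)
    have p6 := bin_pascal (b - 3 - c) (a - 2 * c - 3)
    have q0 := fun hc : ¬ Even c => bin_even_odd (m := b - 2 - c) (k := a - 2 * c - 3)
      (by grind) (by grind)
    by_cases hc : Even c <;> simp [evenPart, oddPart, ademCoeff, hc, Int.even_add_one, -Int.not_even_iff_odd] <;> grind
  simp only [compSum_add] at e1 e2 e3 e4
  linear_combination (norm := module) -(r * T) • e1 - r • e2 - r ^ 2 • e3 - r ^ 3 • e4

theorem SquareAction.adem_tau_odd_even (h : SquareAction T r Q) {m : V}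
    (hm : ∀ a b, Q a (Q b m) = ademSum T r Q a b m) {a b : ℤ} (ha : ¬ Even a) (hb : Even b) :
    Q a (Q b (T • m)) = ademSum T r Q a b (T • m) := by
  have ha1 : Even (a - 1) := by grind
  have ha2 : ¬ Even (a - 2) := by grind
  have hb1 : ¬ Even (b - 1) := by grind
  have hb2 : Even (b - 2) := by grind
  have hn : Odd (a + b) := by grind
  have hn1 : Even (a + b - 1) := by grind
  have hao : Odd a := by grind
  rw [h.map_tau_even _ _ hb]
  simp only [map_add, mul_smul, pow_two, h.map_rho, h.map_tau_odd _ _ hao, hm]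
  simp only [ademSum, ha, hb, ha1, hb1, ha2, hb2, if_true, if_false, h.compSum_rho, h.compSum_even_tau_odd _ _ hn, h.compSum_odd_tau_even _ _ hn1]
  simp only [show a + (b - 1) = a + b - 1 by ring, show a - 1 + b = a + b - 1 by ring, show a + (b - 2) = a + b - 2 by ring, show a - 2 + b = a + b - 2 by ring, show a - 1 + (b - 1) = a + b - 2 by ring, show a - 2 + (b - 1) = a + b - 3 by ring, show a + b - 1 - 1 = a + b - 2 by ring, show a + b - 1 - 2 = a + b - 3 by ring, show a + b - 2 - 1 = a + b - 3 by ring, show a - 1 - 1 = a - 2 by ring, show a - 2 - 1 = a - 3 by ring, show b - 1 - 1 = b - 2 by ring]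
  generalize hN : a + b = n
  have e1 : compSum Q ((fun c => evenPart (ademCoeff a b) (c + 1))) (n - 1) m =
      compSum Q (oddPart (ademCoeff (a - 1) b) + oddPart (ademCoeff a (b - 1))) (n - 1) m := by
    refine compSum_congr _ _ fun c => ?_
    have p0 := bin_pascal (b - 2 - c) (a - 2 * c)
    have p1 := bin_pascal (b - 2 - c) (a - 2 * c - 1)
    have q0 := fun hc : ¬ Even c => bin_even_odd (m := b - 1 - c) (k := a - 2 * c)
      (by grind) (by grind)
    by_cases hc : Even c <;> simp [evenPart, oddPart, ademCoeff, hc, Int.even_add_one, -Int.not_even_iff_odd] <;> grind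
  have e2 : compSum Q (evenPart (ademCoeff a b)) (n - 1) m =
      compSum Q (evenPart (ademCoeff (a - 1) b)) (n - 1) m := by
    refine compSum_congr _ _ fun c => ?_
    have p0 := bin_pascal (b - 1 - c) (a - 2 * c)
    have q0 := fun hc : Even c => bin_even_odd (m := b - c) (k := a - 2 * c)
      (by grind) (by grind)
    by_cases hc : Even c <;> simp [evenPart, oddPart, ademCoeff, hc, Int.even_add_one, -Int.not_even_iff_odd] <;> grind
  have e3 : compSum Q (evenPart (ademCoeff a b) + (fun c => evenPart (ademCoeff a b) (c + 1)) + oddPart (ademCoeff (a - 1) b) + (fun c => oddPart (ademCoeff (a - 1) b) (c + 1))) (n - 2) m =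
      compSum Q (evenPart (ademCoeff (a - 2) b) + evenPart (ademCoeff (a - 1) (b - 1)) + oddPart (ademCoeff (a - 1) (b - 1))) (n - 2) m := by
    refine compSum_congr _ _ fun c => ?_
    have p0 := bin_pascal (b - 2 - c) (a - 2 * c)
    have p1 := bin_pascal (b - 2 - c) (a - 2 * c - 1)
    have p2 := bin_pascal (b - 2 - c) (a - 2 * c - 2)
    have p3 := bin_pascal (b - 1 - c) (a - 2 * c)
    have p4 := bin_pascal (b - 1 - c) (a - 2 * c - 1)
    have q0 := fun hc : Even c => bin_even_odd (m := b - c) (k := a - 2 * c)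
      (by grind) (by grind)
    by_cases hc : Even c <;> simp [evenPart, oddPart, ademCoeff, hc, Int.even_add_one, -Int.not_even_iff_odd] <;> grind
  have e4 : compSum Q ((fun c => evenPart (ademCoeff a b) (c + 1)) + oddPart (ademCoeff (a - 1) b) + (fun c => oddPart (ademCoeff (a - 1) b) (c + 2))) (n - 3) m =
      compSum Q (oddPart (ademCoeff (a - 3) b) + oddPart (ademCoeff (a - 1) (b - 1)) + oddPart (ademCoeff (a - 2) (b - 1))) (n - 3) m := by
    refine compSum_congr _ _ fun c => ?_
    have p0 := bin_pascal (b - 2 - c) (a - 2 * c)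
    have p1 := bin_pascal (b - 2 - c) (a - 2 * c - 1)
    have p2 := bin_pascal (b - 2 - c) (a - 2 * c - 2)
    have p3 := bin_pascal (b - 2 - c) (a - 2 * c - 3)
    have p4 := bin_pascal (b - 3 - c) (a - 2 * c)
    have p5 := bin_pascal (b - 3 - c) (a - 2 * c - 1)
    have p6 := bin_pascal (b - 3 - c) (a - 2 * c - 2)
    have p7 := bin_pascal (b - 3 - c) (a - 2 * c - 3)
    have p8 := bin_pascal (b - 3 - c) (a - 2 * c - 4)
    have q0 := fun hc : ¬ Even c => bin_even_odd (m := b - 3 - c) (k := a - 2 * c - 2)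
      (by grind) (by grind)
    by_cases hc : Even c <;> simp [evenPart, oddPart, ademCoeff, hc, Int.even_add_one, -Int.not_even_iff_odd] <;> grind
  simp only [compSum_add] at e1 e2 e3 e4
  linear_combination (norm := module) -(r * T) • e1 - r • e2 - r ^ 2 • e3 - r ^ 3 • e4

theorem SquareAction.adem_tau (h : SquareAction T r Q) {m : V}
    (hm : ∀ a b, Q a (Q b m) = ademSum T r Q a b m) (a b : ℤ) :
    Q a (Q b (T • m)) = ademSum T r Q a b (T • m) := by
  by_cases ha : Even a <;> by_cases hb : Even b
  · exact h.adem_tau_even_even hm ha hb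
  · exact h.adem_tau_even_odd hm ha hb
  · exact h.adem_tau_odd_even hm ha hb
  · exact h.adem_tau_odd_odd hm ha hb

theorem ademSum_map_add (T r : R) (Q : ℤ → Module.End (ZMod 2) V) (a b : ℤ) (m m' : V) :
    ademSum T r Q a b (m + m') = ademSum T r Q a b m + ademSum T r Q a b m' := by
  simp only [ademSum, compSum_map_add, smul_add]
  split_ifs <;> abel

theorem SquareAction.ademSum_rho (h : SquareAction T r Q) (a b : ℤ) (m : V) :
    ademSum T r Q a b (r • m) = r • ademSum T r Q a b m := by
  simp only [ademSum, h.compSum_rho]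
  split_ifs <;> module

end Adem

/-! ### A representation of the Steenrod algebra on a free module of rank two. -/

/-- The coefficients of `Sq^n (τ ^ k)` in `𝔽₂[τ, ρ]`. -/
noncomputable def sqTau : ℕ → ℤ → M2R
  | 0, n => if n = 0 then 1 else 0
  | k + 1, n =>
    if Even n then MvPolynomial.X 0 * sqTau k n
      + MvPolynomial.X 1 * MvPolynomial.X 0 * sqTau k (n - 1)
    else MvPolynomial.X 0 * sqTau k n + MvPolynomial.X 1 * sqTau k (n - 1)
      + MvPolynomial.X 1 ^ 2 * sqTau k (n - 2)

theorem sqTau_of_neg (k : ℕ) {n : ℤ} (hn : n < 0) : sqTau k n = 0 := by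
  induction k generalizing n with
  | zero => simp [sqTau, hn.ne]
  | succ k ih =>
    rw [sqTau, ih hn, ih (n := n - 1) (by lia), ih (n := n - 2) (by lia)]
    simp

/-- The action of `Sq^n` on the coefficient ring `𝔽₂[τ, ρ]`. -/
noncomputable def sqCoeff (n : ℤ) : M2R →ₗ[ZMod 2] M2R :=
  (MvPolynomial.basisMonomials (Fin 2) (ZMod 2)).constr (ZMod 2)
    fun d => MvPolynomial.X 1 ^ d 1 * sqTau (d 0) n

theorem sqCoeff_monomial (n : ℤ) (d : Fin 2 →₀ ℕ) :
    sqCoeff n (MvPolynomial.monomial d 1) = MvPolynomial.X 1 ^ d 1 * sqTau (d 0) n := by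
  have := (MvPolynomial.basisMonomials (Fin 2) (ZMod 2)).constr_basis (ZMod 2)
    (fun d => (MvPolynomial.X 1 ^ d 1 * sqTau (d 0) n : M2R)) d
  rwa [MvPolynomial.coe_basisMonomials] at this

theorem sqCoeff_one (n : ℤ) : sqCoeff n 1 = if n = 0 then 1 else 0 := by
  have := sqCoeff_monomial n 0
  rw [MvPolynomial.monomial_zero', map_one] at this
  rw [this]
  simp [sqTau]

theorem sqCoeff_of_neg {n : ℤ} (hn : n < 0) : sqCoeff n = 0 := by
  refine (MvPolynomial.basisMonomials (Fin 2) (ZMod 2)).ext fun d => ?_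
  rw [MvPolynomial.coe_basisMonomials, sqCoeff_monomial, sqTau_of_neg _ hn]
  simp

theorem X_mul_monomial_one (i : Fin 2) (d : Fin 2 →₀ ℕ) :
    (MvPolynomial.X i * MvPolynomial.monomial d 1 : M2R) =
      MvPolynomial.monomial (Finsupp.single i 1 + d) 1 := by
  rw [MvPolynomial.X, MvPolynomial.monomial_mul, one_mul]

theorem sqCoeff_rho (n : ℤ) (f : M2R) :
    sqCoeff n (MvPolynomial.X 1 * f) = MvPolynomial.X 1 * sqCoeff n f := by
  suffices h : sqCoeff n ∘ₗ LinearMap.mulLeft (ZMod 2) (MvPolynomial.X 1) =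
      LinearMap.mulLeft (ZMod 2) (MvPolynomial.X 1) ∘ₗ sqCoeff n from LinearMap.congr_fun h f
  refine (MvPolynomial.basisMonomials (Fin 2) (ZMod 2)).ext fun d => ?_
  simp only [MvPolynomial.coe_basisMonomials, LinearMap.comp_apply, LinearMap.mulLeft_apply,
    X_mul_monomial_one, sqCoeff_monomial]
  simp [pow_add, mul_assoc]

theorem sqCoeff_tau_even {n : ℤ} (hn : Even n) (f : M2R) :
    sqCoeff n (MvPolynomial.X 0 * f) = MvPolynomial.X 0 * sqCoeff n f
      + MvPolynomial.X 1 * MvPolynomial.X 0 * sqCoeff (n - 1) f := by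
  suffices h : sqCoeff n ∘ₗ LinearMap.mulLeft (ZMod 2) (MvPolynomial.X 0) =
      LinearMap.mulLeft (ZMod 2) (MvPolynomial.X 0) ∘ₗ sqCoeff n
        + LinearMap.mulLeft (ZMod 2) (MvPolynomial.X 1 * MvPolynomial.X 0) ∘ₗ sqCoeff (n - 1)
    from LinearMap.congr_fun h f
  refine (MvPolynomial.basisMonomials (Fin 2) (ZMod 2)).ext fun d => ?_
  simp only [MvPolynomial.coe_basisMonomials, LinearMap.comp_apply, LinearMap.mulLeft_apply,
    X_mul_monomial_one, sqCoeff_monomial, LinearMap.add_apply, Finsupp.add_apply,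
    Finsupp.single_eq_same, add_comm 1, sqTau, if_pos hn]
  simp
  ring

theorem sqCoeff_tau_odd {n : ℤ} (hn : Odd n) (f : M2R) :
    sqCoeff n (MvPolynomial.X 0 * f) = MvPolynomial.X 0 * sqCoeff n f
      + MvPolynomial.X 1 * sqCoeff (n - 1) f + MvPolynomial.X 1 ^ 2 * sqCoeff (n - 2) f := by
  suffices h : sqCoeff n ∘ₗ LinearMap.mulLeft (ZMod 2) (MvPolynomial.X 0) =
      LinearMap.mulLeft (ZMod 2) (MvPolynomial.X 0) ∘ₗ sqCoeff n
        + LinearMap.mulLeft (ZMod 2) (MvPolynomial.X 1) ∘ₗ sqCoeff (n - 1)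
        + LinearMap.mulLeft (ZMod 2) (MvPolynomial.X 1 ^ 2) ∘ₗ sqCoeff (n - 2)
    from LinearMap.congr_fun h f
  refine (MvPolynomial.basisMonomials (Fin 2) (ZMod 2)).ext fun d => ?_
  simp only [MvPolynomial.coe_basisMonomials, LinearMap.comp_apply, LinearMap.mulLeft_apply,
    X_mul_monomial_one, sqCoeff_monomial, LinearMap.add_apply, Finsupp.add_apply,
    Finsupp.single_eq_same, add_comm 1, sqTau, if_neg (Int.not_even_iff_odd.2 hn)]
  simp
  ring

/-- The action of `Sq^n` on the free `𝔽₂[τ, ρ]`-module on two classes `u`, `v` with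
`Sq^2 u = v`. -/
noncomputable def sqPair (n : ℤ) : Module.End (ZMod 2) (M2R × M2R) :=
  (sqCoeff n ∘ₗ LinearMap.fst _ _ _).prod
    (sqCoeff n ∘ₗ LinearMap.snd _ _ _ + sqCoeff (n - 2) ∘ₗ LinearMap.fst _ _ _)

theorem sqPair_apply (n : ℤ) (m : M2R × M2R) :
    sqPair n m = (sqCoeff n m.1, sqCoeff n m.2 + sqCoeff (n - 2) m.1) := rfl

theorem squareAction_sqPair :
    SquareAction (MvPolynomial.X 0 : M2R) (MvPolynomial.X 1) sqPair where
  of_neg n hn := by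
    rw [sqPair, sqCoeff_of_neg hn, sqCoeff_of_neg (n := n - 2) (by lia)]
    simp
    rfl
  map_rho n m := by
    simp only [sqPair_apply, Prod.smul_fst, Prod.smul_snd, smul_eq_mul, sqCoeff_rho, Prod.smul_mk,
      mul_add]
  map_tau_even n m hn := by
    have hn2 : Even (n - 2) := by grind
    simp only [sqPair_apply, Prod.smul_fst, Prod.smul_snd, smul_eq_mul, sqCoeff_tau_even hn,
      sqCoeff_tau_even hn2, Prod.smul_mk, Prod.mk_add_mk, Prod.mk.injEq, true_and]
    rw [show n - 2 - 1 = n - 1 - 2 by ring]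
    ring
  map_tau_odd n m hn := by
    have hn2 : Odd (n - 2) := by grind
    simp only [sqPair_apply, Prod.smul_fst, Prod.smul_snd, smul_eq_mul, sqCoeff_tau_odd hn,
      sqCoeff_tau_odd hn2, Prod.smul_mk, Prod.mk_add_mk, Prod.mk.injEq, true_and]
    rw [show n - 2 - 1 = n - 1 - 2 by ring]
    ring

theorem sqPair_inl (n : ℤ) :
    sqPair n (1, 0) = (if n = 0 then (1, 0) else 0) + if n = 2 then (0, 1) else 0 := by
  have h : n - 2 = 0 ↔ n = 2 := by lia
  simp only [sqPair_apply, sqCoeff_one, map_zero, zero_add, h]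
  split_ifs <;> simp

theorem sqPair_inr (n : ℤ) : sqPair n (0, 1) = if n = 0 then (0, 1) else 0 := by
  simp only [sqPair_apply, sqCoeff_one, map_zero, add_zero]
  split_ifs <;> rfl

theorem compSum_sqPair_inr (f : ℤ → ZMod 2) (n : ℤ) :
    compSum sqPair f n (0, 1) = f 0 • sqPair n (0, 1) := by
  by_cases hn : n < 0
  · rw [squareAction_sqPair.of_neg n hn, compSum, Finset.Icc_eq_empty (by lia)]
    simp
  · rw [compSum, Finset.sum_eq_single 0]
    · simp [sqPair_inr 0]
    · intro c _ hc
      simp [sqPair_inr c, hc]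
    · intro h; simp at h; lia

theorem compSum_sqPair_inl (f : ℤ → ZMod 2) (n : ℤ) :
    compSum sqPair f n (1, 0) = f 0 • sqPair n (1, 0) + f 2 • sqPair (n - 2) (0, 1) := by
  have h (c : ℤ) : f c • sqPair (n - c) (sqPair c (1, 0)) =
      (if c = 0 then f 0 • sqPair n (1, 0) else 0) +
        if c = 2 then f 2 • sqPair (n - 2) (0, 1) else 0 := by
    rw [sqPair_inl c]
    by_cases h0 : c = 0
    · subst h0; simp
    · by_cases h2 : c = 2
      · subst h2; simp
      · simp [h0, h2]
  simp only [compSum, h, Finset.sum_add_distrib, Finset.sum_ite_eq', Finset.mem_Icc]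
  congr 1
  · split_ifs with h
    · rfl
    · rw [squareAction_sqPair.of_neg n (by lia)]; simp
  · split_ifs with h
    · rfl
    · rw [squareAction_sqPair.of_neg (n - 2) (by lia)]; simp

theorem bin_neg_one_two : bin (-1) 2 = 1 := by
  have h1 := bin_pascal (-1) 2
  have h2 := bin_pascal (-1) 1
  norm_num [bin_zero_left, bin_zero_right] at h1 h2
  grind

theorem bin_diag (a : ℤ) : bin (-1 - a) a = if a = 0 then 1 else 0 := by
  split_ifs with h
  · rw [h, bin_zero_right]
  · rcases lt_or_gt_of_ne h with h | h
    · exact bin_of_neg _ h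
    · exact bin_central h

theorem adem_sqPair_inr (a b : ℤ) :
    sqPair a (sqPair b (0, 1)) =
      ademSum (MvPolynomial.X 0 : M2R) (MvPolynomial.X 1) sqPair a b (0, 1) := by
  have hd := bin_diag a
  by_cases hab : a + b = 0
  · obtain rfl : b = -a := by lia
    have hd' : bin (-a - 1) a = if a = 0 then 1 else 0 := by rw [← hd]; congr 1; ring
    by_cases ha : Even a <;>
    simp [ademSum, compSum_sqPair_inr, sqPair_inr, evenPart, oddPart, ademCoeff, ha, hd']
    · split_ifs <;> simp_all [sqPair_inr]
    · rw [if_neg (by grind)]; simp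
  · have hl : sqPair a (sqPair b (0, 1)) = 0 := by
      rw [sqPair_inr]
      split_ifs with h
      · rw [sqPair_inr, if_neg (by lia)]
      · simp
    rw [hl]
    simp [ademSum, compSum_sqPair_inr, sqPair_inr, evenPart, oddPart, hab]

/-- Only the totals `0` and `2` can contribute on `u`. In total `2` the terms `c = 0` and `c = 2`
both land on `v`, and for even `a` their coefficients sum to `1` exactly for `a = 0` and `a = 2`, by
`bin_central_sub`; for odd `a` both sides vanish. -/
theorem adem_sqPair_inl (a b : ℤ) :
    sqPair a (sqPair b (1, 0)) =
      ademSum (MvPolynomial.X 0 : M2R) (MvPolynomial.X 1) sqPair a b (1, 0) := by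
  have hd := bin_diag a
  by_cases hab : a + b = 0
  · obtain rfl : b = -a := by lia
    have hd' : bin (-a - 1) a = if a = 0 then 1 else 0 := by rw [← hd]; congr 1; ring
    by_cases ha : Even a
    · simp only [ademSum, compSum_sqPair_inl, sqPair_inl, sqPair_inr, evenPart, oddPart, ademCoeff,
        ha, even_neg, hab, sub_zero, mul_zero, hd']
      by_cases h0 : a = 0
      · simp [h0, sqPair_inl 0]
      · have h2 : a = -2 → sqPair a = 0 := fun h => squareAction_sqPair.of_neg a (by lia)
        by_cases h3 : a = -2
        · simp [h0, h2 h3]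
        · simp [h0, show -a ≠ 2 by lia]
    · have h0 : a ≠ 0 := by grind
      have h2 : -a ≠ 2 := by grind
      simp [ademSum, compSum_sqPair_inl, sqPair_inl, sqPair_inr, evenPart, oddPart, ademCoeff,
        ha, even_neg, hab, h0, h2]
  by_cases hab2 : a + b = 2
  · obtain rfl : b = 2 - a := by lia
    by_cases ha : Even a
    · have hb : Even (2 - a) := by grind
      have hs : ademCoeff a (2 - a) 0 + ademCoeff a (2 - a) 2 =
          if a = 0 ∨ a = 2 then 1 else 0 := by
        rw [ademCoeff, ademCoeff, show 2 - a - 1 - 0 = 1 - a by ring,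
          show 2 - a - 1 - 2 = -1 - a by ring, show a - 2 * 0 = a by ring,
          show a - 2 * 2 = a - 4 by ring]
        split_ifs with h
        · rcases h with rfl | rfl
          · rw [bin_zero_right, bin_of_neg _ (by lia), add_zero]
          · rw [bin_of_neg (k := 2 - 4) _ (by lia), add_zero]
            exact bin_neg_one_two
        · rw [not_or] at h
          exact bin_central_sub h.1 h.2
      have hr : ademSum (MvPolynomial.X 0 : M2R) (MvPolynomial.X 1) sqPair a (2 - a) (1, 0) =
          (if a = 0 ∨ a = 2 then 1 else 0 : ZMod 2) • (0, 1) := by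
        rw [← hs, add_smul]
        simp [ademSum, compSum_sqPair_inl, evenPart, oddPart, ha, hb, sqPair_inl 2, sqPair_inr 0]
      rw [hr]
      by_cases h0 : a = 0
      · subst h0
        simp [sqPair_inl 2, sqPair_inr 0]
      · by_cases h2 : a = 2
        · subst h2
          simp [sqPair_inl 0, sqPair_inl 2]
        · have h3 : 2 - a ≠ 0 := by lia
          simp [sqPair_inl (2 - a), h0, h2, h3, sqPair_inr a]
    · have h0 : a ≠ 0 := by grind
      have h1 : 2 - a ≠ 0 := by grind
      have hb : ¬ Even (2 - a) := by grind
      simp [ademSum, compSum_sqPair_inl, sqPair_inl (2 - a), sqPair_inr a, evenPart, oddPart, ha,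
        hb, h0, h1]
  · have hl : sqPair a (sqPair b (1, 0)) = 0 := by
      rw [sqPair_inl]
      by_cases h0 : b = 0
      · have : a ≠ 0 := by lia
        have : a ≠ 2 := by lia
        simp [h0, sqPair_inl a, *]
      · by_cases h2 : b = 2
        · have : a ≠ 0 := by lia
          simp [h2, sqPair_inr a, *]
        · simp [h0, h2]
    rw [hl]
    have h2 : a + b - 2 ≠ 0 := by lia
    simp [ademSum, compSum_sqPair_inl, sqPair_inr, sqPair_inl, evenPart, oddPart, hab, hab2, h2]

theorem adem_smul {w : M2R × M2R}
    (hw : ∀ a b, sqPair a (sqPair b w) =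
      ademSum (MvPolynomial.X 0 : M2R) (MvPolynomial.X 1) sqPair a b w) (f : M2R) (a b : ℤ) :
    sqPair a (sqPair b (f • w)) =
      ademSum (MvPolynomial.X 0 : M2R) (MvPolynomial.X 1) sqPair a b (f • w) := by
  induction f using MvPolynomial.induction_on generalizing a b with
  | C x =>
    obtain rfl | rfl : x = 0 ∨ x = 1 := by revert x; decide
    · simp [ademSum, compSum]
    · simpa using hw a b
  | add p q hp hq => simp only [add_smul, map_add, hp, hq, ademSum_map_add]
  | mul_X p i hp =>
    rw [mul_comm, mul_smul]
    fin_cases i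
    · exact squareAction_sqPair.adem_tau hp a b
    · simp only [Fin.mk_one, squareAction_sqPair.map_rho, hp, squareAction_sqPair.ademSum_rho]

/-- The Adem relations hold for the operators `sqPair`. -/
theorem adem_sqPair (a b : ℤ) (m : M2R × M2R) :
    sqPair a (sqPair b m) =
      ademSum (MvPolynomial.X 0 : M2R) (MvPolynomial.X 1) sqPair a b m := by
  have h : m = m.1 • ((1, 0) : M2R × M2R) + m.2 • ((0, 1) : M2R × M2R) := by simp
  rw [h]
  simp only [map_add, ademSum_map_add, adem_smul adem_sqPair_inl, adem_smul adem_sqPair_inr]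

/-- Passes from integer to natural indices. The cutoff `k` will be `a / 2 + 1`, since Adem
coefficients have negative lower entry beyond it. -/
theorem compSum_eq_sum_range {V : Type*} [AddCommGroup V] [Module (ZMod 2) V]
    (Q : ℤ → Module.End (ZMod 2) V) (f : ℤ → ZMod 2) {n : ℤ} {N k : ℕ} (hn : n = N)
    (hk : k ≤ N + 1) (hf : ∀ c : ℕ, k ≤ c → f c = 0) (m : V) :
    compSum Q f n m = ∑ c ∈ Finset.range k, f c • Q ((N - c : ℕ) : ℤ) (Q c m) := by
  have h1 : compSum Q f n m = ∑ c ∈ Finset.range (N + 1), f c • Q ((N - c : ℕ) : ℤ) (Q c m) := by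
    subst hn
    refine Finset.sum_bij' (fun c _ => c.toNat) (fun c _ => c) ?_ ?_ ?_ ?_ ?_
    · intro c hc; simp only [Finset.mem_Icc, Finset.mem_range] at *; lia
    · intro c hc; simp only [Finset.mem_Icc, Finset.mem_range] at *; lia
    · intro c hc; simp only [Finset.mem_Icc] at hc; lia
    · intro c hc; simp
    · intro c hc
      simp only [Finset.mem_Icc] at hc
      rw [Int.toNat_of_nonneg hc.1, Nat.cast_sub (by lia), Int.toNat_of_nonneg hc.1]
  rw [h1]
  refine (Finset.sum_subset (by simpa using hk) fun c _ hc => ?_).symm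
  rw [hf c (by simpa using hc), zero_smul]

theorem ademCoeff_natCast {a b c : ℕ} (hc : 2 * c ≤ a) (hab : a < 2 * b) :
    ademCoeff a b c = ((b - 1 - c).choose (a - 2 * c) : ZMod 2) := by
  rw [← bin_natCast, ademCoeff]
  congr 1 <;> lia

theorem ademCoeff_of_lt {a b c : ℤ} (hc : a < 2 * c) : ademCoeff a b c = 0 :=
  bin_of_neg _ (by lia)

/-- The endomorphisms of `𝔽₂[τ, ρ]²` assigned to the generators of the Steenrod algebra. -/
noncomputable def genAction : Gen → Module.End (ZMod 2) (M2R × M2R)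
  | Gen.tau => Module.toModuleEnd (ZMod 2) (S := M2R) (M2R × M2R) (MvPolynomial.X 0)
  | Gen.rho => Module.toModuleEnd (ZMod 2) (S := M2R) (M2R × M2R) (MvPolynomial.X 1)
  | Gen.sq n => sqPair n

theorem lift_genAction_tau (m : M2R × M2R) :
    FreeAlgebra.lift (ZMod 2) genAction fτ m = (MvPolynomial.X 0 : M2R) • m := by
  rw [FreeAlgebra.lift_ι_apply]; rfl

theorem lift_genAction_rho (m : M2R × M2R) :
    FreeAlgebra.lift (ZMod 2) genAction fρ m = (MvPolynomial.X 1 : M2R) • m := by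
  rw [FreeAlgebra.lift_ι_apply]; rfl

theorem lift_genAction_sq (n : ℕ) (m : M2R × M2R) :
    FreeAlgebra.lift (ZMod 2) genAction (fSq n) m = sqPair n m := by
  rw [FreeAlgebra.lift_ι_apply]; rfl

theorem sqTau_zero_right (k : ℕ) : sqTau k 0 = MvPolynomial.X 0 ^ k := by
  induction k with
  | zero => simp [sqTau]
  | succ k ih =>
    rw [sqTau, if_pos Even.zero, ih, sqTau_of_neg k (by norm_num)]
    ring

theorem sqPair_zero : sqPair 0 = 1 := by
  have h0 : sqCoeff 0 = LinearMap.id := by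
    refine (MvPolynomial.basisMonomials (Fin 2) (ZMod 2)).ext fun d => ?_
    rw [MvPolynomial.coe_basisMonomials, sqCoeff_monomial, sqTau_zero_right, LinearMap.id_apply]
    change _ = MvPolynomial.monomial d 1
    rw [MvPolynomial.monomial_eq, Finsupp.prod_fintype _ _ (by simp), Fin.prod_univ_two]
    simp [mul_comm]
  refine LinearMap.ext fun m => ?_
  rw [sqPair_apply, h0, sqCoeff_of_neg (n := 0 - 2) (by norm_num)]
  simp

/-- The Adem relations imposed are the cases `0 < a < 2 * b` of `adem_sqPair`: the bound makes the
upper entries nonnegative for `2 * c ≤ a`, so integer binomials become natural ones. -/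
theorem lift_genAction_rel {x y : FreeSteenrod} (h : Rel x y) :
    FreeAlgebra.lift (ZMod 2) genAction x = FreeAlgebra.lift (ZMod 2) genAction y := by
  have hQ := squareAction_sqPair
  refine LinearMap.ext fun m => ?_
  cases h with
  | tau_rho =>
    simp only [map_mul, Module.End.mul_apply, lift_genAction_tau, lift_genAction_rho]
    exact smul_comm _ _ _
  | sq_zero =>
    rw [lift_genAction_sq, map_one, Nat.cast_zero, sqPair_zero]
  | sq_rho n =>
    simp only [map_mul, Module.End.mul_apply, lift_genAction_sq, lift_genAction_rho, hQ.map_rho]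
  | sq_one_tau =>
    simp only [map_mul, map_add, Module.End.mul_apply, LinearMap.add_apply, lift_genAction_sq,
      lift_genAction_rho, lift_genAction_tau]
    rw [Nat.cast_one, hQ.map_tau_odd _ _ (by norm_num), sub_self, sqPair_zero,
      hQ.of_neg (1 - 2) (by norm_num)]
    simp
  | sq_even_tau i =>
    simp only [map_mul, map_add, Module.End.mul_apply, LinearMap.add_apply, lift_genAction_sq,
      lift_genAction_rho, lift_genAction_tau, Nat.cast_add, Nat.cast_mul, Nat.cast_ofNat,
      Nat.cast_one]
    rw [hQ.map_tau_even _ _ (by grind), mul_smul]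
    ring_nf
  | sq_odd_tau i =>
    simp only [map_mul, map_add, map_pow, Module.End.mul_apply, LinearMap.add_apply, pow_two,
      lift_genAction_sq,
      lift_genAction_rho, lift_genAction_tau, Nat.cast_add, Nat.cast_mul, Nat.cast_ofNat,
      Nat.cast_one]
    rw [hQ.map_tau_odd _ _ (by grind), pow_two, mul_smul]
    ring_nf
  | adem_even_even a b ha hab hae hbe =>
    rw [map_mul, Module.End.mul_apply, lift_genAction_sq, lift_genAction_sq, adem_sqPair, ademSum,
      if_pos (by simpa using hae), if_pos (by simpa using hbe),
      compSum_eq_sum_range (N := a + b) (k := a / 2 + 1) _ _ (by simp) (by lia),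
      compSum_eq_sum_range (N := a + b) (k := a / 2 + 1) _ _ (by simp) (by lia),
      Finset.smul_sum, ← Finset.sum_add_distrib, map_sum, LinearMap.sum_apply]
    · refine Finset.sum_congr rfl fun c hc => ?_
      simp only [Finset.mem_range] at hc
      rw [map_nsmul, map_mul, map_mul, map_pow, LinearMap.smul_apply, Module.End.mul_apply,
        Module.End.mul_apply, lift_genAction_sq, lift_genAction_sq, ← Nat.cast_smul_eq_nsmul (ZMod 2),
        ← ademCoeff_natCast (by lia) hab]
      rcases Nat.even_or_odd c with hc | hc
      · simp [evenPart, oddPart, hc, Nat.even_iff.1 hc]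
      · rw [Nat.odd_iff.1 hc, pow_one, lift_genAction_tau]
        simp [evenPart, oddPart, Nat.not_even_iff_odd.2 hc,
          -Int.not_even_iff_odd, -Nat.not_even_iff_odd, smul_comm _ (MvPolynomial.X 0 : M2R)]
    · intro c hc; simp [oddPart, ademCoeff_of_lt (show (a : ℤ) < 2 * c by lia)]
    · intro c hc; simp [evenPart, ademCoeff_of_lt (show (a : ℤ) < 2 * c by lia)]
  | adem_even_odd a b ha hab hae hbo =>
    rw [map_mul, Module.End.mul_apply, lift_genAction_sq, lift_genAction_sq, adem_sqPair, ademSum,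
      if_pos (by simpa using hae), if_neg (by simpa using hbo),
      compSum_eq_sum_range (N := a + b) (k := a / 2 + 1) _ _ (by simp) (by lia),
      compSum_eq_sum_range (N := a + b) (k := a / 2 + 1) _ _ (by simp) (by lia),
      compSum_eq_sum_range (N := a + b - 1) (k := a / 2 + 1) _ _ (by lia) (by lia),
      Finset.smul_sum, ← Finset.sum_add_distrib, Finset.sum_filter, map_add, map_sum, map_sum,
      LinearMap.add_apply, LinearMap.sum_apply, LinearMap.sum_apply]
    · congr 1
      · refine Finset.sum_congr rfl fun c hc => ?_
        simp only [Finset.mem_range] at hc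
        rw [map_nsmul, map_mul, LinearMap.smul_apply, Module.End.mul_apply,
          lift_genAction_sq, lift_genAction_sq, ← Nat.cast_smul_eq_nsmul (ZMod 2),
          ← ademCoeff_natCast (by lia) hab]
        rcases Nat.even_or_odd c with hc | hc
        · simp [evenPart, oddPart, hc]
        · simp [evenPart, oddPart, Nat.not_even_iff_odd.2 hc, -Int.not_even_iff_odd,
            -Nat.not_even_iff_odd]
      · refine Finset.sum_congr rfl fun c hc => ?_
        simp only [Finset.mem_range] at hc
        rcases Nat.even_or_odd c with hc' | hc'
        · simp [oddPart, hc', Nat.not_odd_iff_even.2 hc', -Nat.not_odd_iff_even]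
        · rw [if_pos hc', map_nsmul, map_mul, map_mul, LinearMap.smul_apply, Module.End.mul_apply,
            Module.End.mul_apply, lift_genAction_sq, lift_genAction_sq, lift_genAction_rho,
            ← Nat.cast_smul_eq_nsmul (ZMod 2), ← ademCoeff_natCast (by lia) hab,
            show a + b - c - 1 = a + b - 1 - c by lia]
          simp [oddPart, Nat.not_even_iff_odd.2 hc', -Int.not_even_iff_odd,
            -Nat.not_even_iff_odd, smul_comm _ (MvPolynomial.X 1 : M2R)]
    · intro c hc; simp [oddPart, ademCoeff_of_lt (show (a : ℤ) < 2 * c by lia)]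
    · intro c hc; simp [oddPart, ademCoeff_of_lt (show (a : ℤ) < 2 * c by lia)]
    · intro c hc; simp [evenPart, ademCoeff_of_lt (show (a : ℤ) < 2 * c by lia)]
  | adem_odd_even a b ha hab hao hbe =>
    rw [map_mul, Module.End.mul_apply, lift_genAction_sq, lift_genAction_sq, adem_sqPair, ademSum,
      if_neg (by simpa using hao), if_pos (by simpa using hbe),
      compSum_eq_sum_range (N := a + b) (k := a / 2 + 1) _ _ (by simp) (by lia),
      compSum_eq_sum_range (N := a + b - 1) (k := a / 2 + 1) _ _ (by lia) (by lia),
      Finset.smul_sum, Finset.sum_filter, Finset.sum_filter, map_add, map_sum, map_sum,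
      LinearMap.add_apply, LinearMap.sum_apply, LinearMap.sum_apply]
    · congr 1
      · refine Finset.sum_congr rfl fun c hc => ?_
        simp only [Finset.mem_range] at hc
        rcases Nat.even_or_odd c with hc' | hc'
        · rw [if_pos hc', map_nsmul, map_mul, LinearMap.smul_apply, Module.End.mul_apply,
            lift_genAction_sq, lift_genAction_sq, ← Nat.cast_smul_eq_nsmul (ZMod 2),
            ← ademCoeff_natCast (by lia) hab]
          simp [evenPart, hc']
        · simp [evenPart, Nat.not_even_iff_odd.2 hc', -Int.not_even_iff_odd,
            -Nat.not_even_iff_odd]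
      · refine Finset.sum_congr rfl fun c hc => ?_
        simp only [Finset.mem_range] at hc
        rcases Nat.even_or_odd c with hc' | hc'
        · simp [oddPart, hc', Nat.not_odd_iff_even.2 hc', -Nat.not_odd_iff_even]
        · have hc2 : 2 * c ≤ a - 1 := by obtain ⟨k, rfl⟩ := hao; lia
          rw [if_pos hc', map_nsmul, map_mul, map_mul, LinearMap.smul_apply, Module.End.mul_apply,
            Module.End.mul_apply, lift_genAction_sq, lift_genAction_sq, lift_genAction_rho,
            ← Nat.cast_smul_eq_nsmul (ZMod 2), ← ademCoeff_natCast hc2 (by lia),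
            show a + b - c - 1 = a + b - 1 - c by lia, Nat.cast_sub (Nat.one_le_of_lt ha)]
          simp [oddPart, Nat.not_even_iff_odd.2 hc', -Int.not_even_iff_odd,
            -Nat.not_even_iff_odd, smul_comm _ (MvPolynomial.X 1 : M2R)]
    · intro c hc; simp [oddPart, ademCoeff_of_lt (show (a : ℤ) - 1 < 2 * c by lia)]
    · intro c hc; simp [evenPart, ademCoeff_of_lt (show (a : ℤ) < 2 * c by lia)]
  | adem_odd_odd a b ha hab hao hbo =>
    rw [map_mul, Module.End.mul_apply, lift_genAction_sq, lift_genAction_sq, adem_sqPair, ademSum,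
      if_neg (by simpa using hao), if_neg (by simpa using hbo),
      compSum_eq_sum_range (N := a + b) (k := a / 2 + 1) _ _ (by simp) (by lia),
      Finset.sum_filter, map_sum, LinearMap.sum_apply]
    · refine Finset.sum_congr rfl fun c hc => ?_
      simp only [Finset.mem_range] at hc
      rcases Nat.even_or_odd c with hc' | hc'
      · simp [oddPart, hc', Nat.not_odd_iff_even.2 hc', -Nat.not_odd_iff_even]
      · rw [if_pos hc', map_nsmul, map_mul, LinearMap.smul_apply, Module.End.mul_apply,
          lift_genAction_sq, lift_genAction_sq, ← Nat.cast_smul_eq_nsmul (ZMod 2),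
          ← ademCoeff_natCast (by lia) hab]
        simp [oddPart, Nat.not_even_iff_odd.2 hc', -Int.not_even_iff_odd,
          -Nat.not_even_iff_odd]
    · intro c hc; simp [oddPart, ademCoeff_of_lt (show (a : ℤ) < 2 * c by lia)]

/-- The representation of the Steenrod algebra on `𝔽₂[τ, ρ]²`. -/
noncomputable def steenrodAction : Steenrod →ₐ[ZMod 2] Module.End (ZMod 2) (M2R × M2R) :=
  RingQuot.liftAlgHom (ZMod 2) ⟨FreeAlgebra.lift (ZMod 2) genAction, fun _ _ => lift_genAction_rel⟩

theorem steenrodAction_toSteenrod (x : FreeSteenrod) :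
    steenrodAction (toSteenrod x) = FreeAlgebra.lift (ZMod 2) genAction x :=
  RingQuot.liftAlgHom_mkAlgHom_apply ..

/-! ### The basis of eight words of `A1` over the coefficients. -/

/-- The `𝔽₂[τ, ρ]`-module underlying an `𝒜(1)^ℝ`-module. -/
noncomputable abbrev coeffModule (M : Type*) [AddCommGroup M] [Module A1 M] : Module M2R M :=
  Module.compHom M coeff.toRingHom

attribute [local instance] coeffModule

theorem coeff_smul {M : Type*} [AddCommGroup M] [Module A1 M] (r : M2R) (m : M) :
    r • m = coeff r • m := rfl

theorem coeff_smul_eq_mul (r : M2R) (a : A1) : r • a = coeff r * a := rfl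

theorem coeff_X_zero : coeff (MvPolynomial.X 0) = τ := by
  refine (AddMonoidAlgebra.lift_single _ _ _).trans ?_
  simp

theorem coeff_X_one : coeff (MvPolynomial.X 1) = ρ := by
  refine (AddMonoidAlgebra.lift_single _ _ _).trans ?_
  simp

/-- The words in `Sq^1` and `Sq^2` that form a basis of `𝒜(1)^ℝ` over `𝔽₂[τ, ρ]`. -/
noncomputable def word : Fin 8 → A1 :=
  ![1, Sq1, Sq2, Sq1 * Sq2, Sq2 * Sq1, Sq1 * Sq2 * Sq1, Sq2 * Sq1 * Sq2, Sq1 * Sq2 * Sq1 * Sq2]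

theorem A1_add_self (a : A1) : a + a = 0 := by
  have h : (1 + 1 : ZMod 2) • a = 0 := by rw [zmod_two_add_self, zero_smul]
  rwa [add_smul, one_smul] at h

theorem Sq1_mul_Sq1 : Sq1 * Sq1 = 0 := by
  apply Subtype.ext
  have h := toSteenrod_rel (Rel.adem_odd_odd 1 1 (by norm_num) (by norm_num) (by decide) (by decide))
  simpa [Finset.sum_filter, Sq1] using h

theorem toSteenrod_Sq3 : toSteenrod (fSq 3) = toSteenrod (fSq 1) * toSteenrod (fSq 2) := by
  have h := toSteenrod_rel (Rel.adem_odd_even 1 2 (by norm_num) (by norm_num) (by decide) (by decide))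
  have h0 := toSteenrod_rel Rel.sq_zero
  simp [Finset.sum_filter, h0] at h
  exact h.symm

theorem Sq2_mul_Sq2 : Sq2 * Sq2 = τ * (Sq1 * (Sq2 * Sq1)) := by
  apply Subtype.ext
  have h := toSteenrod_rel (Rel.adem_even_even 2 2 (by norm_num) (by norm_num) (by decide) (by decide))
  simp [Finset.sum_range_succ, toSteenrod_Sq3] at h
  simpa [Sq2, τ, Sq1, mul_assoc] using h

/-- Both sides equal `Sq^1 Sq^4 Sq^1`. -/
theorem Sq2_mul_Sq1_mul_Sq2_mul_Sq1 :
    Sq2 * (Sq1 * (Sq2 * Sq1)) = Sq1 * (Sq2 * (Sq1 * Sq2)) := by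
  apply Subtype.ext
  have h := toSteenrod_rel (Rel.adem_even_odd 2 3 (by norm_num) (by norm_num) (by decide) (by decide))
  have h' := toSteenrod_rel (Rel.adem_odd_even 1 4 (by norm_num) (by norm_num) (by decide) (by decide))
  have h0 := toSteenrod_rel Rel.sq_zero
  have h1 : toSteenrod (fSq 1) * toSteenrod (fSq 1) = 0 := congrArg Subtype.val Sq1_mul_Sq1
  have h2 : toSteenrod (fSq 1) * toSteenrod fρ = toSteenrod fρ * toSteenrod (fSq 1) :=
    congrArg Subtype.val Sq1_mul_ρ
  have h3 : (3 : FreeSteenrod) = 1 := by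
    have h := congrArg (algebraMap (ZMod 2) FreeSteenrod) (show ((3 : ℕ) : ZMod 2) = 1 by decide)
    rwa [map_natCast, map_one] at h
  simp [Finset.sum_range_succ, Finset.sum_filter, toSteenrod_Sq3, h0, h3] at h h'
  -- With `Sq^5 = Sq^1 Sq^4` this reads `Sq^2 Sq^1 Sq^2 = Sq^1 Sq^4 + Sq^4 Sq^1 + ρ Sq^1 Sq^2 Sq^1`.
  -- Multiplying by `Sq^1` on either side leaves `Sq^1 Sq^4 Sq^1`, because `Sq^1 Sq^1 = 0` and `ρ`
  -- commutes with `Sq^1`.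
  rw [← h'] at h
  have e1 := congrArg (· * toSteenrod (fSq 1)) h
  have e2 := congrArg (toSteenrod (fSq 1) * ·) h
  simp only [mul_add, add_mul, ← mul_assoc, h1, zero_mul, h2] at e1 e2
  simp only [mul_assoc, h1, mul_zero, zero_mul, add_zero, zero_add] at e1 e2
  simpa [Sq2, Sq1, mul_assoc] using e1.trans e2.symm

/-- `𝒜(1)^ℝ` acts on `𝔽₂[τ, ρ]²`. -/
noncomputable def A1Action : A1 →ₐ[ZMod 2] Module.End (ZMod 2) (M2R × M2R) :=
  steenrodAction.comp A1.val

theorem A1Action_Sq1 : A1Action Sq1 = sqPair 1 := by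
  refine (steenrodAction_toSteenrod _).trans ?_
  rw [FreeAlgebra.lift_ι_apply]; rfl

theorem A1Action_Sq2 : A1Action Sq2 = sqPair 2 := by
  refine (steenrodAction_toSteenrod _).trans ?_
  rw [FreeAlgebra.lift_ι_apply]; rfl

theorem A1Action_coeff (r : M2R) (m : M2R × M2R) : A1Action (coeff r) m = r • m := by
  induction r using MvPolynomial.induction_on generalizing m with
  | C x =>
    rw [← MvPolynomial.algebraMap_eq, AlgHom.commutes, AlgHom.commutes, algebraMap_smul]
    rfl
  | add p q hp hq => rw [map_add, map_add, LinearMap.add_apply, hp, hq, add_smul]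
  | mul_X p i hp =>
    rw [map_mul, map_mul, Module.End.mul_apply, hp, mul_smul]
    congr 1
    fin_cases i
    · simp only [Fin.zero_eta, coeff_X_zero]
      refine (LinearMap.congr_fun (steenrodAction_toSteenrod _) m).trans ?_
      exact lift_genAction_tau m
    · simp only [Fin.mk_one, coeff_X_one]
      refine (LinearMap.congr_fun (steenrodAction_toSteenrod _) m).trans ?_
      exact lift_genAction_rho m

theorem sqPair_one_mk (f g : M2R) : sqPair 1 (f, g) = (sqCoeff 1 f, sqCoeff 1 g) := by
  rw [sqPair_apply, sqCoeff_of_neg (n := 1 - 2) (by norm_num)]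
  simp

theorem sqPair_two_mk (f g : M2R) : sqPair 2 (f, g) = (sqCoeff 2 f, sqCoeff 2 g + f) := by
  have h := congrArg Prod.fst (LinearMap.congr_fun sqPair_zero (f, g))
  rw [sqPair_apply] at h
  rw [sqPair_apply, sub_self]
  exact Prod.ext rfl (congrArg (sqCoeff 2 g + ·) h)

theorem sqCoeff_one_tau (f : M2R) : sqCoeff 1 (MvPolynomial.X 0 * f) =
    MvPolynomial.X 0 * sqCoeff 1 f + MvPolynomial.X 1 * f := by
  have h := congrArg Prod.fst (LinearMap.congr_fun sqPair_zero (f, 0))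
  rw [sqPair_apply] at h
  rw [sqCoeff_tau_odd (by norm_num), sub_self, sqCoeff_of_neg (n := 1 - 2) (by norm_num)]
  simpa using congrArg (MvPolynomial.X 1 * ·) h

theorem sqCoeff_two_tau (f : M2R) : sqCoeff 2 (MvPolynomial.X 0 * f) =
    MvPolynomial.X 0 * sqCoeff 2 f + MvPolynomial.X 1 * MvPolynomial.X 0 * sqCoeff 1 f := by
  rw [sqCoeff_tau_even even_two]
  norm_num

/-- Applying a relation to `τ^k u` for `k = 0, 1, 2, 3` gives two components each, hence eight
equations, solvable successively after cancelling powers of `ρ`. The coefficient ring alone would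
not suffice: `Sq1` and `Sq2` commute with `τ^4`, so it gives at most four independent equations. -/
theorem linearIndependent_word : LinearIndependent M2R word := by
  rw [Fintype.linearIndependent_iff]
  intro g hg
  have H (m : M2R × M2R) := LinearMap.congr_fun (congrArg A1Action hg) m
  have two : (2 : M2R) = 0 := CharTwo.two_eq_zero
  have c0 : sqCoeff 1 1 = 0 := by simp [sqCoeff_one]
  have c0' : sqCoeff 2 1 = 0 := by simp [sqCoeff_one]
  have c1 : sqCoeff 1 (MvPolynomial.X 0) = MvPolynomial.X 1 := by
    simpa [c0] using sqCoeff_one_tau 1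
  have c1' : sqCoeff 2 (MvPolynomial.X 0) = 0 := by
    simpa [c0, c0'] using sqCoeff_two_tau 1
  have c2 : sqCoeff 1 (MvPolynomial.X 0 ^ 2) = 0 := by
    rw [pow_two, sqCoeff_one_tau, c1]
    linear_combination (MvPolynomial.X 0 * MvPolynomial.X 1) * two
  have c2' : sqCoeff 2 (MvPolynomial.X 0 ^ 2) = MvPolynomial.X 1 ^ 2 * MvPolynomial.X 0 := by
    rw [pow_two, sqCoeff_two_tau, c1, c1']
    ring
  have c3 : sqCoeff 1 (MvPolynomial.X 0 ^ 3) = MvPolynomial.X 1 * MvPolynomial.X 0 ^ 2 := by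
    rw [pow_succ', sqCoeff_one_tau, c2]
    ring
  have c3' : sqCoeff 2 (MvPolynomial.X 0 ^ 3) = MvPolynomial.X 1 ^ 2 * MvPolynomial.X 0 ^ 2 := by
    rw [pow_succ', sqCoeff_two_tau, c2, c2']
    ring
  have r1 (n : ℤ) : sqCoeff n (MvPolynomial.X 1) = MvPolynomial.X 1 * sqCoeff n 1 := by
    rw [← sqCoeff_rho, mul_one]
  have r2 (n : ℤ) (f : M2R) : sqCoeff n (MvPolynomial.X 1 ^ 2 * f) =
      MvPolynomial.X 1 ^ 2 * sqCoeff n f := by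
    rw [pow_two, mul_assoc, sqCoeff_rho, sqCoeff_rho, mul_assoc]
  have H0 := H (1, 0)
  have H1 := H (MvPolynomial.X 0, 0)
  have H2 := H (MvPolynomial.X 0 ^ 2, 0)
  have H3 := H (MvPolynomial.X 0 ^ 3, 0)
  simp [Fin.sum_univ_succ, word, coeff_smul_eq_mul, A1Action_coeff, A1Action_Sq1, A1Action_Sq2,
    sqPair_one_mk, sqPair_two_mk, c0, c0', c1, c1', c2, c2', c3, c3', r1, r2, sqCoeff_rho] at H0 H1 H2 H3
  have hX : (MvPolynomial.X 1 : M2R) ≠ 0 := MvPolynomial.X_ne_zero 1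
  obtain ⟨g0, g2⟩ := H0
  simp [g0, g2, hX] at H1 H2 H3
  obtain ⟨g1, g34⟩ := H1
  obtain ⟨g3, g6⟩ := H2
  simp [g3, hX] at g34
  simp [g1, g3, g34, g6, hX] at H3
  intro i
  fin_cases i
  · exact g0
  · exact g1
  · exact g2
  · exact g3
  · exact g34
  · exact H3.1
  · exact g6
  · exact H3.2

/-- Induction on the elements of `𝒜(1)^ℝ`. -/
theorem A1_induction {p : A1 → Prop} (tau : p τ) (rho : p ρ) (sq1 : p Sq1) (sq2 : p Sq2)
    (zero : p 0) (one : p 1) (add : ∀ a b, p a → p b → p (a + b))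
    (mul : ∀ a b, p a → p b → p (a * b)) (a : A1) : p a := by
  obtain ⟨a, ha⟩ := a
  induction ha using Algebra.adjoin_induction with
  | mem a h => rcases h with rfl | rfl | rfl | rfl <;> assumption
  | algebraMap r =>
    obtain rfl | rfl : r = 0 ∨ r = 1 := by revert r; decide
    · convert zero using 1; exact Subtype.ext (map_zero _)
    · convert one using 1; exact Subtype.ext (map_one _)
  | add a b ha hb iha ihb => exact add _ _ iha ihb
  | mul a b ha hb iha ihb => exact mul _ _ iha ihb

theorem mul_ρ (a : A1) : a * ρ = ρ * a := by
  induction a using A1_induction with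
  | tau => exact τ_mul_ρ
  | rho => rfl
  | sq1 => exact Sq1_mul_ρ
  | sq2 => exact Sq2_mul_ρ
  | zero => simp
  | one => simp
  | add a b iha ihb => rw [add_mul, mul_add, iha, ihb]
  | mul a b iha ihb => rw [mul_assoc, ihb, ← mul_assoc, iha, mul_assoc]

theorem mul_ρ_mul (a b : A1) : a * (ρ * b) = ρ * (a * b) := by
  rw [← mul_assoc, mul_ρ, mul_assoc]

theorem Sq1_mul_τ_mul (a : A1) : Sq1 * (τ * a) = τ * (Sq1 * a) + ρ * a := by
  rw [← mul_assoc, Sq1_mul_τ, add_mul, mul_assoc]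

theorem Sq2_mul_τ_mul (a : A1) : Sq2 * (τ * a) = τ * (Sq2 * a) + ρ * (τ * (Sq1 * a)) := by
  rw [← mul_assoc, Sq2_mul_τ, add_mul, mul_assoc, mul_assoc, mul_assoc]

theorem Sq1_mul_Sq1_mul (a : A1) : Sq1 * (Sq1 * a) = 0 := by
  rw [← mul_assoc, Sq1_mul_Sq1, zero_mul]

theorem Sq2_mul_Sq2_mul (a : A1) : Sq2 * (Sq2 * a) = τ * (Sq1 * (Sq2 * (Sq1 * a))) := by
  simp only [← mul_assoc, Sq2_mul_Sq2]

theorem Sq2_mul_Sq1_mul_Sq2_mul_Sq1_mul (a : A1) :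
    Sq2 * (Sq1 * (Sq2 * (Sq1 * a))) = Sq1 * (Sq2 * (Sq1 * (Sq2 * a))) := by
  have h := congrArg (· * a) Sq2_mul_Sq1_mul_Sq2_mul_Sq1
  simpa only [mul_assoc] using h

theorem word_mul_ρ (i : Fin 8) : word i * ρ = ρ * word i := mul_ρ _

/-- Every correction term is a multiple of `ρ`, and none involves the top word `word 7`. -/
theorem word_mul_τ (i : Fin 8) : word i * τ = τ * word i +
    ![0, ρ * word 0, ρ * (τ * word 1), ρ * word 2 + ρ * (ρ * word 1), ρ * word 2,
      ρ * word 3 + ρ * word 4, ρ * (ρ * word 4) + ρ * (τ * word 5), ρ * word 6] i := by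
  fin_cases i <;>
  simp [word, mul_assoc, mul_add, mul_ρ_mul, Sq1_mul_τ, Sq2_mul_τ, Sq1_mul_τ_mul, Sq2_mul_τ_mul,
    mul_ρ, Sq1_mul_Sq1, Sq1_mul_Sq1_mul, Sq2_mul_Sq2, Sq2_mul_Sq2_mul,
    Sq2_mul_Sq1_mul_Sq2_mul_Sq1, Sq2_mul_Sq1_mul_Sq2_mul_Sq1_mul] <;>
  abel_nf <;> simp [two_smul, A1_add_self]

theorem word_mul_Sq1 (i : Fin 8) :
    word i * Sq1 = ![word 1, 0, word 4, word 5, 0, 0, word 7, 0] i := by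
  fin_cases i <;>
  simp [word, mul_assoc, mul_add, mul_ρ_mul, Sq1_mul_τ, Sq2_mul_τ, Sq1_mul_τ_mul, Sq2_mul_τ_mul,
    mul_ρ, Sq1_mul_Sq1, Sq1_mul_Sq1_mul, Sq2_mul_Sq2, Sq2_mul_Sq2_mul,
    Sq2_mul_Sq1_mul_Sq2_mul_Sq1, Sq2_mul_Sq1_mul_Sq2_mul_Sq1_mul]

theorem word_mul_Sq2 (i : Fin 8) : word i * Sq2 =
    ![word 2, word 3, τ * word 5, ρ * word 5, word 6, word 7, ρ * word 7, 0] i := by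
  fin_cases i <;>
  simp [word, mul_assoc, mul_add, mul_ρ_mul, Sq1_mul_τ, Sq2_mul_τ, Sq1_mul_τ_mul, Sq2_mul_τ_mul,
    mul_ρ, Sq1_mul_Sq1, Sq1_mul_Sq1_mul, Sq2_mul_Sq2, Sq2_mul_Sq2_mul,
    Sq2_mul_Sq1_mul_Sq2_mul_Sq1, Sq2_mul_Sq1_mul_Sq2_mul_Sq1_mul]

theorem τ_mul_mem {S : Submodule M2R A1} {a : A1} (h : a ∈ S) : τ * a ∈ S := by
  have := S.smul_mem (MvPolynomial.X 0) h
  rwa [coeff_smul_eq_mul, coeff_X_zero] at this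

theorem ρ_mul_mem {S : Submodule M2R A1} {a : A1} (h : a ∈ S) : ρ * a ∈ S := by
  have := S.smul_mem (MvPolynomial.X 1) h
  rwa [coeff_smul_eq_mul, coeff_X_one] at this

/-- The multiplication tables show that the span is stable under right multiplication by the four
generators; it contains `1`. -/
theorem span_word : Submodule.span M2R (Set.range word) = ⊤ := by
  set S := Submodule.span M2R (Set.range word)
  have hw (i : Fin 8) : word i ∈ S := Submodule.subset_span ⟨i, rfl⟩
  have key (g : A1) (h : ∀ i, word i * g ∈ S) (a : A1) (ha : a ∈ S) : a * g ∈ S := by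
    induction ha using Submodule.span_induction with
    | mem a h' => obtain ⟨i, rfl⟩ := h'; exact h i
    | zero => simp
    | add a b _ _ iha ihb => rw [add_mul]; exact S.add_mem iha ihb
    | smul r a _ iha => 
      rw [coeff_smul_eq_mul, mul_assoc]
      exact S.smul_mem r iha
  have main (g : A1) : ∀ a ∈ S, a * g ∈ S := by
    induction g using A1_induction with
    | tau =>
      refine key _ fun i => ?_
      rw [word_mul_τ]
      refine S.add_mem (τ_mul_mem (hw i)) ?_
      fin_cases i
      · exact S.zero_mem
      · exact ρ_mul_mem (hw 0)
      · exact ρ_mul_mem (τ_mul_mem (hw 1))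
      · exact S.add_mem (ρ_mul_mem (hw 2)) (ρ_mul_mem (ρ_mul_mem (hw 1)))
      · exact ρ_mul_mem (hw 2)
      · exact S.add_mem (ρ_mul_mem (hw 3)) (ρ_mul_mem (hw 4))
      · exact S.add_mem (ρ_mul_mem (ρ_mul_mem (hw 4))) (ρ_mul_mem (τ_mul_mem (hw 5)))
      · exact ρ_mul_mem (hw 6)
    | rho =>
      refine key _ fun i => ?_
      rw [word_mul_ρ]
      exact ρ_mul_mem (hw i)
    | sq1 =>
      refine key _ fun i => ?_
      rw [word_mul_Sq1]
      fin_cases i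
      exacts [hw 1, S.zero_mem, hw 4, hw 5, S.zero_mem, S.zero_mem, hw 7, S.zero_mem]
    | sq2 =>
      refine key _ fun i => ?_
      rw [word_mul_Sq2]
      fin_cases i
      exacts [hw 2, hw 3, τ_mul_mem (hw 5), ρ_mul_mem (hw 5), hw 6, hw 7, ρ_mul_mem (hw 7),
        S.zero_mem]
    | zero => simp
    | one => simp
    | add g g' ih ih' => intro a ha; rw [mul_add]; exact S.add_mem (ih a ha) (ih' a ha)
    | mul g g' ih ih' => intro a ha; rw [← mul_assoc]; exact ih' _ (ih a ha)
  refine Submodule.eq_top_iff'.2 fun a => ?_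
  have := main a 1 (hw 0)
  rwa [one_mul] at this

/-- The basis of `𝒜(1)^ℝ` over `𝔽₂[τ, ρ]`. -/
noncomputable def wordBasis : Module.Basis (Fin 8) M2R A1 :=
  Module.Basis.mk linearIndependent_word span_word.ge

theorem wordBasis_apply (i : Fin 8) : wordBasis i = word i := by simp [wordBasis]

theorem sum_word (a : A1) : ∑ i, coeff (wordBasis.repr a i) * word i = a := by
  have := wordBasis.sum_repr a
  simpa only [wordBasis_apply, coeff_smul_eq_mul] using this

/-! ### The Frobenius form and its dual bases. -/

/-- The coefficient of the top word, a Frobenius form on `𝒜(1)^ℝ`. -/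
noncomputable def topCoeff : A1 →ₗ[M2R] M2R := wordBasis.coord 7

theorem topCoeff_word (i : Fin 8) : topCoeff (word i) = if i = 7 then 1 else 0 := by
  rw [topCoeff, ← wordBasis_apply, Module.Basis.coord_apply, Module.Basis.repr_self,
    Finsupp.single_apply]

theorem topCoeff_τ_mul (a : A1) : topCoeff (τ * a) = MvPolynomial.X 0 * topCoeff a := by
  rw [← coeff_X_zero, ← coeff_smul_eq_mul, map_smul, smul_eq_mul]

theorem topCoeff_ρ_mul (a : A1) : topCoeff (ρ * a) = MvPolynomial.X 1 * topCoeff a := by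
  rw [← coeff_X_one, ← coeff_smul_eq_mul, map_smul, smul_eq_mul]

/-- Linearity over coefficients acting on the right holds because no correction in `word_mul_τ`
contains the top word. Coefficients are not central in `A1`, so this does not follow from left
linearity. -/
theorem topCoeff_mul_coeff (a : A1) (r : M2R) : topCoeff (a * coeff r) = r * topCoeff a := by
  induction r using MvPolynomial.induction_on generalizing a with
  | C x =>
    obtain rfl | rfl : x = 0 ∨ x = 1 := by revert x; decide
    · simp
    · simp
  | add p q hp hq => rw [map_add, mul_add, map_add, hp, hq, add_mul]
  | mul_X p i hp =>
    rw [mul_comm p, map_mul coeff, ← mul_assoc, hp, mul_comm (MvPolynomial.X i), mul_assoc]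
    congr 1
    fin_cases i
    · simp only [Fin.zero_eta, coeff_X_zero]
      rw [← sum_word a, Finset.sum_mul, map_sum, map_sum, Finset.mul_sum]
      refine Finset.sum_congr rfl fun i _ => ?_
      rw [mul_assoc, ← coeff_smul_eq_mul, ← coeff_smul_eq_mul, map_smul, map_smul, smul_eq_mul,
        smul_eq_mul, mul_left_comm]
      congr 1
      rw [word_mul_τ, map_add, topCoeff_τ_mul]
      fin_cases i <;> simp [topCoeff_τ_mul, topCoeff_ρ_mul, topCoeff_word]
    · simp only [Fin.mk_one, coeff_X_one]
      rw [mul_ρ, topCoeff_ρ_mul]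

/-- The basis of `𝒜(1)^ℝ` dual to `word` with respect to the Frobenius form. -/
noncomputable def dualWord (j : Fin 8) : A1 :=
  -- The term `ρ * word 1` cancels `word 6 * word 2 = ρ * word 7`, the one failure of the words to
  -- be dual to each other.
  if j = 5 then word 2 + ρ * word 1 else word (![7, 6, 5, 3, 4, 2, 1, 0] j)

theorem topCoeff_word_mul_dualWord (i j : Fin 8) :
    topCoeff (word i * dualWord j) = if i = j then 1 else 0 := by
  have h0 := topCoeff_word 0
  have h1 := topCoeff_word 1
  have h2 := topCoeff_word 2
  have h3 := topCoeff_word 3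
  have h4 := topCoeff_word 4
  have h5 := topCoeff_word 5
  have h6 := topCoeff_word 6
  have h7 := topCoeff_word 7
  simp [word, mul_assoc] at h0 h1 h2 h3 h4 h5 h6 h7
  fin_cases i <;> fin_cases j <;>
  simp [word, dualWord, mul_assoc, mul_add, mul_ρ_mul, mul_ρ, Sq1_mul_Sq1, Sq1_mul_Sq1_mul,
    Sq2_mul_Sq2, Sq2_mul_Sq2_mul, Sq2_mul_Sq1_mul_Sq2_mul_Sq1, Sq2_mul_Sq1_mul_Sq2_mul_Sq1_mul,
    Sq1_mul_τ_mul, Sq2_mul_τ_mul, topCoeff_τ_mul, topCoeff_ρ_mul,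
    h0, h1, h2, h3, h4, h5, h6, h7, CharTwo.add_self_eq_zero]

/-- The expansion of an element of `𝒜(1)^ℝ` along `dualWord`, as an additive map. -/
noncomputable def dualSum : A1 →+ A1 where
  toFun a := ∑ j, dualWord j * coeff (topCoeff (word j * a))
  map_zero' := by simp
  map_add' a b := by simp only [mul_add, map_add, Finset.sum_add_distrib]

theorem dualSum_apply (a : A1) :
    dualSum a = ∑ j, dualWord j * coeff (topCoeff (word j * a)) := rfl

theorem dualSum_mul_coeff (a : A1) (r : M2R) : dualSum (a * coeff r) = dualSum a * coeff r := by
  simp only [dualSum_apply, ← mul_assoc, topCoeff_mul_coeff, mul_comm r, map_mul coeff,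
    Finset.sum_mul]

theorem dualSum_dualWord (i : Fin 8) : dualSum (dualWord i) = dualWord i := by
  simp [dualSum_apply, topCoeff_word_mul_dualWord]

/-- The elements fixed by `dualSum` form a right module over the coefficients containing the dual
words. It remains to show stability under left multiplication by coefficients and that the words lie
in it; then it is all of `A1` by `sum_word`. -/
theorem sum_dualWord (a : A1) : ∑ j, dualWord j * coeff (topCoeff (word j * a)) = a := by
  obtain ⟨S, hS⟩ : ∃ S : AddSubgroup A1, ∀ a, a ∈ S ↔ dualSum a = a :=
    ⟨dualSum.eqLocus (AddMonoidHom.id A1), fun a => Iff.rfl⟩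
  have mulc {a : A1} (ha : a ∈ S) (r : M2R) : a * coeff r ∈ S := by
    rw [hS] at ha ⊢
    rw [dualSum_mul_coeff, ha]
  have dual (i : Fin 8) : dualWord i ∈ S := (hS _).2 (dualSum_dualWord i)
  have hρ {a : A1} (ha : a ∈ S) : ρ * a ∈ S := by
    rw [← mul_ρ, ← coeff_X_one]
    exact mulc ha _
  have hw2 : word 2 ∈ S := by
    rw [show word 2 = dualWord 5 + ρ * dualWord 6 by simp [dualWord, add_assoc, A1_add_self]]
    exact S.add_mem (dual 5) (hρ (dual 6))
  have hw (i : Fin 8) : word i ∈ S := by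
    fin_cases i
    · simpa [dualWord] using dual 7
    · simpa [dualWord] using dual 6
    · exact hw2
    · simpa [dualWord] using dual 3
    · simpa [dualWord] using dual 4
    · simpa [dualWord] using dual 2
    · simpa [dualWord] using dual 1
    · simpa [dualWord] using dual 0
  have hτw (i : Fin 8) : τ * word i ∈ S := by
    have h1 : τ * word i = word i * τ + (word i * τ + τ * word i) := by
      rw [← add_assoc, A1_add_self, zero_add]
    have h2 (j : Fin 8) : word j * τ ∈ S := coeff_X_zero ▸ mulc (hw j) _
    -- The corrections for `word 2` and `word 6` involve `τ * word 1` and `τ * word 5`, so these two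
    -- products come first.
    have h4 : τ * word 1 ∈ S := by
      have := S.add_mem (h2 1) (hρ (hw 0))
      rw [word_mul_τ, add_assoc] at this
      simpa [A1_add_self] using this
    have h5 : τ * word 5 ∈ S := by
      have := S.add_mem (h2 5) (S.add_mem (hρ (hw 3)) (hρ (hw 4)))
      rw [word_mul_τ, add_assoc] at this
      simpa [A1_add_self] using this
    rw [h1]
    refine S.add_mem (h2 i) ?_
    rw [word_mul_τ, add_comm, ← add_assoc, A1_add_self, zero_add]
    fin_cases i
    exacts [S.zero_mem, hρ (hw 0), hρ h4, S.add_mem (hρ (hw 2)) (hρ (hρ (hw 1))), hρ (hw 2),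
      S.add_mem (hρ (hw 3)) (hρ (hw 4)), S.add_mem (hρ (hρ (hw 4))) (hρ h5), hρ (hw 6)]
  have hτd (i : Fin 8) : τ * dualWord i ∈ S := by
    fin_cases i <;> simp only [dualWord, Fin.zero_eta, Fin.mk_one, Fin.reduceFinMk,
      Matrix.cons_val, Fin.reduceEq, if_true, if_false, mul_add, mul_ρ_mul, hτw]
    exact S.add_mem (hτw 2) (hρ (hτw 1))
  have hτ {a : A1} (ha : a ∈ S) : τ * a ∈ S := by
    rw [hS, dualSum_apply] at ha
    rw [← ha, Finset.mul_sum]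
    refine S.sum_mem fun i _ => ?_
    rw [← mul_assoc]
    exact mulc (hτd i) _
  have hc (r : M2R) {a : A1} (ha : a ∈ S) : coeff r * a ∈ S := by
    induction r using MvPolynomial.induction_on generalizing a with
    | C x =>
      obtain rfl | rfl : x = 0 ∨ x = 1 := by revert x; decide
      · simp
      · simpa using ha
    | add p q hp hq => rw [map_add, add_mul]; exact S.add_mem (hp ha) (hq ha)
    | mul_X p i hp =>
      rw [map_mul, mul_assoc]
      refine hp ?_
      fin_cases i
      · simp only [Fin.zero_eta, coeff_X_zero]
        exact hτ ha
      · simp only [Fin.mk_one, coeff_X_one]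
        exact hρ ha
  rw [← dualSum_apply, ← hS, ← sum_word a]
  exact S.sum_mem fun i _ => hc _ (hw i)

/-! ### Vanishing of Margolis homology for free and projective modules. -/

/-- Multiplication by `a` on `M/S` has kernel contained in its image. -/
def IsExactMod {M : Type*} [AddCommGroup M] [Module A1 M] (S : AddSubgroup M) (a : A1) : Prop :=
  ∀ m : M, a • m ∈ S → ∃ m' : M, m - a • m' ∈ S

theorem τ_smul_mem_rhoTau {M : Type u} [AddCommGroup M] [Module A1 M] (m : M) :
    τ • m ∈ rhoTau M := ⟨0, m, by simp⟩

theorem ρ_smul_mem_rhoTau {M : Type u} [AddCommGroup M] [Module A1 M] (m : M) :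
    ρ • m ∈ rhoTau M := ⟨m, 0, by simp⟩

theorem coeff_smul_sub_mem_rhoTau {M : Type u} [AddCommGroup M] [Module A1 M] (r : M2R) (m : M) :
    coeff r • m - coeff (MvPolynomial.C (MvPolynomial.constantCoeff r)) • m ∈ rhoTau M := by
  induction r using MvPolynomial.induction_on generalizing m with
  | C x => simp
  | add p q hp hq =>
    have := (rhoTau M).add_mem (hp m) (hq m)
    convert this using 1
    simp only [map_add, add_smul]
    abel
  | mul_X p i hp =>
    rw [map_mul MvPolynomial.constantCoeff, MvPolynomial.constantCoeff_X, mul_zero, map_zero,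
      map_zero, zero_smul, sub_zero, map_mul, mul_smul]
    refine (rhoTau M).smul_mem _ ?_
    fin_cases i
    · simp only [Fin.zero_eta, coeff_X_zero]; exact τ_smul_mem_rhoTau m
    · simp only [Fin.mk_one, coeff_X_one]; exact ρ_smul_mem_rhoTau m

/-- The coordinates of an element of `𝒜(1)^ℝ/(ρ, τ)` in the basis `word`. -/
noncomputable def redCoord : A1 →+ (Fin 8 → ZMod 2) where
  toFun a i := MvPolynomial.constantCoeff (wordBasis.repr a i)
  map_zero' := by ext; simp
  map_add' a b := by ext; simp

theorem redCoord_apply (a : A1) (i : Fin 8) :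
    redCoord a i = MvPolynomial.constantCoeff (wordBasis.repr a i) := rfl

theorem redCoord_word (i : Fin 8) : redCoord (word i) = Pi.single i 1 := by
  ext j
  rw [redCoord_apply, ← wordBasis_apply, Module.Basis.repr_self, Finsupp.single_apply,
    Pi.single_apply]
  split_ifs <;> simp_all

/-- The combination of the basis `word` with given coefficients in `𝔽₂`. -/
noncomputable def ofCoord (v : Fin 8 → ZMod 2) : A1 := ∑ i, coeff (MvPolynomial.C (v i)) * word i

theorem sub_ofCoord_mem (a : A1) : a - ofCoord (redCoord a) ∈ rhoTau A1 := by
  have h : a - ofCoord (redCoord a) = ∑ i, (coeff (wordBasis.repr a i) * word i -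
      coeff (MvPolynomial.C (redCoord a i)) * word i) := by
    rw [Finset.sum_sub_distrib, sum_word, ofCoord]
  rw [h]
  exact (rhoTau A1).sum_mem fun i _ => coeff_smul_sub_mem_rhoTau _ (word i)

theorem redCoord_of_mem {a : A1} (h : a ∈ rhoTau A1) : redCoord a = 0 := by
  obtain ⟨y, z, rfl⟩ := h
  ext i
  rw [redCoord_apply, smul_eq_mul, smul_eq_mul, ← coeff_X_zero, ← coeff_X_one, ← coeff_smul_eq_mul,
    ← coeff_smul_eq_mul, map_add, map_smul, map_smul]
  simp

theorem mem_of_redCoord {a : A1} (h : redCoord a = 0) : a ∈ rhoTau A1 := by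
  simpa [h, ofCoord] using sub_ofCoord_mem a

theorem addHom_eq_of_word {X : Type*} [AddCommGroup X] (F G : A1 →+ X)
    (hF : ∀ a ∈ rhoTau A1, F a = 0) (hG : ∀ a ∈ rhoTau A1, G a = 0)
    (h : ∀ i, F (word i) = G (word i)) (a : A1) : F a = G a := by
  have e (H : A1 →+ X) (hH : ∀ a ∈ rhoTau A1, H a = 0) : H a = H (ofCoord (redCoord a)) := by
    rw [← sub_eq_zero, ← map_sub]
    exact hH _ (sub_ofCoord_mem a)
  rw [e F hF, e G hG, ofCoord, map_sum, map_sum]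
  refine Finset.sum_congr rfl fun i _ => ?_
  generalize redCoord a i = x
  obtain rfl | rfl : x = 0 ∨ x = 1 := by revert x; decide
  · simp
  · simpa using h i

theorem redCoord_ofCoord (v : Fin 8 → ZMod 2) : redCoord (ofCoord v) = v := by
  rw [ofCoord, map_sum]
  have (i : Fin 8) : redCoord (coeff (MvPolynomial.C (v i)) * word i) = Pi.single i (v i) := by
    generalize v i = x
    obtain rfl | rfl : x = 0 ∨ x = 1 := by revert x; decide
    · simp
    · simp [redCoord_word]
  simp only [this]
  exact Finset.univ_sum_single v

/-- The effect of left multiplication by `a` on the coordinates mod `(ρ, τ)`, given its effect on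
the basis. -/
theorem redCoord_mul_eq (a : A1) (G : (Fin 8 → ZMod 2) →+ (Fin 8 → ZMod 2))
    (h : ∀ i, redCoord (a * word i) = G (Pi.single i 1)) (b : A1) :
    redCoord (a * b) = G (redCoord b) := by
  refine addHom_eq_of_word (redCoord.comp (AddMonoidHom.mulLeft a)) (G.comp redCoord) ?_ ?_ ?_ b
  · intro b hb
    exact redCoord_of_mem ((rhoTau A1).smul_mem a hb)
  · intro b hb
    simp [redCoord_of_mem hb]
  · intro i
    simpa [redCoord_word] using h i

theorem redCoord_τ_mul (a : A1) : redCoord (τ * a) = 0 := redCoord_of_mem (τ_smul_mem_rhoTau a)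

theorem redCoord_words : redCoord 1 = Pi.single 0 1 ∧ redCoord Sq1 = Pi.single 1 1 ∧
    redCoord Sq2 = Pi.single 2 1 ∧ redCoord (Sq1 * Sq2) = Pi.single 3 1 ∧
    redCoord (Sq2 * Sq1) = Pi.single 4 1 ∧ redCoord (Sq1 * (Sq2 * Sq1)) = Pi.single 5 1 ∧
    redCoord (Sq2 * (Sq1 * Sq2)) = Pi.single 6 1 ∧
    redCoord (Sq1 * (Sq2 * (Sq1 * Sq2))) = Pi.single 7 1 := by
  have h := redCoord_word
  refine ⟨?_, ?_, ?_, ?_, ?_, ?_, ?_, ?_⟩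
  · simpa [word] using h 0
  · simpa [word] using h 1
  · simpa [word] using h 2
  · simpa [word] using h 3
  · simpa [word] using h 4
  · simpa [word, mul_assoc] using h 5
  · simpa [word, mul_assoc] using h 6
  · simpa [word, mul_assoc] using h 7

theorem redCoord_Sq1_mul (b : A1) : redCoord (Sq1 * b) = ![0, redCoord b 0, 0, redCoord b 2, 0,
    redCoord b 4, 0, redCoord b 6] := by
  refine redCoord_mul_eq Sq1 ⟨⟨fun v => ![0, v 0, 0, v 2, 0, v 4, 0, v 6], by decide⟩,
    fun v w => by ext j; fin_cases j <;> simp⟩ (fun i => ?_) b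
  obtain ⟨h0, h1, h2, h3, h4, h5, h6, h7⟩ := redCoord_words
  fin_cases i <;> ext j <;> fin_cases j <;>
    simp [word, mul_assoc, Sq1_mul_Sq1, Sq1_mul_Sq1_mul, h0, h1, h2, h3, h4, h5, h6, h7]

theorem redCoord_Sq2_mul (b : A1) : redCoord (Sq2 * b) = ![0, 0, redCoord b 0, 0, redCoord b 1, 0,
    redCoord b 3, redCoord b 5] := by
  refine redCoord_mul_eq Sq2 ⟨⟨fun v => ![0, 0, v 0, 0, v 1, 0, v 3, v 5], by decide⟩,
    fun v w => by ext j; fin_cases j <;> simp⟩ (fun i => ?_) b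
  obtain ⟨h0, h1, h2, h3, h4, h5, h6, h7⟩ := redCoord_words
  fin_cases i <;> ext j <;> fin_cases j <;>
    simp [word, mul_assoc, Sq1_mul_Sq1, Sq2_mul_Sq2, Sq2_mul_Sq2_mul, Sq1_mul_Sq1_mul,
      Sq2_mul_Sq1_mul_Sq2_mul_Sq1, Sq2_mul_Sq1_mul_Sq2_mul_Sq1_mul, Sq1_mul_τ_mul, mul_ρ_mul,
      mul_add, redCoord_τ_mul, h0, h1, h2, h3, h4, h5, h6, h7]

theorem redCoord_Q1_mul (b : A1) : redCoord (Q1 * b) = ![0, 0, 0, redCoord b 0, redCoord b 0,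
    redCoord b 1, redCoord b 2, redCoord b 3 + redCoord b 4] := by
  simp only [Q1, add_mul, map_add, mul_assoc, redCoord_Sq1_mul, redCoord_Sq2_mul]
  ext j
  fin_cases j <;> simp

/-- Linear algebra on the eight-dimensional quotient `A1/(ρ, τ)`: the coordinate formulas for left
multiplication exhibit a preimage of every cycle. -/
theorem isExactMod_A1 {a : A1} (ha : a ∈ ({Q0, Q1, Sq2} : Set A1)) :
    IsExactMod (rhoTau A1).toAddSubgroup a := by
  intro m hm
  have hm := redCoord_of_mem hm
  have key (v : Fin 8 → ZMod 2) (hv : redCoord m = redCoord (a * ofCoord v)) :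
      ∃ m' : A1, m - a • m' ∈ (rhoTau A1).toAddSubgroup :=
    ⟨ofCoord v, mem_of_redCoord (by rw [map_sub, smul_eq_mul, hv, sub_self])⟩
  obtain ⟨k, hk⟩ : ∃ k, redCoord m = k := ⟨_, rfl⟩
  rw [hk] at key
  rcases ha with rfl | rfl | rfl
  · rw [Q0, smul_eq_mul, redCoord_Sq1_mul, hk] at hm
    refine key ![k 1, 0, k 3, 0, k 5, 0, k 7, 0] ?_
    rw [Q0, redCoord_Sq1_mul, redCoord_ofCoord]
    have h0 := congrFun hm 1
    have h2 := congrFun hm 3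
    have h4 := congrFun hm 5
    have h6 := congrFun hm 7
    simp at h0 h2 h4 h6
    ext j; fin_cases j <;> simp [h0, h2, h4, h6]
  · rw [smul_eq_mul, redCoord_Q1_mul, hk] at hm
    refine key ![k 3, k 5, k 6, k 7, 0, 0, 0, 0] ?_
    rw [redCoord_Q1_mul, redCoord_ofCoord]
    have h0 := congrFun hm 3
    have h2 := congrFun hm 5
    have h4 := congrFun hm 6
    have h6 := congrFun hm 7
    simp at h0 h2 h4 h6
    -- The image of `Q1` has equal coordinates at positions `3` and `4`, and the last cycle equation
    -- forces this.
    have h3 : k 4 = k 3 := by linear_combination h6 - zmod_two_add_self (k 3)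
    ext j; fin_cases j <;> simp [h0, h2, h4, h3]
  · rw [smul_eq_mul, redCoord_Sq2_mul, hk] at hm
    refine key ![k 2, k 4, 0, k 6, 0, k 7, 0, 0] ?_
    rw [redCoord_Sq2_mul, redCoord_ofCoord]
    have h0 := congrFun hm 2
    have h2 := congrFun hm 4
    have h4 := congrFun hm 6
    have h6 := congrFun hm 7
    simp at h0 h2 h4 h6
    ext j; fin_cases j <;> simp [h0, h2, h4, h6]

theorem map_mem_rhoTau {M N : Type*} [AddCommGroup M] [Module A1 M] [AddCommGroup N] [Module A1 N]
    (f : M →ₗ[A1] N) {m : M} (h : m ∈ rhoTau M) : f m ∈ rhoTau N := by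
  obtain ⟨y, z, rfl⟩ := h
  exact ⟨f y, f z, by simp⟩

theorem smul_mem_rhoTau_of_mem {M : Type u} [AddCommGroup M] [Module A1 M] {a : A1}
    (h : a ∈ rhoTau A1) (m : M) : a • m ∈ rhoTau M := by
  obtain ⟨y, z, rfl⟩ := h
  exact ⟨y • m, z • m, by simp [add_smul, mul_smul]⟩

-- A splitting `s` of the canonical map from the free module on `P` reduces the claim to one
-- coordinate at a time, where it is `isExactMod_A1`.
open Classical in
theorem isExactMod_of_projective {P : Type u} [AddCommGroup P] [Module A1 P]
    [Module.Projective A1 P] {a : A1} (ha : a ∈ ({Q0, Q1, Sq2} : Set A1)) :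
    IsExactMod (rhoTau P).toAddSubgroup a := by
  intro m hm
  obtain ⟨s, hs⟩ := Module.Projective.out (R := A1) (P := P)
  have hsm (i : P) : a * s m i ∈ rhoTau A1 := by
    obtain ⟨y, z, hyz⟩ := hm
    refine ⟨s y i, s z i, ?_⟩
    have := DFunLike.congr_fun (congrArg s hyz) i
    simpa using this
  choose c hc using fun b : {b : A1 // a * b ∈ rhoTau A1} => isExactMod_A1 ha b.1 b.2
  -- Preimages are chosen to be `0` at `0`, so that the coordinatewise choice still has finite
  -- support.
  let c' : A1 → A1 := fun b => if h : b ≠ 0 ∧ a * b ∈ rhoTau A1 then c ⟨b, h.2⟩ else 0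
  have hc0 : c' 0 = 0 := by simp [c']
  have hc' (b : A1) (hb : a * b ∈ rhoTau A1) : b - a * c' b ∈ rhoTau A1 := by
    by_cases h : b = 0
    · simp [h, hc0]
    · simpa [c', h, hb] using hc ⟨b, hb⟩
  refine ⟨Finsupp.linearCombination A1 id ((s m).mapRange c' hc0), ?_⟩
  have e : m - a • Finsupp.linearCombination A1 id ((s m).mapRange c' hc0) =
      Finsupp.linearCombination A1 id (s m - a • (s m).mapRange c' hc0) := by
    rw [map_sub, map_smul, hs m]
  rw [e, Finsupp.linearCombination_apply]
  refine AddSubgroup.sum_mem _ fun i _ => smul_mem_rhoTau_of_mem ?_ _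
  simpa using hc' _ (hsm i)

/-! ### Elementwise form of Margolis isomorphisms, and the forward implication. -/

section Margolis

variable {M N : Type u} [AddCommGroup M] [Module A1 M] [AddCommGroup N] [Module A1 N]

theorem margolisMap_injective_iff (f : M →ₗ[A1] N) (a : A1) :
    Function.Injective (margolisMap f a) ↔
      ∀ m, a • m = 0 → (∃ n, a • n = f m) → ∃ m', a • m' = m := by
  rw [injective_iff_map_eq_zero]
  constructor
  · intro h m hm hn
    have hm' : m ∈ (mulBy M a).ker := hm
    have := h (QuotientAddGroup.mk ⟨m, hm'⟩) ((QuotientAddGroup.eq_zero_iff _).2 hn)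
    exact (QuotientAddGroup.eq_zero_iff _).1 this
  · intro h x hx
    induction x using QuotientAddGroup.induction_on with
    | H z =>
      obtain ⟨m, hm⟩ := z
      exact (QuotientAddGroup.eq_zero_iff _).2 (h m hm ((QuotientAddGroup.eq_zero_iff _).1 hx))

theorem margolisMap_surjective_iff (f : M →ₗ[A1] N) (a : A1) :
    Function.Surjective (margolisMap f a) ↔
      ∀ n, a • n = 0 → ∃ m, a • m = 0 ∧ ∃ n', a • n' = n - f m := by
  constructor
  · intro h n hn
    have hn' : n ∈ (mulBy N a).ker := hn
    obtain ⟨x, hx⟩ := h (QuotientAddGroup.mk ⟨n, hn'⟩)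
    induction x using QuotientAddGroup.induction_on with
    | H z =>
      obtain ⟨m, hm⟩ := z
      obtain ⟨n', hn'⟩ := QuotientAddGroup.eq.1 hx
      refine ⟨m, hm, n', hn'.trans ?_⟩
      change -(f m) + n = n - f m
      abel
  · intro h x
    induction x using QuotientAddGroup.induction_on with
    | H z =>
      obtain ⟨n, hn⟩ := z
      obtain ⟨m, hm, n', hn'⟩ := h n hn
      refine ⟨QuotientAddGroup.mk ⟨m, hm⟩, QuotientAddGroup.eq.2 ⟨n', hn'.trans ?_⟩⟩
      change n - f m = -(f m) + n
      abel

theorem redMap_mk (f : M →ₗ[A1] N) (m : M) :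
    redMap f (Submodule.Quotient.mk m) = Submodule.Quotient.mk (f m) := rfl

/-- Lifts the condition from subquotients of `M/(ρ, τ)` and `N/(ρ, τ)` to congruences in `M` and
`N`, the form used in both diagram chases. -/
theorem margolisMap_redMap_bijective_iff (f : M →ₗ[A1] N) (a : A1) :
    Function.Bijective (margolisMap (redMap f) a) ↔
      (∀ m, a • m ∈ rhoTau M → (∃ n, f m - a • n ∈ rhoTau N) → ∃ m', m - a • m' ∈ rhoTau M) ∧
      ∀ n, a • n ∈ rhoTau N → ∃ m, a • m ∈ rhoTau M ∧ ∃ n', n - f m - a • n' ∈ rhoTau N := by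
  have hM (m : M) : (Submodule.Quotient.mk m : Red M) = 0 ↔ m ∈ rhoTau M :=
    Submodule.Quotient.mk_eq_zero _
  have hN (n : N) : (Submodule.Quotient.mk n : Red N) = 0 ↔ n ∈ rhoTau N :=
    Submodule.Quotient.mk_eq_zero _
  rw [Function.Bijective, margolisMap_injective_iff, margolisMap_surjective_iff,
    (Submodule.Quotient.mk_surjective (rhoTau M)).forall,
    (Submodule.Quotient.mk_surjective (rhoTau N)).forall]
  simp only [(Submodule.Quotient.mk_surjective (rhoTau M)).exists,
    (Submodule.Quotient.mk_surjective (rhoTau N)).exists, redMap_mk, ← Submodule.Quotient.mk_smul,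
    hM, hN, ← Submodule.Quotient.mk_sub, eq_comm (a := Submodule.Quotient.mk (a • _)),
    Submodule.Quotient.eq]

end Margolis

/-- The discrepancies `g f - id` and `f g - id` pass through projectives, where every cycle modulo
`(ρ, τ)` is a boundary; so `f` and `g` are mutually inverse on Margolis homology. -/
theorem bijective_of_isStableEquivalence {M N : FreeMod.{u}} {f : FreeMod.Hom M N}
    (h : IsStableEquivalence f) {a : A1} (ha : a ∈ ({Q0, Q1, Sq2} : Set A1)) :
    Function.Bijective (margolisMap (redMap f.toLin) a) := by
  obtain ⟨g, ⟨P, i, p, hP, hgf⟩, ⟨P', i', p', hP', hfg⟩⟩ := h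
  have hgf (m : M) : m = g.toLin (f.toLin m) - p.toLin (i.toLin m) := by
    have := LinearMap.congr_fun hgf m
    simp only [LinearMap.sub_apply, LinearMap.comp_apply, LinearMap.id_apply] at this
    rw [← this]; abel
  have hfg (m : N) : m = f.toLin (g.toLin m) - p'.toLin (i'.toLin m) := by
    have := LinearMap.congr_fun hfg m
    simp only [LinearMap.sub_apply, LinearMap.comp_apply, LinearMap.id_apply] at this
    rw [← this]; abel
  rw [margolisMap_redMap_bijective_iff]
  constructor
  · rintro m hm ⟨n, hn⟩
    have h1 : a • i.toLin m ∈ rhoTau P := by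
      rw [← map_smul]; exact map_mem_rhoTau _ hm
    obtain ⟨q, hq⟩ := isExactMod_of_projective ha (i.toLin m) h1
    refine ⟨g.toLin n - p.toLin q, ?_⟩
    have h2 := (rhoTau M).sub_mem (map_mem_rhoTau g.toLin hn) (map_mem_rhoTau p.toLin hq)
    convert h2 using 1
    conv_lhs => rw [hgf m]
    simp only [map_sub, map_smul, smul_sub]
    abel
  · intro n hn
    have h1 : a • i'.toLin n ∈ rhoTau P' := by
      rw [← map_smul]; exact map_mem_rhoTau _ hn
    obtain ⟨q, hq⟩ := isExactMod_of_projective ha (i'.toLin n) h1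
    refine ⟨g.toLin n, ?_, -p'.toLin q, ?_⟩
    · rw [← map_smul]; exact map_mem_rhoTau _ hn
    · have h2 := (rhoTau N).neg_mem (map_mem_rhoTau p'.toLin hq)
      convert h2 using 1
      nth_rw 1 [hfg n]
      simp only [map_sub, map_smul, smul_neg]
      abel

/-! ### Bigraded abelian groups and homogeneous components. -/

section Graded

variable {M N : Type*} [AddCommGroup M] [AddCommGroup N] {deg : ℤ × ℤ → AddSubgroup M}
  {deg' : ℤ × ℤ → AddSubgroup N}

/-- The projection onto a homogeneous component. -/
noncomputable def gradedComp (h : DirectSum.IsInternal deg) (d : ℤ × ℤ) : M →+ M :=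
  (deg d).subtype.comp ((DFinsupp.evalAddMonoidHom d).comp
    (AddEquiv.ofBijective (DirectSum.coeAddMonoidHom deg) h).symm.toAddMonoidHom)

theorem gradedComp_mem (h : DirectSum.IsInternal deg) (d : ℤ × ℤ) (x : M) :
    gradedComp h d x ∈ deg d := Subtype.prop _

theorem gradedComp_apply (h : DirectSum.IsInternal deg) (d e : ℤ × ℤ) {x : M} (hx : x ∈ deg d) :
    gradedComp h e x = if d = e then x else 0 := by
  have h1 : (AddEquiv.ofBijective (DirectSum.coeAddMonoidHom deg) h).symm x =
      DirectSum.of (fun d => deg d) d ⟨x, hx⟩ := by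
    rw [AddEquiv.symm_apply_eq]
    exact (DirectSum.coeAddMonoidHom_of deg d ⟨x, hx⟩).symm
  change (((AddEquiv.ofBijective (DirectSum.coeAddMonoidHom deg) h).symm x) e : M) = _
  rw [h1, DirectSum.coe_of_apply]
  split_ifs <;> rfl

theorem gradedComp_of_mem (h : DirectSum.IsInternal deg) {d : ℤ × ℤ} {x : M} (hx : x ∈ deg d) :
    gradedComp h d x = x := by
  rw [gradedComp_apply h d d hx, if_pos rfl]

theorem exists_sum_gradedComp (h : DirectSum.IsInternal deg) (x : M) :
    ∃ s : Finset (ℤ × ℤ), (∀ d ∉ s, gradedComp h d x = 0) ∧ ∑ d ∈ s, gradedComp h d x = x := by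
  classical
  obtain ⟨y, rfl⟩ := h.2 x
  have hy (d : ℤ × ℤ) : gradedComp h d (DirectSum.coeAddMonoidHom deg y) = y d := by
    change (((AddEquiv.ofBijective (DirectSum.coeAddMonoidHom deg) h).symm
      (AddEquiv.ofBijective (DirectSum.coeAddMonoidHom deg) h y)) d : M) = _
    rw [AddEquiv.symm_apply_apply]
  refine ⟨DFinsupp.support y, fun d hd => ?_, ?_⟩
  · rw [hy, DFinsupp.notMem_support_iff.1 hd, ZeroMemClass.coe_zero]
  · simp only [hy]
    exact (DirectSum.coeAddMonoidHom_eq_dfinsuppSum deg y).symm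

theorem graded_induction (h : DirectSum.IsInternal deg) (S : AddSubgroup M)
    (hS : ∀ d, deg d ≤ S) (x : M) : x ∈ S := by
  obtain ⟨s, -, hs⟩ := exists_sum_gradedComp h x
  rw [← hs]
  exact S.sum_mem fun d _ => hS d (gradedComp_mem h d x)

theorem mem_of_gradedComp_mem (h : DirectSum.IsInternal deg) (S : AddSubgroup M) {x : M}
    (hS : ∀ d, gradedComp h d x ∈ S) : x ∈ S := by
  obtain ⟨s, -, hs⟩ := exists_sum_gradedComp h x
  rw [← hs]
  exact S.sum_mem fun d _ => hS d

theorem gradedComp_map (h : DirectSum.IsInternal deg) (h' : DirectSum.IsInternal deg')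
    (T : M →+ N) (e : ℤ × ℤ) (hT : ∀ d, ∀ x ∈ deg d, T x ∈ deg' (d + e)) (d : ℤ × ℤ) (x : M) :
    gradedComp h' d (T x) = T (gradedComp h (d - e) x) := by
  refine graded_induction h (((gradedComp h' d).comp T).eqLocus (T.comp (gradedComp h (d - e))))
    (fun c x hx => ?_) x
  change gradedComp h' d (T x) = T (gradedComp h (d - e) x)
  rw [gradedComp_apply h' _ _ (hT c x hx), gradedComp_apply h _ _ hx]
  by_cases hc : c = d - e
  · rw [if_pos hc, if_pos (by rw [hc, sub_add_cancel])]
  · rw [if_neg hc, if_neg fun h => hc (eq_sub_of_add_eq h), map_zero]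

theorem isInternal_of_comp (π : ℤ × ℤ → M →+ M)
    (h1 : ∀ d e, ∀ x ∈ deg d, π e x = if d = e then x else 0) (h2 : ⨆ d, deg d = ⊤) :
    DirectSum.IsInternal deg := by
  constructor
  · rw [injective_iff_map_eq_zero]
    intro y hy
    have (d : ℤ × ℤ) (z : DirectSum (ℤ × ℤ) fun d => deg d) :
        π d (DirectSum.coeAddMonoidHom deg z) = z d := by
      induction z using DirectSum.induction_on with
      | zero => simp
      | of i z =>
        rw [DirectSum.coeAddMonoidHom_of, h1 i d z z.2, DirectSum.coe_of_apply]
        split_ifs <;> rfl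
      | add x y hx hy => rw [map_add, map_add, hx, hy]; rfl
    ext d
    rw [← this, hy, map_zero]
    rfl
  · rw [← AddMonoidHom.range_eq_top, eq_top_iff, ← h2, iSup_le_iff]
    exact fun d x hx => ⟨DirectSum.of (fun d => deg d) d ⟨x, hx⟩, DirectSum.coeAddMonoidHom_of ..⟩

/-- A subgroup containing the homogeneous components of its elements. -/
def IsHomogeneousSubgroup (h : DirectSum.IsInternal deg) (S : AddSubgroup M) : Prop :=
  ∀ d, ∀ x ∈ S, gradedComp h d x ∈ S

end Graded

/-! ### Exactness on successive quotients. -/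

section AddMul

variable {M : Type*} [AddCommGroup M] [Module A1 M]

/-- The subgroup `S + a M`. -/
def addMul (S : AddSubgroup M) (a : A1) : AddSubgroup M where
  carrier := {x | ∃ m : M, x - a • m ∈ S}
  add_mem' := by
    rintro x y ⟨m, hm⟩ ⟨n, hn⟩
    refine ⟨m + n, ?_⟩
    convert S.add_mem hm hn using 1
    rw [smul_add]; abel
  zero_mem' := ⟨0, by simp⟩
  neg_mem' := by
    rintro x ⟨m, hm⟩
    refine ⟨-m, ?_⟩
    convert S.neg_mem hm using 1
    rw [smul_neg]; abel

variable {S : AddSubgroup M} {a c : A1}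

theorem le_addMul (S : AddSubgroup M) (a : A1) : S ≤ addMul S a := fun x hx => ⟨0, by simpa⟩

theorem smul_mem_addMul (S : AddSubgroup M) (a : A1) (m : M) : a • m ∈ addMul S a := ⟨m, by simp⟩

theorem smul_mem_addMul_of_comm (hS : ∀ x ∈ S, a • x ∈ S)
    (hac : ∀ m : M, a • c • m - c • a • m ∈ S) {x : M} (hx : x ∈ addMul S c) :
    a • x ∈ addMul S c := by
  obtain ⟨m, hm⟩ := hx
  refine ⟨a • m, ?_⟩
  convert S.add_mem (hS _ hm) (hac m) using 1
  rw [smul_sub]; abel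

variable {deg : ℤ × ℤ → AddSubgroup M} {h : DirectSum.IsInternal deg}

theorem gradedComp_smul (h : DirectSum.IsInternal deg) {a : A1} {e : ℤ × ℤ}
    (ha : ∀ d, ∀ x ∈ deg d, a • x ∈ deg (d + e)) (d : ℤ × ℤ) (x : M) :
    gradedComp h d (a • x) = a • gradedComp h (d - e) x :=
  gradedComp_map h h (mulBy M a) e ha d x

theorem IsHomogeneousSubgroup.addMul (hS : IsHomogeneousSubgroup h S) {e : ℤ × ℤ}
    (ha : ∀ d, ∀ x ∈ deg d, a • x ∈ deg (d + e)) : IsHomogeneousSubgroup h (addMul S a) := by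
  rintro d x ⟨m, hm⟩
  refine ⟨gradedComp h (d - e) m, ?_⟩
  rw [← gradedComp_smul h ha, ← map_sub]
  exact hS d _ hm

/-- A double complex argument. On `M/S` the operators `a` and `c` commute, square to zero and are
exact. A cycle for `a` modulo `c M` starts a zigzag whose successive terms move by `e - e'`; it
leaves the finitely many degrees where `M/S` is nonzero, and retracing it shows that the cycle is a
boundary. -/
theorem IsExactMod.addMul (hS : IsHomogeneousSubgroup h S)
    {D : Set (ℤ × ℤ)} (hD : D.Finite) (hDS : ∀ d ∉ D, deg d ≤ S)
    {e e' : ℤ × ℤ} (hae : ∀ d, ∀ x ∈ deg d, a • x ∈ deg (d + e))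
    (hce : ∀ d, ∀ x ∈ deg d, c • x ∈ deg (d + e')) (he : e ≠ e')
    (ha : ∀ x ∈ S, a • x ∈ S) (hc : ∀ x ∈ S, c • x ∈ S)
    (hac : ∀ m : M, a • c • m - c • a • m ∈ S)
    (haa : ∀ m : M, a • a • m ∈ S) (hcc : ∀ m : M, c • c • m ∈ S)
    (ea : IsExactMod S a) (ec : IsExactMod S c) : IsExactMod (addMul S c) a := by
  have key (n : ℕ) : ∀ d, d + n • (e - e') ∉ D → ∀ v ∈ deg d, a • v ∈ RMotivic.addMul S c →
      v ∈ RMotivic.addMul (RMotivic.addMul S c) a := by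
    induction n with
    | zero =>
      intro d hd v hv _
      rw [zero_smul, add_zero] at hd
      exact le_addMul _ _ (le_addMul _ _ (hDS d hd hv))
    | succ n ih =>
      rintro d hd v hv ⟨w, hw⟩
      obtain ⟨w', hw', hwS⟩ : ∃ w' ∈ deg (d + (e - e')), a • v - c • w' ∈ S := by
        refine ⟨gradedComp h (d + (e - e')) w, gradedComp_mem h _ _, ?_⟩
        have := hS (d + e) _ hw
        rwa [map_sub, gradedComp_of_mem h (hae d v hv), gradedComp_smul h hce, add_sub_assoc] at this
      -- From `a v ≡ c w'` follows `c (a w') ≡ a (a v) ≡ 0`, so exactness of `c` makes `w'` a cycle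
      -- of the same kind, one step along the zigzag.
      have h1 : a • w' ∈ RMotivic.addMul S c := by
        refine ec (a • w') ?_
        have := S.sub_mem (S.sub_mem (haa v) (ha _ hwS)) (hac w')
        rw [smul_sub] at this
        convert this using 1
        abel
      obtain ⟨p, q, hpq⟩ := ih (d + (e - e')) (by rwa [add_assoc, ← succ_nsmul']) w' hw' h1
      -- Writing `w' ≡ a p + c q` gives `a v ≡ c w' ≡ a c p`, as `c c = 0` and `a`, `c` commute
      -- modulo `S`.
      have h2 : a • (v - c • p) ∈ S := by
        have := S.add_mem (S.sub_mem (S.add_mem hwS (hc _ hpq)) (hac p)) (hcc q)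
        convert this using 1
        simp only [smul_sub]
        abel
      obtain ⟨r, hr⟩ := ea _ h2
      refine ⟨r, p, ?_⟩
      convert hr using 1
      abel
  intro v hv
  refine mem_of_gradedComp_mem h (RMotivic.addMul (RMotivic.addMul S c) a) fun d => ?_
  -- Since `e ≠ e'`, the degrees `d + n • (e - e')` are distinct and eventually avoid the finite set
  -- `D`.
  obtain ⟨n, hn⟩ : ∃ n : ℕ, d + n • (e - e') ∉ D := by
    by_contra! hcon
    have hinj : Function.Injective fun n : ℕ => d + n • (e - e') := by
      intro m n hmn
      have : m • (e - e') = n • (e - e') := add_left_cancel hmn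
      have he' : e - e' ≠ 0 := sub_ne_zero.2 he
      rw [ne_eq, Prod.ext_iff, not_and_or] at he'
      have h1 := congrArg Prod.fst this
      have h2 := congrArg Prod.snd this
      rw [Prod.smul_fst, Prod.smul_fst, nsmul_eq_mul, nsmul_eq_mul] at h1
      rw [Prod.smul_snd, Prod.smul_snd, nsmul_eq_mul, nsmul_eq_mul] at h2
      rcases he' with h | h
      · exact_mod_cast mul_right_cancel₀ h h1
      · exact_mod_cast mul_right_cancel₀ h h2
    exact Set.infinite_range_of_injective hinj (hD.subset (by rintro _ ⟨n, rfl⟩; exact hcon n))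
  refine key n d hn _ (gradedComp_mem h _ _) ?_
  have := (hS.addMul hce) (d + e) _ hv
  rwa [gradedComp_smul h hae, add_sub_cancel_right] at this

/-- Descent of injectivity modulo `S + a M` to injectivity modulo `S`. -/
theorem comap_le_of_comap_addMul_le {N : Type*} [AddCommGroup N] [Module A1 N] (f : N →ₗ[A1] M)
    {T : AddSubgroup N} (ea : IsExactMod S a) (hT : ∀ x ∈ T, f x ∈ S) (haT : ∀ x ∈ T, a • x ∈ T)
    (haa : ∀ n : N, a • a • n ∈ T)
    (hf : ∀ x, f x ∈ addMul S a → x ∈ addMul T a) {x : N} (hx : f x ∈ S) : x ∈ T := by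
  -- Write `x ≡ a v` modulo `T`. Then `a (f v) ∈ S`, so exactness puts `f v` in `S + a M` and the
  -- hypothesis puts `v` in `T + a N`; as `a a N ⊆ T`, this gives `x ∈ T`. Exactness is needed only
  -- in the target.
  obtain ⟨v, hv⟩ := hf x (le_addMul _ _ hx)
  have h1 : a • f v ∈ S := by
    have := S.sub_mem hx (hT _ hv)
    rw [map_sub, map_smul] at this
    convert this using 1
    abel
  obtain ⟨w, hw⟩ := hf v (ea _ h1)
  have h2 := T.add_mem hv (T.add_mem (haT _ hw) (haa w))
  rw [smul_sub] at h2
  convert h2 using 1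
  abel

end AddMul

/-! ### The filtration of the augmentation ideal by `(ρ, τ)`, `Q1`, `Sq1`, `Sq2`. -/

section Augmentation

variable {M N : Type*} [AddCommGroup M] [Module A1 M] [AddCommGroup N] [Module A1 N]

theorem map_mem_addMul {f : M →ₗ[A1] N} {S : AddSubgroup M} {T : AddSubgroup N}
    (hf : ∀ x ∈ S, f x ∈ T) {a : A1} {x : M} (hx : x ∈ addMul S a) : f x ∈ addMul T a := by
  obtain ⟨m, hm⟩ := hx
  exact ⟨f m, by rw [← map_smul, ← map_sub]; exact hf _ hm⟩

theorem smul_mem_of_generators {S : AddSubgroup M} (h1 : ∀ x ∈ S, τ • x ∈ S)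
    (h2 : ∀ x ∈ S, ρ • x ∈ S) (h3 : ∀ x ∈ S, Sq1 • x ∈ S) (h4 : ∀ x ∈ S, Sq2 • x ∈ S)
    (a : A1) {x : M} (hx : x ∈ S) : a • x ∈ S := by
  induction a using A1_induction generalizing x with
  | tau => exact h1 x hx
  | rho => exact h2 x hx
  | sq1 => exact h3 x hx
  | sq2 => exact h4 x hx
  | zero => rw [zero_smul]; exact S.zero_mem
  | one => rwa [one_smul]
  | add a b ha hb => rw [add_smul]; exact S.add_mem (ha hx) (hb hx)
  | mul a b ha hb => rw [mul_smul]; exact ha (hb hx)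

variable (M) in
/-- The subgroup `(ρ, τ) M + Q₁ M`. -/
noncomputable def rhoTauQ1 : AddSubgroup M := addMul (rhoTau M).toAddSubgroup Q1

variable (M) in
/-- The subgroup `(ρ, τ) M + Q₁ M + Sq¹ M`. -/
noncomputable def rhoTauQ1Sq1 : AddSubgroup M := addMul (rhoTauQ1 M) Sq1

variable (M) in
/-- The subgroup `(ρ, τ) M + Q₁ M + Sq¹ M + Sq² M`. -/
noncomputable def augmented : AddSubgroup M := addMul (rhoTauQ1Sq1 M) Sq2

theorem rhoTau_le_rhoTauQ1 {x : M} (h : x ∈ rhoTau M) : x ∈ rhoTauQ1 M := le_addMul _ _ h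

theorem rhoTauQ1_le : rhoTauQ1 M ≤ rhoTauQ1Sq1 M := le_addMul _ _

theorem rhoTauQ1Sq1_le : rhoTauQ1Sq1 M ≤ augmented M := le_addMul _ _

theorem rhoTau_le_augmented {x : M} (h : x ∈ rhoTau M) : x ∈ augmented M :=
  rhoTauQ1Sq1_le (rhoTauQ1_le (rhoTau_le_rhoTauQ1 h))

theorem Sq1_mul_Q1 : Sq1 * Q1 = Q1 * Sq1 := by
  simp [Q1, mul_add, add_mul, mul_assoc, Sq1_mul_Sq1, Sq1_mul_Sq1_mul]

/-- The `ρ`-term arises when the `τ` in `Sq2 * Sq2` is moved past `Sq1`. Thus `Q1` commutes with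
`Sq2` only modulo `ρ`, and `(ρ, τ)` has to be divided out first. -/
theorem Sq2_mul_Q1 : Sq2 * Q1 = Q1 * Sq2 + ρ * (Sq1 * (Sq2 * Sq1)) := by
  simp [Q1, mul_add, add_mul, mul_assoc, Sq1_mul_Sq1, Sq2_mul_Sq2, Sq2_mul_Sq2_mul,
    Sq1_mul_Sq1_mul, Sq1_mul_τ_mul]
  rw [add_right_comm, A1_add_self, zero_add]

theorem Q1_mul_Q1_mem : Q1 * Q1 ∈ rhoTau A1 := by
  refine mem_of_redCoord ?_
  rw [redCoord_Q1_mul, Q1]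
  obtain ⟨h0, h1, h2, h3, h4, h5, h6, h7⟩ := redCoord_words
  ext j
  fin_cases j <;> simp [h3, h4, CharTwo.add_self_eq_zero]

theorem Sq2_mul_Sq2_mem : Sq2 * Sq2 ∈ rhoTau A1 := by
  rw [Sq2_mul_Sq2]; exact τ_smul_mem_rhoTau _

theorem smul_smul_sub_mem {a b : A1} (h : a * b - b * a ∈ rhoTau A1) (m : M) :
    a • b • m - b • a • m ∈ rhoTau M := by
  rw [← mul_smul, ← mul_smul, ← sub_smul]
  exact smul_mem_rhoTau_of_mem h m

theorem Sq1_Q1_comm_mem (m : M) : Sq1 • Q1 • m - Q1 • Sq1 • m ∈ rhoTau M :=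
  smul_smul_sub_mem (by rw [Sq1_mul_Q1, sub_self]; exact zero_mem _) m

theorem Sq2_Q1_comm_mem (m : M) : Sq2 • Q1 • m - Q1 • Sq2 • m ∈ rhoTau M :=
  smul_smul_sub_mem (by rw [Sq2_mul_Q1, add_sub_cancel_left]; exact ρ_smul_mem_rhoTau _) m

theorem τ_comm_mem (a : A1) (m : M) : τ • a • m - a • τ • m ∈ rhoTau M :=
  (rhoTau M).sub_mem (τ_smul_mem_rhoTau _) ((rhoTau M).smul_mem a (τ_smul_mem_rhoTau _))

theorem ρ_comm_mem (a : A1) (m : M) : ρ • a • m - a • ρ • m ∈ rhoTau M :=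
  (rhoTau M).sub_mem (ρ_smul_mem_rhoTau _) ((rhoTau M).smul_mem a (ρ_smul_mem_rhoTau _))

theorem Sq2_Sq1_comm_mem (m : M) : Sq2 • Sq1 • m - Sq1 • Sq2 • m ∈ rhoTauQ1 M := by
  -- The witness is `m` itself, the subtracted term being zero: in characteristic 2 the commutator
  -- of `Sq2` and `Sq1` is `Q1`.
  refine ⟨m - Sq1 • Sq2 • 0, ?_⟩
  rw [Q1]
  have h : Sq1 • Sq2 • m + Sq1 • Sq2 • m = 0 := by
    rw [← mul_smul, ← add_smul, A1_add_self, zero_smul]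
  have : Sq2 • Sq1 • m - Sq1 • Sq2 • m - (Sq1 * Sq2 + Sq2 * Sq1) • (m - Sq1 • Sq2 • 0) =
      -(Sq1 • Sq2 • m + Sq1 • Sq2 • m) := by
    simp only [smul_zero, sub_zero, add_smul, mul_smul]; abel
  rw [this, h, neg_zero]
  exact zero_mem _

theorem smul_mem_rhoTauQ1 (a : A1) {x : M} (hx : x ∈ rhoTauQ1 M) : a • x ∈ rhoTauQ1 M := by
  have h (a : A1) : ∀ x ∈ (rhoTau M).toAddSubgroup, a • x ∈ (rhoTau M).toAddSubgroup :=
    fun _ => (rhoTau M).smul_mem a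
  exact smul_mem_of_generators
    (fun x hx => smul_mem_addMul_of_comm (h _) (τ_comm_mem _) hx)
    (fun x hx => smul_mem_addMul_of_comm (h _) (ρ_comm_mem _) hx)
    (fun x hx => smul_mem_addMul_of_comm (h _) Sq1_Q1_comm_mem hx)
    (fun x hx => smul_mem_addMul_of_comm (h _) Sq2_Q1_comm_mem hx) a hx

theorem smul_mem_rhoTauQ1Sq1 (a : A1) {x : M} (hx : x ∈ rhoTauQ1Sq1 M) :
    a • x ∈ rhoTauQ1Sq1 M := by
  have h (a : A1) : ∀ x ∈ rhoTauQ1 M, a • x ∈ rhoTauQ1 M := fun _ => smul_mem_rhoTauQ1 a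
  refine smul_mem_of_generators
    (fun x hx => smul_mem_addMul_of_comm (h _) (fun m => rhoTau_le_rhoTauQ1 (τ_comm_mem _ m)) hx)
    (fun x hx => smul_mem_addMul_of_comm (h _) (fun m => rhoTau_le_rhoTauQ1 (ρ_comm_mem _ m)) hx)
    (fun x hx => smul_mem_addMul _ _ _)
    (fun x hx => smul_mem_addMul_of_comm (h _) Sq2_Sq1_comm_mem hx) a hx

theorem smul_mem_augmented (a : A1) {x : M} (hx : x ∈ augmented M) : a • x ∈ augmented M :=
  smul_mem_of_generators
    (fun x _ => rhoTau_le_augmented (τ_smul_mem_rhoTau x))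
    (fun x _ => rhoTau_le_augmented (ρ_smul_mem_rhoTau x))
    (fun x _ => rhoTauQ1Sq1_le (smul_mem_addMul _ _ x))
    (fun x _ => smul_mem_addMul _ _ x) a hx

theorem map_mem_rhoTauQ1 (f : M →ₗ[A1] N) {x : M} (hx : x ∈ rhoTauQ1 M) : f x ∈ rhoTauQ1 N :=
  map_mem_addMul (fun _ => map_mem_rhoTau f) hx

theorem map_mem_rhoTauQ1Sq1 (f : M →ₗ[A1] N) {x : M} (hx : x ∈ rhoTauQ1Sq1 M) :
    f x ∈ rhoTauQ1Sq1 N :=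
  map_mem_addMul (fun _ => map_mem_rhoTauQ1 f) hx

theorem map_mem_augmented (f : M →ₗ[A1] N) {x : M} (hx : x ∈ augmented M) : f x ∈ augmented N :=
  map_mem_addMul (fun _ => map_mem_rhoTauQ1Sq1 f) hx

/-- All four algebra generators are augmented, so `A1` modulo its augmentation ideal has no classes
besides `0` and `1`. Linear relations modulo `augmented` thereby become relations among subset sums.
-/
theorem mem_augmented_A1_or (a : A1) : a ∈ augmented A1 ∨ a - 1 ∈ augmented A1 := by
  induction a using A1_induction with
  | tau => exact Or.inl (by simpa using rhoTau_le_augmented (τ_smul_mem_rhoTau (1 : A1)))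
  | rho => exact Or.inl (by simpa using rhoTau_le_augmented (ρ_smul_mem_rhoTau (1 : A1)))
  | sq1 => exact Or.inl (by simpa using rhoTauQ1Sq1_le (smul_mem_addMul (rhoTauQ1 A1) Sq1 1))
  | sq2 => exact Or.inl (by simpa [augmented] using smul_mem_addMul (rhoTauQ1Sq1 A1) Sq2 1)
  | zero => exact Or.inl (zero_mem _)
  | one => exact Or.inr (by rw [sub_self]; exact zero_mem _)
  | add a b ha hb =>
    rcases ha with ha | ha <;> rcases hb with hb | hb
    · exact Or.inl (add_mem ha hb)
    · exact Or.inr (by convert add_mem ha hb using 1; abel)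
    · exact Or.inr (by convert add_mem ha hb using 1; abel)
    · refine Or.inl ?_
      convert add_mem ha hb using 1
      rw [sub_add_sub_comm, A1_add_self, sub_zero]
  | mul a b ha hb =>
    rcases hb with hb | hb
    · exact Or.inl (smul_mem_augmented a hb)
    · have h := smul_mem_augmented a hb
      rw [smul_eq_mul, mul_sub, mul_one] at h
      rcases ha with ha | ha
      · exact Or.inl (by convert add_mem h ha using 1; abel)
      · exact Or.inr (by convert add_mem h ha using 1; abel)

theorem smul_mem_augmented_of_mem {a : A1} (ha : a ∈ augmented A1) (m : M) :
    a • m ∈ augmented M := by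
  obtain ⟨b, c, d, y, z, h⟩ := ha
  refine ⟨b • m, c • m, d • m, y • m, z • m, ?_⟩
  rw [← smul_assoc, ← smul_assoc, ← smul_assoc, ← smul_assoc, ← smul_assoc, ← sub_smul, ← sub_smul,
    ← sub_smul, h, add_smul]

theorem pi_mem_augmented {ι : Type} [Fintype ι] {v : ι → A1} (h : ∀ i, v i ∈ augmented A1) :
    v ∈ augmented (ι → A1) := by
  classical
  rw [← Finset.univ_sum_single v]
  exact sum_mem fun i _ => map_mem_augmented (LinearMap.single A1 (fun _ => A1) i) (h i)

variable {φ : M →ₗ[A1] N}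

/-- A map into a module which is exact modulo `(ρ, τ)` with respect to `Q₁`, `Sq¹`, `Sq²` (in the
sense of the successive quotients) is injective modulo `(ρ, τ)` if it is so modulo `augmented`. -/
theorem mem_rhoTau_of_map_mem (hz : IsExactMod (rhoTau N).toAddSubgroup Q1)
    (hx : IsExactMod (rhoTauQ1 N) Sq1) (hy : IsExactMod (rhoTauQ1Sq1 N) Sq2)
    (hφ : ∀ m, φ m ∈ augmented N → m ∈ augmented M) {m : M} (hm : φ m ∈ rhoTau N) :
    m ∈ rhoTau M := by
  have h2 (m : M) (hm : φ m ∈ rhoTauQ1Sq1 N) : m ∈ rhoTauQ1Sq1 M :=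
    comap_le_of_comap_addMul_le φ hy (fun _ => map_mem_rhoTauQ1Sq1 φ)
      (fun _ => smul_mem_rhoTauQ1Sq1 _)
      (fun n => rhoTauQ1_le (rhoTau_le_rhoTauQ1 (by
        rw [← mul_smul]; exact smul_mem_rhoTau_of_mem Sq2_mul_Sq2_mem n))) hφ hm
  have h1 (m : M) (hm : φ m ∈ rhoTauQ1 N) : m ∈ rhoTauQ1 M :=
    comap_le_of_comap_addMul_le φ hx (fun _ => map_mem_rhoTauQ1 φ)
      (fun _ => smul_mem_rhoTauQ1 _)
      (fun n => by rw [← mul_smul, Sq1_mul_Sq1, zero_smul]; exact zero_mem _) h2 hm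
  exact comap_le_of_comap_addMul_le (T := (rhoTau M).toAddSubgroup) φ hz
    (fun _ => map_mem_rhoTau φ) (fun _ => (rhoTau M).smul_mem _)
    (fun n => by rw [← mul_smul]; exact smul_mem_rhoTau_of_mem Q1_mul_Q1_mem n) h1 hm

end Augmentation

/-! ### Generators, Nakayama arguments and the detection theorem. -/

namespace FreeMod

variable (C : FreeMod.{u})

theorem finite_coeff : Module.Finite M2R C := C.finite

theorem projective_coeff : Module.Projective M2R C := C.projective

/-- The projection onto the component of degree `d`. -/
noncomputable abbrev comp (d : ℤ × ℤ) : C →+ C := gradedComp C.isInternal d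

variable {C}

theorem comp_τ_smul (d : ℤ × ℤ) (x : C) : C.comp d (τ • x) = τ • C.comp (d - (0, 1)) x :=
  gradedComp_smul C.isInternal C.τ_smul_mem d x

theorem comp_ρ_smul (d : ℤ × ℤ) (x : C) : C.comp d (ρ • x) = ρ • C.comp (d - (1, 1)) x :=
  gradedComp_smul C.isInternal C.ρ_smul_mem d x

theorem comp_Sq1_smul (d : ℤ × ℤ) (x : C) : C.comp d (Sq1 • x) = Sq1 • C.comp (d - (1, 0)) x :=
  gradedComp_smul C.isInternal C.Sq1_smul_mem d x

theorem comp_Sq2_smul (d : ℤ × ℤ) (x : C) : C.comp d (Sq2 • x) = Sq2 • C.comp (d - (2, 1)) x :=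
  gradedComp_smul C.isInternal C.Sq2_smul_mem d x

theorem Q1_smul_mem (d : ℤ × ℤ) (x : C) (hx : x ∈ C.deg d) : Q1 • x ∈ C.deg (d + (3, 1)) := by
  rw [Q1, add_smul, mul_smul, mul_smul]
  refine add_mem ?_ ?_
  · have := C.Sq1_smul_mem _ _ (C.Sq2_smul_mem _ _ hx)
    rwa [add_assoc] at this
  · have := C.Sq2_smul_mem _ _ (C.Sq1_smul_mem _ _ hx)
    rwa [add_assoc] at this

theorem comp_Q1_smul (d : ℤ × ℤ) (x : C) : C.comp d (Q1 • x) = Q1 • C.comp (d - (3, 1)) x :=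
  gradedComp_smul C.isInternal Q1_smul_mem d x

theorem isHomogeneous_rhoTau :
    IsHomogeneousSubgroup C.isInternal (rhoTau C).toAddSubgroup := by
  rintro d _ ⟨y, z, rfl⟩
  refine ⟨C.comp (d - (1, 1)) y, C.comp (d - (0, 1)) z, ?_⟩
  rw [map_add, ← comp_τ_smul, ← comp_ρ_smul]

theorem coeff_smul_mem {M : Type*} [AddCommGroup M] [Module A1 M] {B : AddSubgroup M}
    (h1 : ∀ x ∈ B, τ • x ∈ B) (h2 : ∀ x ∈ B, ρ • x ∈ B) (r : M2R) {x : M} (hx : x ∈ B) :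
    coeff r • x ∈ B := by
  induction r using MvPolynomial.induction_on generalizing x with
  | C c =>
    obtain rfl | rfl : c = 0 ∨ c = 1 := by revert c; decide
    · simp
    · simpa using hx
  | add p q hp hq => rw [map_add, add_smul]; exact B.add_mem (hp hx) (hq hx)
  | mul_X p i hp =>
    rw [map_mul, mul_smul]
    refine hp ?_
    fin_cases i
    · simp only [Fin.zero_eta, coeff_X_zero]; exact h1 _ hx
    · simp only [Fin.mk_one, coeff_X_one]; exact h2 _ hx

variable (C) in
theorem exists_homogeneous_generators : ∃ E : Finset C, (∀ x ∈ E, ∃ d, x ∈ C.deg d) ∧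
    ∀ B : AddSubgroup C, (∀ x ∈ E, x ∈ B) → (∀ x ∈ B, τ • x ∈ B) → (∀ x ∈ B, ρ • x ∈ B) →
      ∀ x, x ∈ B := by
  classical
  obtain ⟨G, hG⟩ := C.finite_coeff
  choose s _ hs using exists_sum_gradedComp C.isInternal
  refine ⟨G.biUnion fun x => (s x).image fun d => C.comp d x, ?_, ?_⟩
  · intro x hx
    obtain ⟨y, -, hy⟩ := Finset.mem_biUnion.1 hx
    obtain ⟨d, -, rfl⟩ := Finset.mem_image.1 hy
    exact ⟨d, gradedComp_mem _ _ _⟩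
  · intro B hB h1 h2 x
    have hx : x ∈ Submodule.span M2R (G : Set C) := hG ▸ Submodule.mem_top
    induction hx using Submodule.span_induction with
    | mem x hx =>
      rw [← hs x]
      refine B.sum_mem fun d hd => hB _ ?_
      exact Finset.mem_biUnion.2 ⟨x, hx, Finset.mem_image_of_mem _ hd⟩
    | zero => exact B.zero_mem
    | add x y _ _ hx hy => exact B.add_mem hx hy
    | smul r x _ hx => exact coeff_smul_mem h1 h2 r hx

-- Modulo `(ρ, τ)` only the degrees of a finite set of homogeneous generators survive, although `C`
-- itself may be nonzero in infinitely many degrees. This is the finiteness that `IsExactMod.addMul`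
-- needs.
variable (C) in
theorem finite_deg_not_le : {d | ¬ C.deg d ≤ (rhoTau C).toAddSubgroup}.Finite := by
  obtain ⟨E, hE, hgen⟩ := C.exists_homogeneous_generators
  choose! d hd using hE
  refine (E.image d).finite_toSet.subset fun e he => ?_
  by_contra hne
  refine he fun x hx => ?_
  have := hgen ((rhoTau C).toAddSubgroup.comap (C.comp e)) (fun y hy => ?_)
    (fun y _ => isHomogeneous_rhoTau e _ (τ_smul_mem_rhoTau y))
    (fun y _ => isHomogeneous_rhoTau e _ (ρ_smul_mem_rhoTau y)) x
  · rwa [AddSubgroup.mem_comap, gradedComp_of_mem _ hx] at this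
  · rw [AddSubgroup.mem_comap, gradedComp_apply _ _ _ (hd y hy), if_neg]
    · exact zero_mem _
    · rintro rfl
      exact hne (Finset.mem_coe.2 (Finset.mem_image_of_mem d hy))

-- The sum of the two degrees is used because `τ` and `ρ` raise it by `1` and `2`, so it is bounded
-- below by its values on generators. The first degree alone would not see `τ`.
variable (C) in
theorem exists_deg_eq_bot : ∃ n : ℤ, ∀ d : ℤ × ℤ, d.1 + d.2 < n → ∀ x ∈ C.deg d, x = 0 := by
  obtain ⟨E, hE, hgen⟩ := C.exists_homogeneous_generators
  choose! d hd using hE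
  obtain ⟨n, hn⟩ : ∃ n : ℤ, ∀ x ∈ E, n ≤ (d x).1 + (d x).2 := by
    obtain ⟨n, hn⟩ := (E.image fun x => (d x).1 + (d x).2).bddBelow
    exact ⟨n, fun x hx => hn (Finset.mem_coe.2 (Finset.mem_image_of_mem _ hx))⟩
  let B : AddSubgroup C := ⨅ e : {e : ℤ × ℤ // e.1 + e.2 < n}, (C.comp e).ker
  have hB (x : C) : x ∈ B ↔ ∀ e : ℤ × ℤ, e.1 + e.2 < n → C.comp e x = 0 := by
    simp [B, AddSubgroup.mem_iInf, AddMonoidHom.mem_ker]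
  refine ⟨n, fun e he x hx => ?_⟩
  have := hgen B (fun y hy => (hB y).2 fun e he => ?_) (fun y hy => (hB _).2 fun e he => ?_)
    (fun y hy => (hB _).2 fun e he => ?_) x
  · rw [← gradedComp_of_mem C.isInternal hx]
    exact (hB x).1 this e he
  · rw [gradedComp_apply _ _ _ (hd y hy), if_neg]
    rintro rfl
    exact absurd (hn y hy) (not_le.2 he)
  · rw [comp_τ_smul, (hB y).1 hy _ (by simp only [Prod.fst_sub, Prod.snd_sub]; linarith), smul_zero]
  · rw [comp_ρ_smul, (hB y).1 hy _ (by simp only [Prod.fst_sub, Prod.snd_sub]; linarith), smul_zero]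

theorem isExactMod_rhoTauQ1_Sq1 (hx : IsExactMod (rhoTau C).toAddSubgroup Sq1)
    (hz : IsExactMod (rhoTau C).toAddSubgroup Q1) : IsExactMod (rhoTauQ1 C) Sq1 :=
  IsExactMod.addMul isHomogeneous_rhoTau C.finite_deg_not_le (fun d hd => not_not.1 hd)
    C.Sq1_smul_mem Q1_smul_mem (by decide) (fun _ => (rhoTau C).smul_mem _)
    (fun _ => (rhoTau C).smul_mem _) Sq1_Q1_comm_mem
    (fun m => by rw [← mul_smul, Sq1_mul_Sq1, zero_smul]; exact zero_mem _)
    (fun m => by rw [← mul_smul]; exact smul_mem_rhoTau_of_mem Q1_mul_Q1_mem m) hx hz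

theorem isExactMod_rhoTauQ1_Sq2 (hy : IsExactMod (rhoTau C).toAddSubgroup Sq2)
    (hz : IsExactMod (rhoTau C).toAddSubgroup Q1) : IsExactMod (rhoTauQ1 C) Sq2 :=
  IsExactMod.addMul isHomogeneous_rhoTau C.finite_deg_not_le (fun d hd => not_not.1 hd)
    C.Sq2_smul_mem Q1_smul_mem (by decide) (fun _ => (rhoTau C).smul_mem _)
    (fun _ => (rhoTau C).smul_mem _) Sq2_Q1_comm_mem
    (fun m => by rw [← mul_smul]; exact smul_mem_rhoTau_of_mem Sq2_mul_Sq2_mem m)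
    (fun m => by rw [← mul_smul]; exact smul_mem_rhoTau_of_mem Q1_mul_Q1_mem m) hy hz

theorem isExactMod_rhoTauQ1Sq1_Sq2 (hx : IsExactMod (rhoTauQ1 C) Sq1)
    (hy : IsExactMod (rhoTauQ1 C) Sq2) : IsExactMod (rhoTauQ1Sq1 C) Sq2 :=
  IsExactMod.addMul (isHomogeneous_rhoTau.addMul Q1_smul_mem) C.finite_deg_not_le
    (fun d hd => (not_not.1 hd).trans fun _ => rhoTau_le_rhoTauQ1)
    C.Sq2_smul_mem C.Sq1_smul_mem (by decide) (fun _ => smul_mem_rhoTauQ1 _)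
    (fun _ => smul_mem_rhoTauQ1 _) Sq2_Sq1_comm_mem
    (fun m => by
      rw [← mul_smul]; exact rhoTau_le_rhoTauQ1 (smul_mem_rhoTau_of_mem Sq2_mul_Sq2_mem m))
    (fun m => by rw [← mul_smul, Sq1_mul_Sq1, zero_smul]; exact zero_mem _) hy hx

-- A generating set of least cardinality modulo `augmented` is independent there: a nonempty
-- vanishing subset sum would make one of its members redundant. Over `𝔽₂` subset sums are all the
-- linear combinations.
variable (C) in
theorem exists_minimal_generators : ∃ E : Finset C, (∀ x ∈ E, ∃ d, x ∈ C.deg d) ∧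
    (∀ x, x ∈ AddSubgroup.closure (E : Set C) ⊔ augmented C) ∧
    ∀ T ⊆ E, ∑ x ∈ T, x ∈ augmented C → T = ∅ := by
  classical
  have hex : ∃ n, ∃ E : Finset C, E.card = n ∧ (∀ x ∈ E, ∃ d, x ∈ C.deg d) ∧
      (∀ x, x ∈ AddSubgroup.closure (E : Set C) ⊔ augmented C) := by
    obtain ⟨E, hE, hgen⟩ := C.exists_homogeneous_generators
    refine ⟨_, E, rfl, hE, hgen _ (fun x hx => ?_) (fun x _ => ?_) (fun x _ => ?_)⟩
    · exact AddSubgroup.mem_sup_left (AddSubgroup.subset_closure hx)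
    · exact AddSubgroup.mem_sup_right (rhoTau_le_augmented (τ_smul_mem_rhoTau x))
    · exact AddSubgroup.mem_sup_right (rhoTau_le_augmented (ρ_smul_mem_rhoTau x))
  obtain ⟨E, hcard, hE, hgen⟩ := Nat.find_spec hex
  refine ⟨E, hE, hgen, fun T hT hsum => ?_⟩
  by_contra hne
  obtain ⟨x, hx⟩ := Finset.nonempty_iff_ne_empty.2 hne
  have hlt : (E.erase x).card < Nat.find hex := hcard ▸ Finset.card_erase_lt_of_mem (hT hx)
  refine Nat.find_min hex hlt ⟨_, rfl, fun y hy => hE y (Finset.mem_of_mem_erase hy), fun y => ?_⟩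
  refine (sup_le ((AddSubgroup.closure_le _).2 fun z hz => ?_) le_sup_right : _ ≤ _) (hgen y)
  by_cases hzx : z = x
  · have hxs : x = ∑ y ∈ T, y - ∑ y ∈ T.erase x, y :=
      eq_sub_of_add_eq (Finset.add_sum_erase T (fun y => y) hx)
    rw [hzx, SetLike.mem_coe]
    refine (congrArg (· ∈ AddSubgroup.closure ((E.erase x : Finset C) : Set C) ⊔ augmented C)
      hxs).mpr ?_
    refine sub_mem (AddSubgroup.mem_sup_right hsum) (AddSubgroup.mem_sup_left ?_)
    exact sum_mem fun y hy => AddSubgroup.subset_closure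
      (Finset.mem_coe.2 (Finset.erase_subset_erase x hT hy))
  · exact AddSubgroup.mem_sup_left (AddSubgroup.subset_closure
      (Finset.mem_coe.2 (Finset.mem_erase.2 ⟨hzx, hz⟩)))

/-- The graded Nakayama lemma: homogeneous elements generating modulo `augmented` generate. -/
theorem span_eq_top {E : Set C} (hE : ∀ x ∈ E, ∃ d, x ∈ C.deg d)
    (hgen : ∀ x, x ∈ AddSubgroup.closure E ⊔ augmented C) : Submodule.span A1 E = ⊤ := by
  set H := Submodule.span A1 E with hH
  have hom (x : C) (hx : x ∈ H) : ∀ d, C.comp d x ∈ H := by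
    induction hx using Submodule.span_induction with
    | mem x hx =>
      intro d
      obtain ⟨e, he⟩ := hE x hx
      rw [gradedComp_apply _ _ _ he]
      split_ifs
      · exact Submodule.subset_span hx
      · exact H.zero_mem
    | zero => simp
    | add x y _ _ hx hy => intro d; rw [map_add]; exact H.add_mem (hx d) (hy d)
    | smul a x _ hx =>
      induction a using A1_induction generalizing x with
      | tau => intro d; rw [comp_τ_smul]; exact H.smul_mem _ (hx _)
      | rho => intro d; rw [comp_ρ_smul]; exact H.smul_mem _ (hx _)
      | sq1 => intro d; rw [comp_Sq1_smul]; exact H.smul_mem _ (hx _)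
      | sq2 => intro d; rw [comp_Sq2_smul]; exact H.smul_mem _ (hx _)
      | zero => simp
      | one => simpa using hx
      | add a b ha hb =>
        intro d
        rw [add_smul, map_add]
        exact H.add_mem (ha x ‹_› hx d) (hb x ‹_› hx d)
      | mul a b ha hb =>
        rw [mul_smul]
        exact ha _ (H.smul_mem b ‹_›) (hb x ‹_› hx)
  have hcl : AddSubgroup.closure E ≤ H.toAddSubgroup :=
    (AddSubgroup.closure_le _).2 Submodule.subset_span
  obtain ⟨n, hn⟩ := C.exists_deg_eq_bot
  -- Induction on the sum of the degrees, which `τ`, `ρ`, `Sq1`, `Sq2`, `Q1` raise by `1`, `2`, `1`,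
  -- `3`, `4`; every augmented term therefore has a coefficient in lower total degree.
  have key (k : ℕ) : ∀ d : ℤ × ℤ, d.1 + d.2 < n + k → ∀ x ∈ C.deg d, x ∈ H := by
    induction k with
    | zero =>
      intro d hd x hx
      rw [hn d (by simpa using hd) x hx]
      exact H.zero_mem
    | succ k ih =>
      intro d hd x hx
      push_cast at hd
      have ih' (d' : ℤ × ℤ) (h : d'.1 + d'.2 < n + k) (m : C) : C.comp d' m ∈ H :=
        ih d' h _ (gradedComp_mem _ _ _)
      obtain ⟨y, hy, s, ⟨m, z, w, p, q, hs⟩, hys⟩ := AddSubgroup.mem_sup.1 (hgen x)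
      have h1 : x = y + Sq2 • m + Sq1 • z + Q1 • w + ρ • p + τ • q := by
        rw [← hys, ← sub_eq_zero]
        have := sub_eq_zero.2 hs
        rw [← this]
        abel
      rw [← gradedComp_of_mem C.isInternal hx, h1]
      change C.comp d _ ∈ H
      simp only [map_add, comp_Sq2_smul, comp_Sq1_smul, comp_Q1_smul, comp_τ_smul, comp_ρ_smul]
      refine add_mem (add_mem (add_mem (add_mem (add_mem (hom y (hcl hy) d) ?_) ?_) ?_) ?_) ?_ <;>
      · refine H.smul_mem _ (ih' _ ?_ _)
        simp only [Prod.fst_sub, Prod.snd_sub]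
        linarith
  refine eq_top_iff.2 fun x _ => mem_of_gradedComp_mem C.isInternal H.toAddSubgroup fun d => ?_
  refine key (d.1 + d.2 + 1 - n).toNat d ?_ _ (gradedComp_mem _ _ _)
  have := Int.self_le_toNat (d.1 + d.2 + 1 - n)
  linarith

/-- Nakayama's lemma for a surjection from a free `𝒜(1)^ℝ`-module onto an object. -/
theorem injective_of_mem_rhoTau {n : ℕ} (φ : (Fin n → A1) →ₗ[A1] C)
    (hsurj : Function.Surjective φ)
    (hred : ∀ u, φ u ∈ rhoTau C → u ∈ rhoTau (Fin n → A1)) : Function.Injective φ := by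
  have := C.projective_coeff
  let ψ : (Fin n → A1) →ₗ[M2R] C :=
    { toFun := φ
      map_add' := map_add φ
      map_smul' := fun r x => map_smul φ (coeff r) x }
  obtain ⟨σ, hσ⟩ := Module.projective_lifting_property ψ LinearMap.id hsurj
  have hσ (c : C) : φ (σ c) = c := LinearMap.congr_fun hσ c
  -- Projectivity over the coefficients supplies `σ`, and `π` projects onto the kernel of `φ`. The
  -- kernel is thus finitely generated, and applying `π` to a decomposition in `(ρ, τ)` of one of
  -- its elements keeps the terms inside the kernel.
  let π : (Fin n → A1) →ₗ[M2R] (Fin n → A1) := LinearMap.id - σ ∘ₗ ψ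
  have hπ (u : Fin n → A1) : π u = u - σ (φ u) := rfl
  have hfin : Module.Finite M2R A1 := Module.Finite.of_basis wordBasis
  have hfree : Module.Free M2R A1 := Module.Free.of_basis wordBasis
  have hK : LinearMap.range π ≤ Ideal.span {(MvPolynomial.X 0 : M2R), MvPolynomial.X 1} •
      LinearMap.range π := by
    rintro _ ⟨u, rfl⟩
    obtain ⟨y, z, hyz⟩ := hred (π u) (by rw [hπ, map_sub, hσ, sub_self]; exact zero_mem _)
    have h1 : π u = (MvPolynomial.X 1 : M2R) • y + (MvPolynomial.X 0 : M2R) • z := by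
      rw [hyz, coeff_smul, coeff_smul, coeff_X_zero, coeff_X_one]
    have h2 : π u = π (π u) := by
      rw [hπ (π u), hπ u, map_sub, hσ, sub_self, map_zero, sub_zero]
    rw [h2, h1, map_add, map_smul, map_smul]
    exact add_mem (Submodule.smul_mem_smul (Ideal.subset_span (by simp)) ⟨y, rfl⟩)
      (Submodule.smul_mem_smul (Ideal.subset_span (by simp)) ⟨z, rfl⟩)
  have hfg : (LinearMap.range π).FG := by
    rw [LinearMap.range_eq_map]
    exact Module.Finite.fg_top.map π
  obtain ⟨r, hr, hr0⟩ := Submodule.exists_sub_one_mem_and_smul_eq_zero_of_fg_of_le_smul _ _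
    hfg hK
  -- Nakayama gives `r` with constant term `1` annihilating the kernel; as the free module is
  -- torsion-free over a domain, `r ≠ 0` suffices.
  have hrne : r ≠ 0 := by
    rintro rfl
    have hle : Ideal.span {(MvPolynomial.X 0 : M2R), MvPolynomial.X 1} ≤
        RingHom.ker (MvPolynomial.constantCoeff : M2R →+* ZMod 2) := by
      rw [Ideal.span_le]
      rintro x (rfl | rfl) <;> simp
    simpa using hle hr
  rw [injective_iff_map_eq_zero]
  intro u hu
  have hu' : u = π u := by rw [hπ, hu, map_zero, sub_zero]
  have := hr0 u ⟨u, hu'.symm⟩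
  exact (smul_eq_zero.1 this).resolve_left hrne

/-- The detection theorem: Margolis homology detects projectivity. -/
theorem projective_of_isExactMod
    (h : ∀ a ∈ ({Q0, Q1, Sq2} : Set A1), IsExactMod (rhoTau C).toAddSubgroup a) :
    Module.Projective A1 C := by
  classical
  have hz := h Q1 (by simp)
  have hx := isExactMod_rhoTauQ1_Sq1 (h Q0 (by simp)) hz
  have hy := isExactMod_rhoTauQ1Sq1_Sq2 hx (isExactMod_rhoTauQ1_Sq2 (h Sq2 (by simp)) hz)
  obtain ⟨E, hE, hgen, hmin⟩ := C.exists_minimal_generators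
  let e : Fin E.card → C := fun i => (E.equivFin.symm i : C)
  let φ : (Fin E.card → A1) →ₗ[A1] C := Fintype.linearCombination A1 e
  have hφ (u : Fin E.card → A1) : φ u = ∑ i, u i • e i := Fintype.linearCombination_apply A1 e u
  have hsurj : Function.Surjective φ := by
    rw [← LinearMap.range_eq_top, ← top_le_iff, ← span_eq_top hE hgen, Submodule.span_le]
    intro x hx
    refine ⟨Pi.single (E.equivFin ⟨x, hx⟩) 1, ?_⟩
    rw [hφ, Finset.sum_eq_single (E.equivFin ⟨x, hx⟩)]
    · simp [e]
    · intro j _ hj; simp [hj]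
    · simp
  -- Modulo `augmented`, `φ u` is the sum of those generators whose coefficient is not in the
  -- augmentation ideal; minimality leaves no such index.
  have haug (u : Fin E.card → A1) (hu : φ u ∈ augmented C) : u ∈ augmented (Fin E.card → A1) := by
    let T := Finset.univ.filter fun i => u i ∉ augmented A1
    have hT : ∑ x ∈ T.map ⟨e, fun i j hij => E.equivFin.symm.injective (Subtype.ext hij)⟩, x ∈
        augmented C := by
      rw [Finset.sum_map]
      have h1 : ∑ i ∈ T, e i + ∑ i, (u i - if i ∈ T then 1 else 0) • e i = φ u := by
        rw [hφ]
        simp only [sub_smul, ite_smul, one_smul, zero_smul, Finset.sum_sub_distrib,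
          Finset.sum_ite_mem, Finset.univ_inter]
        abel
      refine (add_mem_cancel_right (h := sum_mem fun i _ =>
        smul_mem_augmented_of_mem ?_ (e i))).1 (h1 ▸ hu)
      by_cases hi : u i ∈ augmented A1
      · rwa [if_neg (by simp [T, hi]), sub_zero]
      · rw [if_pos (by simp [T, hi])]
        exact (mem_augmented_A1_or _).resolve_left hi
    have hT' := hmin _ (by
      intro x hx
      obtain ⟨i, -, rfl⟩ := Finset.mem_map.1 hx
      exact (E.equivFin.symm i).2) hT
    rw [Finset.map_eq_empty] at hT'
    refine pi_mem_augmented fun i => ?_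
    by_contra hi
    exact absurd (hT' ▸ Finset.mem_filter.2 ⟨Finset.mem_univ i, hi⟩ : i ∈ (∅ : Finset _)) (by simp)
  have hred (u : Fin E.card → A1) (hu : φ u ∈ rhoTau C) : u ∈ rhoTau (Fin E.card → A1) :=
    mem_rhoTau_of_map_mem hz hx hy haug hu
  have hinj := injective_of_mem_rhoTau φ hsurj hred
  exact Module.Projective.of_equiv (LinearEquiv.ofBijective φ ⟨hinj, hsurj⟩)

end FreeMod

/-! ### Coinduced modules and their projectivity. -/

/-- Right multiplication by `a`, as a linear map over the coefficients. -/
noncomputable def mulRightLinear (a : A1) : A1 →ₗ[M2R] A1 where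
  toFun b := b * a
  map_add' b c := add_mul b c a
  map_smul' r b := mul_assoc (coeff r) b a

/-- An `𝒜(1)^ℝ`-linear map, as a linear map over the coefficients. -/
noncomputable def coeffLinear {M N : Type*} [AddCommGroup M] [Module A1 M] [AddCommGroup N]
    [Module A1 N] (f : M →ₗ[A1] N) : M →ₗ[M2R] N where
  toFun := f
  map_add' := map_add f
  map_smul' r x := map_smul f (coeff r) x

/-- The coinduced module `Hom(𝒜(1)^ℝ, V)`, on which `𝒜(1)^ℝ` acts through its right action on
itself. -/
def Coind (V : Type*) [AddCommGroup V] [Module M2R V] : Type _ := A1 →ₗ[M2R] V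

namespace Coind

section General

variable {V W : Type*} [AddCommGroup V] [Module M2R V] [AddCommGroup W] [Module M2R W]

noncomputable instance : AddCommGroup (Coind V) := inferInstanceAs (AddCommGroup (A1 →ₗ[M2R] V))

instance : FunLike (Coind V) A1 V := inferInstanceAs (FunLike (A1 →ₗ[M2R] V) A1 V)

instance : AddMonoidHomClass (Coind V) A1 V :=
  inferInstanceAs (AddMonoidHomClass (A1 →ₗ[M2R] V) A1 V)

theorem map_coeff_mul (f : Coind V) (r : M2R) (b : A1) : f (coeff r * b) = r • f b :=
  LinearMap.map_smul (M := A1) (M₂ := V) f r b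

theorem add_apply (f g : Coind V) (b : A1) : (f + g) b = f b + g b := rfl

theorem zero_apply (b : A1) : (0 : Coind V) b = 0 := rfl

theorem ext_word {f g : Coind V} (h : ∀ i, f (word i) = g (word i)) : f = g :=
  wordBasis.ext (f₁ := (f : A1 →ₗ[M2R] V)) (f₂ := (g : A1 →ₗ[M2R] V)) fun i => by
    rw [wordBasis_apply]; exact h i

noncomputable instance : SMul A1 (Coind V) := ⟨fun a f => LinearMap.comp f (mulRightLinear a)⟩

theorem smul_apply (a : A1) (f : Coind V) (b : A1) : (a • f) b = f (b * a) := rfl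

noncomputable instance : Module A1 (Coind V) where
  one_smul f := DFunLike.ext _ _ fun b => by rw [smul_apply, mul_one]
  mul_smul a c f := DFunLike.ext _ _ fun b => by simp only [smul_apply, mul_assoc]
  smul_zero a := rfl
  smul_add a f g := rfl
  add_smul a c f := DFunLike.ext _ _ fun b => by simp only [smul_apply, add_apply, mul_add, map_add]
  zero_smul f := DFunLike.ext _ _ fun b => by rw [smul_apply, mul_zero, map_zero, zero_apply]

/-- The element of the coinduced module with given values on the basis `word`. -/
noncomputable def ofWord (v : Fin 8 → V) : Coind V := wordBasis.constr M2R v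

theorem ofWord_word (v : Fin 8 → V) (i : Fin 8) : ofWord v (word i) = v i := by
  have := wordBasis.constr_basis M2R v i
  rwa [wordBasis_apply] at this

/-- Functoriality of coinduction. -/
noncomputable def map (g : V →ₗ[M2R] W) : Coind V →ₗ[A1] Coind W where
  toFun f := LinearMap.comp g f
  map_add' f f' := DFunLike.ext _ _ fun b => map_add g _ _
  map_smul' a f := rfl

/-- The comparison of the free module with the coinduced module given by the Frobenius form. -/
noncomputable def frobenius (n : ℕ) : (Fin n → A1) →ₗ[A1] Coind (Fin n → M2R) where
  toFun u := LinearMap.pi fun i => topCoeff ∘ₗ mulRightLinear (u i)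
  map_add' u v := DFunLike.ext _ _ fun b => funext fun i => by
    change topCoeff (b * (u i + v i)) = topCoeff (b * u i) + topCoeff (b * v i)
    rw [mul_add, map_add]
  map_smul' a u := DFunLike.ext _ _ fun b => funext fun i => by
    change topCoeff (b * (a * u i)) = topCoeff (b * a * u i)
    rw [mul_assoc]

theorem frobenius_apply {n : ℕ} (u : Fin n → A1) (b : A1) (i : Fin n) :
    frobenius n u b i = topCoeff (b * u i) := rfl

/-- Injectivity is the expansion `sum_dualWord`; surjectivity is duality of `word` and `dualWord`
for the Frobenius form. Coinduction of a free coefficient module is therefore free over `A1`. -/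
theorem frobenius_bijective (n : ℕ) : Function.Bijective (frobenius n) := by
  constructor
  · rw [injective_iff_map_eq_zero]
    intro u hu
    ext1 i
    have h (j : Fin 8) : topCoeff (word j * u i) = 0 := by
      rw [← frobenius_apply, hu]; rfl
    rw [← sum_dualWord (u i)]
    simp only [h, map_zero, mul_zero, Finset.sum_const_zero, Pi.zero_apply]
  · intro f
    refine ⟨fun i => ∑ j, dualWord j * coeff (f (word j) i), ext_word fun k => funext fun i => ?_⟩
    rw [frobenius_apply, Finset.mul_sum, map_sum]
    simp only [← mul_assoc, topCoeff_mul_coeff, topCoeff_word_mul_dualWord, mul_ite, mul_one,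
      mul_zero, Finset.sum_ite_eq, Finset.mem_univ, if_true]

-- `V` is a summand of some `M2R ^ n`; coinduction preserves the splitting, and the Frobenius
-- isomorphism identifies the coinduction of `M2R ^ n` with `A1 ^ n`.
variable (V) in
theorem exists_retract [Module.Finite M2R V] [Module.Projective M2R V] :
    ∃ (n : ℕ) (i : Coind V →ₗ[A1] (Fin n → A1)) (r : (Fin n → A1) →ₗ[A1] Coind V),
      r ∘ₗ i = LinearMap.id := by
  obtain ⟨n, p, hp⟩ := Module.Finite.exists_fin' M2R V
  obtain ⟨s, hs⟩ := Module.projective_lifting_property p LinearMap.id hp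
  let Θ := LinearEquiv.ofBijective _ (frobenius_bijective n)
  refine ⟨n, Θ.symm.toLinearMap ∘ₗ map s, map p ∘ₗ Θ.toLinearMap, LinearMap.ext fun f => ?_⟩
  change map p (Θ (Θ.symm (map s f))) = f
  rw [LinearEquiv.apply_symm_apply]
  exact DFunLike.ext _ _ fun b => LinearMap.congr_fun hs (f b)

variable (V) in
theorem projective [Module.Finite M2R V] [Module.Projective M2R V] :
    Module.Projective A1 (Coind V) := by
  obtain ⟨n, i, r, h⟩ := exists_retract V
  exact Module.Projective.of_split i r h

variable (V) in
theorem finite_coeff [Module.Finite M2R V] [Module.Projective M2R V] :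
    Module.Finite M2R (Coind V) := by
  obtain ⟨n, i, r, h⟩ := exists_retract V
  have : Module.Finite M2R A1 := Module.Finite.of_basis wordBasis
  have : Module.Finite M2R (Fin n → A1) := Module.Finite.pi
  exact Module.Finite.of_surjective (coeffLinear r) fun f => ⟨i f, LinearMap.congr_fun h f⟩

variable (V) in
theorem projective_coeff [Module.Finite M2R V] [Module.Projective M2R V] :
    Module.Projective M2R (Coind V) := by
  obtain ⟨n, i, r, h⟩ := exists_retract V
  have : Module.Free M2R A1 := Module.Free.of_basis wordBasis
  have : Module.Free M2R (Fin n → A1) := Module.Free.function (Fin n) M2R A1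
  exact Module.Projective.of_split (coeffLinear i) (coeffLinear r)
    (LinearMap.ext fun f => LinearMap.congr_fun h f)

end General

end Coind

/-! ### The grading of the coinduced module, its unit and its evaluation. -/

/-- The degrees of the basis `word`. -/
def wordDeg : Fin 8 → ℤ × ℤ :=
  ![(0, 0), (1, 0), (2, 1), (3, 1), (3, 1), (4, 1), (5, 2), (6, 2)]

namespace FreeMod

variable (M : FreeMod.{u})

/-- The homogeneous components of the coinduced module. -/
noncomputable def coindDeg (d : ℤ × ℤ) : AddSubgroup (Coind M) where
  carrier := {f | ∀ i, f (word i) ∈ M.deg (d + wordDeg i)}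
  add_mem' hf hg i := add_mem (hf i) (hg i)
  zero_mem' i := zero_mem _
  neg_mem' hf i := neg_mem (hf i)

variable {M}

/-- The projection of the coinduced module onto a homogeneous component. -/
noncomputable def coindComp (d : ℤ × ℤ) : Coind M →+ Coind M where
  toFun f := Coind.ofWord fun i => M.comp (d + wordDeg i) (f (word i))
  map_zero' := Coind.ext_word fun i => by
    simp only [Coind.ofWord_word, Coind.zero_apply, map_zero]
  map_add' f g := Coind.ext_word fun i => by
    simp only [Coind.ofWord_word, Coind.add_apply, map_add]

theorem coindComp_word (d : ℤ × ℤ) (f : Coind M) (i : Fin 8) :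
    coindComp d f (word i) = M.comp (d + wordDeg i) (f (word i)) :=
  Coind.ofWord_word (V := M) _ i

/-- The elements of the coinduced module supported on one basis element. -/
noncomputable def coindSingle (i : Fin 8) : M →+ Coind M where
  toFun m := Coind.ofWord (Pi.single i m)
  map_zero' := Coind.ext_word fun j => by
    rw [Coind.ofWord_word, Coind.zero_apply, Pi.single_zero]; rfl
  map_add' f g := Coind.ext_word fun j => by
    rw [Coind.add_apply, Coind.ofWord_word, Coind.ofWord_word, Coind.ofWord_word, Pi.single_add]
    rfl

theorem coindSingle_word (i j : Fin 8) (m : M) :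
    coindSingle i m (word j) = (Pi.single i m : Fin 8 → M) j := Coind.ofWord_word (V := M) _ j

theorem sum_coindSingle (f : Coind M) : ∑ i, coindSingle i (f (word i)) = f := by
  refine Coind.ext_word fun j => ?_
  have (s : Finset (Fin 8)) (g : Fin 8 → Coind M) : (∑ i ∈ s, g i) (word j) =
      ∑ i ∈ s, g i (word j) :=
    map_sum (⟨⟨fun f => f (word j), rfl⟩, fun f g => rfl⟩ : Coind M →+ M) g s
  rw [this]
  simp only [coindSingle_word]
  rw [Finset.sum_eq_single j (fun i _ hij => Pi.single_eq_of_ne hij.symm _) (by simp),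
    Pi.single_eq_same]

theorem isInternal_coindDeg : DirectSum.IsInternal (coindDeg M) := by
  refine isInternal_of_comp coindComp (fun d e f hf => Coind.ext_word fun i => ?_) ?_
  · rw [coindComp_word, gradedComp_apply _ _ _ (hf i)]
    simp only [add_left_inj]
    split_ifs <;> rfl
  · rw [eq_top_iff]
    intro f _
    rw [← sum_coindSingle f]
    refine sum_mem fun i _ => ?_
    refine graded_induction M.isInternal ((⨆ d, coindDeg M d).comap (coindSingle i))
      (fun d m hm => ?_) (f (word i))
    refine AddSubgroup.mem_iSup_of_mem (d - wordDeg i) fun j => ?_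
    rw [coindSingle_word]
    by_cases hij : j = i
    · subst hij
      rwa [Pi.single_eq_same, sub_add_cancel]
    · rw [Pi.single_eq_of_ne hij]
      exact zero_mem _

section Shift

variable {d : ℤ × ℤ} {f : Coind M} {e e' : ℤ × ℤ} {b : A1}

theorem coind_τ_mul_mem (h : f b ∈ M.deg (d + e)) (he : e' = e + (0, 1)) :
    f (τ * b) ∈ M.deg (d + e') := by
  rw [← coeff_X_zero, Coind.map_coeff_mul, coeff_smul, coeff_X_zero, he, ← add_assoc]
  exact M.τ_smul_mem _ _ h

theorem coind_ρ_mul_mem (h : f b ∈ M.deg (d + e)) (he : e' = e + (1, 1)) :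
    f (ρ * b) ∈ M.deg (d + e') := by
  rw [← coeff_X_one, Coind.map_coeff_mul, coeff_smul, coeff_X_one, he, ← add_assoc]
  exact M.ρ_smul_mem _ _ h

theorem coind_word_mem (hf : f ∈ coindDeg M d) {i : Fin 8} (he : e = wordDeg i) :
    f (word i) ∈ M.deg (d + e) := he ▸ hf i

theorem coind_zero_mem : f 0 ∈ M.deg (d + e) := by rw [map_zero]; exact zero_mem _

theorem coind_add_mem {b c : A1} (hb : f b ∈ M.deg (d + e)) (hc : f c ∈ M.deg (d + e)) :
    f (b + c) ∈ M.deg (d + e) := by rw [map_add]; exact add_mem hb hc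

end Shift

theorem coind_smul_mem {a : A1} {e : ℤ × ℤ}
    (ha : ∀ d, ∀ f ∈ coindDeg M d, ∀ i, f (word i * a) ∈ M.deg (d + (e + wordDeg i)))
    (d : ℤ × ℤ) (f : Coind M) (hf : f ∈ coindDeg M d) : a • f ∈ coindDeg M (d + e) := by
  intro i
  rw [add_assoc]
  exact ha d f hf i

theorem coind_Sq1_smul_mem (d : ℤ × ℤ) (f : Coind M) (hf : f ∈ coindDeg M d) :
    Sq1 • f ∈ coindDeg M (d + (1, 0)) := by
  refine coind_smul_mem (fun d f hf i => ?_) d f hf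
  rw [word_mul_Sq1]
  have w (i : Fin 8) := @coind_word_mem M d f (wordDeg i) hf i rfl
  fin_cases i
  exacts [w 1, coind_zero_mem, w 4, w 5, coind_zero_mem, coind_zero_mem, w 7, coind_zero_mem]

theorem coind_Sq2_smul_mem (d : ℤ × ℤ) (f : Coind M) (hf : f ∈ coindDeg M d) :
    Sq2 • f ∈ coindDeg M (d + (2, 1)) := by
  refine coind_smul_mem (fun d f hf i => ?_) d f hf
  rw [word_mul_Sq2]
  have w (i : Fin 8) := @coind_word_mem M d f (wordDeg i) hf i rfl
  fin_cases i
  exacts [w 2, w 3, coind_τ_mul_mem (w 5) rfl, coind_ρ_mul_mem (w 5) rfl, w 6, w 7,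
    coind_ρ_mul_mem (w 7) rfl, coind_zero_mem]

theorem coind_ρ_smul_mem (d : ℤ × ℤ) (f : Coind M) (hf : f ∈ coindDeg M d) :
    ρ • f ∈ coindDeg M (d + (1, 1)) := by
  refine coind_smul_mem (fun d f hf i => ?_) d f hf
  rw [word_mul_ρ]
  exact coind_ρ_mul_mem (hf i) (add_comm _ _)

theorem coind_τ_smul_mem (d : ℤ × ℤ) (f : Coind M) (hf : f ∈ coindDeg M d) :
    τ • f ∈ coindDeg M (d + (0, 1)) := by
  refine coind_smul_mem (fun d f hf i => ?_) d f hf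
  rw [word_mul_τ]
  refine coind_add_mem (coind_τ_mul_mem (hf i) (add_comm _ _)) ?_
  have w (i : Fin 8) := @coind_word_mem M d f (wordDeg i) hf i rfl
  have r (i : Fin 8) := @coind_ρ_mul_mem M d f _ (wordDeg i + (1, 1)) _ (w i) rfl
  have t (i : Fin 8) := @coind_τ_mul_mem M d f _ (wordDeg i + (0, 1)) _ (w i) rfl
  fin_cases i
  exacts [coind_zero_mem, r 0, coind_ρ_mul_mem (t 1) rfl,
    coind_add_mem (r 2) (coind_ρ_mul_mem (r 1) rfl), r 2, coind_add_mem (r 3) (r 4),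
    coind_add_mem (coind_ρ_mul_mem (r 4) rfl) (coind_ρ_mul_mem (t 5) rfl), r 6]

variable (M) in
/-- The coinduced object. -/
noncomputable def coind : FreeMod.{u} where
  carrier := Coind M
  deg := coindDeg M
  isInternal := isInternal_coindDeg
  τ_smul_mem := coind_τ_smul_mem
  ρ_smul_mem := coind_ρ_smul_mem
  Sq1_smul_mem := coind_Sq1_smul_mem
  Sq2_smul_mem := coind_Sq2_smul_mem
  finite :=
    have := M.finite_coeff
    have := M.projective_coeff
    Coind.finite_coeff M
  projective :=
    have := M.finite_coeff
    have := M.projective_coeff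
    Coind.projective_coeff M

variable (M) in
theorem coind_projective : Module.Projective A1 M.coind :=
  have := M.finite_coeff
  have := M.projective_coeff
  Coind.projective M

theorem word_smul_mem {d : ℤ × ℤ} {m : M} (hm : m ∈ M.deg d) (i : Fin 8) :
    word i • m ∈ M.deg (d + wordDeg i) := by
  have x {d d' : ℤ × ℤ} {m : M} (hm : m ∈ M.deg d) (h : d' = d + (1, 0)) : Sq1 • m ∈ M.deg d' :=
    h ▸ M.Sq1_smul_mem _ _ hm
  have y {d d' : ℤ × ℤ} {m : M} (hm : m ∈ M.deg d) (h : d' = d + (2, 1)) : Sq2 • m ∈ M.deg d' :=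
    h ▸ M.Sq2_smul_mem _ _ hm
  fin_cases i <;> simp only [word, wordDeg, Fin.zero_eta, Fin.mk_one, Fin.reduceFinMk,
    Matrix.cons_val, mul_smul, one_smul]
  · rwa [Prod.mk_zero_zero, add_zero]
  · exact x hm rfl
  · exact y hm rfl
  · exact x (y hm rfl) (by rw [add_assoc]; rfl)
  · exact y (x hm rfl) (by rw [add_assoc]; rfl)
  · exact x (y (x hm rfl) rfl) (by rw [add_assoc, add_assoc]; rfl)
  · exact y (x (y hm rfl) rfl) (by rw [add_assoc, add_assoc]; rfl)
  · exact x (y (x (y hm rfl) rfl) rfl) (by rw [add_assoc, add_assoc, add_assoc]; rfl)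

variable (M) in
/-- The unit of the coinduction adjunction. -/
noncomputable def coindUnit : Hom M M.coind where
  toLin :=
    { toFun := fun m => (show A1 →ₗ[M2R] M from
        { toFun := fun b => b • m
          map_add' := fun b c => add_smul b c m
          map_smul' := fun r b => mul_smul (coeff r) b m })
      map_add' := fun m n => DFunLike.ext (F := Coind M) _ _ fun b => smul_add b m n
      map_smul' := fun a m => DFunLike.ext (F := Coind M) _ _ fun b => (mul_smul b a m).symm }
  map_deg := fun _ _ hm i => word_smul_mem hm i

variable (M) in
/-- The evaluation of the coinduced module at `1`. -/
noncomputable def coindEval : M.coind →ₗ[M2R] M where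
  toFun f := (show Coind M from f) 1
  map_add' _ _ := rfl
  map_smul' r f := by
    change (show Coind M from f) (1 * coeff r) = r • _
    -- The action on the coinduced module is through right multiplication, but at `1` a right
    -- coefficient is also a left one, so it can be pulled out.
    rw [one_mul, ← mul_one (coeff r), Coind.map_coeff_mul]

theorem coindEval_coindUnit (m : M) : M.coindEval (M.coindUnit.toLin m) = m := one_smul A1 m

end FreeMod

namespace FreeMod

/-! ### Direct sums, split quotients and graded sections. -/

section Prod

variable (M N : FreeMod.{u})

theorem isInternal_prod : DirectSum.IsInternal fun d => (M.deg d).prod (N.deg d) := by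
  refine isInternal_of_comp (fun d => (M.comp d).prodMap (N.comp d)) (fun d e x hx => ?_) ?_
  · obtain ⟨h1, h2⟩ := AddSubgroup.mem_prod.1 hx
    rw [AddMonoidHom.coe_prodMap, Prod.map_apply', gradedComp_apply _ _ _ h1,
      gradedComp_apply _ _ _ h2]
    split_ifs <;> rfl
  · rw [eq_top_iff]
    rintro ⟨m, n⟩ -
    set S := ⨆ d, (M.deg d).prod (N.deg d)
    have h1 := graded_induction M.isInternal (S.comap (AddMonoidHom.inl M N))
      (fun d m hm => AddSubgroup.mem_iSup_of_mem d ⟨hm, zero_mem _⟩) m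
    have h2 := graded_induction N.isInternal (S.comap (AddMonoidHom.inr M N))
      (fun d m hm => AddSubgroup.mem_iSup_of_mem d ⟨zero_mem _, hm⟩) n
    have := add_mem (AddSubgroup.mem_comap.1 h1) (AddSubgroup.mem_comap.1 h2)
    simpa using this

/-- The direct sum of two objects. -/
noncomputable def prod : FreeMod.{u} where
  carrier := M × N
  deg d := (M.deg d).prod (N.deg d)
  isInternal := isInternal_prod M N
  τ_smul_mem d x hx := ⟨M.τ_smul_mem d _ hx.1, N.τ_smul_mem d _ hx.2⟩
  ρ_smul_mem d x hx := ⟨M.ρ_smul_mem d _ hx.1, N.ρ_smul_mem d _ hx.2⟩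
  Sq1_smul_mem d x hx := ⟨M.Sq1_smul_mem d _ hx.1, N.Sq1_smul_mem d _ hx.2⟩
  Sq2_smul_mem d x hx := ⟨M.Sq2_smul_mem d _ hx.1, N.Sq2_smul_mem d _ hx.2⟩
  finite :=
    have := M.finite_coeff
    have := N.finite_coeff
    (Module.Finite.prod : Module.Finite M2R (M × N))
  projective :=
    have := M.projective_coeff
    have := N.projective_coeff
    (inferInstance : Module.Projective M2R (M × N))

end Prod

section Quotient

variable (E : FreeMod.{u}) (S : Submodule A1 E)

theorem isInternal_quotient (hS : IsHomogeneousSubgroup E.isInternal S.toAddSubgroup) :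
    DirectSum.IsInternal fun d => (E.deg d).map S.mkQ.toAddMonoidHom := by
  refine isInternal_of_comp (M := E ⧸ S)
    (fun d => (QuotientAddGroup.map S.toAddSubgroup S.toAddSubgroup (E.comp d) (hS d) :
      E ⧸ S →+ E ⧸ S)) ?_ ?_
  · rintro d e _ ⟨x, hx, rfl⟩
    change S.mkQ (E.comp e x) = _
    rw [gradedComp_apply _ _ _ hx]
    split_ifs
    · rfl
    · exact map_zero _
  · rw [eq_top_iff]
    intro x _
    obtain ⟨x, rfl⟩ := S.mkQ_surjective x
    exact graded_induction E.isInternal ((⨆ d, (E.deg d).map S.mkQ.toAddMonoidHom).comap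
      S.mkQ.toAddMonoidHom) (fun d x hx => AddSubgroup.mem_iSup_of_mem d ⟨x, hx, rfl⟩) x

/-- The quotient of an object by a homogeneous submodule which is a direct summand over the
coefficients, with complement the image of the projection `T`. -/
noncomputable def quotient (hS : IsHomogeneousSubgroup E.isInternal S.toAddSubgroup)
    (T : E →ₗ[M2R] E) (hT : ∀ x ∈ S, T x = 0) (hT' : ∀ x, x - T x ∈ S) : FreeMod.{u} where
  carrier := E ⧸ S
  deg d := (E.deg d).map S.mkQ.toAddMonoidHom
  isInternal := isInternal_quotient E S hS
  τ_smul_mem := by rintro d _ ⟨x, hx, rfl⟩; exact ⟨τ • x, E.τ_smul_mem d x hx, rfl⟩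
  ρ_smul_mem := by rintro d _ ⟨x, hx, rfl⟩; exact ⟨ρ • x, E.ρ_smul_mem d x hx, rfl⟩
  Sq1_smul_mem := by rintro d _ ⟨x, hx, rfl⟩; exact ⟨Sq1 • x, E.Sq1_smul_mem d x hx, rfl⟩
  Sq2_smul_mem := by rintro d _ ⟨x, hx, rfl⟩; exact ⟨Sq2 • x, E.Sq2_smul_mem d x hx, rfl⟩
  finite :=
    have := E.finite_coeff
    Module.Finite.of_surjective (coeffLinear S.mkQ) S.mkQ_surjective
  projective := by
    have := E.projective_coeff
    let σ : (E ⧸ S) →ₗ[M2R] E :=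
      { toFun := QuotientAddGroup.lift S.toAddSubgroup T.toAddMonoidHom hT
        map_add' := map_add _
        map_smul' := fun r x => by
          obtain ⟨x, rfl⟩ := S.mkQ_surjective x
          exact map_smul T r x }
    refine Module.Projective.of_split σ (coeffLinear S.mkQ) (LinearMap.ext fun x => ?_)
    obtain ⟨x, rfl⟩ := S.mkQ_surjective x
    change S.mkQ (T x) = S.mkQ x
    rw [← sub_eq_zero, ← map_sub, ← neg_sub, map_neg, neg_eq_zero]
    exact (Submodule.Quotient.mk_eq_zero S).2 (hT' x)

end Quotient

/-- The degree-preserving part `t` of any linear section works: it commutes with the homogeneous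
generators of `A1`, and since `p` preserves degrees it is still a section. -/
theorem exists_graded_section {E C : FreeMod.{u}} (p : Hom E C)
    (hp : Function.Surjective p.toLin) [Module.Projective A1 C] :
    ∃ s : Hom C E, ∀ x, p.toLin (s.toLin x) = x := by
  obtain ⟨s, hs⟩ := Module.projective_lifting_property p.toLin LinearMap.id hp
  have hs (x : C) : p.toLin (s x) = x := LinearMap.congr_fun hs x
  let e := AddEquiv.ofBijective (DirectSum.coeAddMonoidHom C.deg) C.isInternal
  let t : C →+ E := (DirectSum.toAddMonoid fun d =>
    (E.comp d).comp (s.toAddMonoidHom.comp (C.deg d).subtype)).comp e.symm.toAddMonoidHom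
  have ht (d : ℤ × ℤ) (x : C) (hx : x ∈ C.deg d) : t x = E.comp d (s x) := by
    have h1 : e.symm x = DirectSum.of (fun d => C.deg d) d ⟨x, hx⟩ := by
      rw [AddEquiv.symm_apply_eq]
      exact (DirectSum.coeAddMonoidHom_of C.deg d ⟨x, hx⟩).symm
    change DirectSum.toAddMonoid _ (e.symm x) = _
    rw [h1, DirectSum.toAddMonoid_of]
    rfl
  have hgen (a : A1) (c : ℤ × ℤ) (haC : ∀ d, ∀ x ∈ C.deg d, a • x ∈ C.deg (d + c))
      (haE : ∀ d, ∀ x ∈ E.deg d, a • x ∈ E.deg (d + c)) (x : C) : t (a • x) = a • t x := by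
    refine graded_induction C.isInternal ((t.comp (mulBy C a)).eqLocus ((mulBy E a).comp t))
      (fun d x hx => ?_) x
    change t (a • x) = a • t x
    rw [ht _ _ (haC d x hx), ht _ _ hx, map_smul, gradedComp_smul _ haE, add_sub_cancel_right]
  have hlin (a : A1) (x : C) : t (a • x) = a • t x := by
    induction a using A1_induction generalizing x with
    | tau => exact hgen τ _ C.τ_smul_mem E.τ_smul_mem x
    | rho => exact hgen ρ _ C.ρ_smul_mem E.ρ_smul_mem x
    | sq1 => exact hgen Sq1 _ C.Sq1_smul_mem E.Sq1_smul_mem x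
    | sq2 => exact hgen Sq2 _ C.Sq2_smul_mem E.Sq2_smul_mem x
    | zero => simp
    | one => simp
    | add a b ha hb => rw [add_smul, map_add, ha, hb, add_smul]
    | mul a b ha hb => rw [mul_smul, ha, hb, mul_smul]
  refine ⟨⟨{ t with map_smul' := hlin }, fun d x hx => ?_⟩, fun x => ?_⟩
  · change t x ∈ _
    rw [ht d x hx]
    exact gradedComp_mem _ _ _
  · refine graded_induction C.isInternal ((p.toLin.toAddMonoidHom.comp t).eqLocus
      (AddMonoidHom.id C)) (fun d x hx => ?_) x
    change p.toLin (t x) = x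
    rw [ht d x hx]
    have := gradedComp_map E.isInternal C.isInternal p.toLin.toAddMonoidHom 0
      (fun d x hx => by rw [add_zero]; exact p.map_deg d x hx) d (s x)
    rw [sub_zero] at this
    refine this.symm.trans ?_
    change C.comp d (p.toLin (s x)) = x
    rw [hs, gradedComp_of_mem _ hx]

theorem mul_self_mem_rhoTau {a : A1} (ha : a ∈ ({Q0, Q1, Sq2} : Set A1)) : a * a ∈ rhoTau A1 := by
  rcases ha with rfl | rfl | rfl
  · rw [Q0, Sq1_mul_Sq1]; exact zero_mem _
  · exact Q1_mul_Q1_mem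
  · exact Sq2_mul_Sq2_mem

theorem coeffLinear_mem_rhoTau {M N : Type*} [AddCommGroup M] [Module A1 M] [AddCommGroup N]
    [Module A1 N] (R : M →ₗ[M2R] N) {x : M} (hx : x ∈ rhoTau M) : R x ∈ rhoTau N := by
  obtain ⟨y, z, rfl⟩ := hx
  refine ⟨R y, R z, ?_⟩
  rw [← coeff_X_zero, ← coeff_X_one, ← coeff_smul, ← coeff_smul, map_add, map_smul, map_smul]
  rfl

/-! ### The cokernel of the stabilized map and the converse implication. -/

/-- The cokernel of a map inducing isomorphisms in Margolis homology, after making the map split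
injective over the coefficients by adding a map to a projective module. -/
theorem isExactMod_cokernel {M N I : Type u} [AddCommGroup M] [Module A1 M] [AddCommGroup N]
    [Module A1 N] [AddCommGroup I] [Module A1 I] [Module.Projective A1 I] (f : M →ₗ[A1] N)
    (ι : M →ₗ[A1] I) (R : I →ₗ[M2R] M) (hR : ∀ m, R (ι m) = m) {a : A1}
    (ha : a ∈ ({Q0, Q1, Sq2} : Set A1)) (hf : Function.Bijective (margolisMap (redMap f) a)) :
    IsExactMod (rhoTau ((N × I) ⧸ LinearMap.range (f.prod ι))).toAddSubgroup a := by
  obtain ⟨hinj, hsurj⟩ := (margolisMap_redMap_bijective_iff f a).1 hf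
  set S := LinearMap.range (f.prod ι) with hS
  intro c hc
  obtain ⟨⟨n, i⟩, rfl⟩ := S.mkQ_surjective c
  obtain ⟨y, z, hyz⟩ := hc
  obtain ⟨⟨y, y'⟩, rfl⟩ := S.mkQ_surjective y
  obtain ⟨⟨z, z'⟩, rfl⟩ := S.mkQ_surjective z
  rw [← map_smul, ← map_smul, ← map_smul, ← map_add, ← sub_eq_zero, ← map_sub, ← LinearMap.mem_ker,
    Submodule.ker_mkQ] at hyz
  obtain ⟨m, hm⟩ := hyz
  have hm1 : f m = a • n - (ρ • y + τ • z) := congrArg Prod.fst hm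
  have hm2 : ι m = a • i - (ρ • y' + τ • z') := congrArg Prod.snd hm
  -- Here `(f m, ι m) ≡ a (n, i)` modulo `(ρ, τ)`. Since `a * a` lies in `(ρ, τ)`, `a • ι m`
  -- vanishes there, and the coefficient retraction `R` transfers this to `a • m`.
  have h1 : a • ι m ∈ rhoTau I := by
    rw [hm2, smul_sub, ← mul_smul]
    exact sub_mem (smul_mem_rhoTau_of_mem (mul_self_mem_rhoTau ha) i)
      ((rhoTau I).smul_mem a ⟨_, _, rfl⟩)
  have h2 : a • m ∈ rhoTau M := by
    rw [← hR (a • m), map_smul]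
    exact coeffLinear_mem_rhoTau R h1
  -- The class of `m` dies in the homology of `N`, because `f m ≡ a n`. So `m ≡ a m'`, and
  -- subtracting the image of `m'` turns both coordinates of `(n, i)` into cycles.
  obtain ⟨m', hm'⟩ := hinj m h2 ⟨n, -y, -z, by rw [hm1, smul_neg, smul_neg]; abel⟩
  have h3 : a • (n - f m') ∈ rhoTau N := by
    have := add_mem (map_mem_rhoTau f hm') (show ρ • y + τ • z ∈ rhoTau N from ⟨_, _, rfl⟩)
    rw [map_sub, map_smul, hm1] at this
    convert this using 1
    rw [smul_sub]; abel
  have h4 : a • (i - ι m') ∈ rhoTau I := by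
    have := add_mem (map_mem_rhoTau ι hm') (show ρ • y' + τ • z' ∈ rhoTau I from ⟨_, _, rfl⟩)
    rw [map_sub, map_smul, hm2] at this
    convert this using 1
    rw [smul_sub]; abel
  -- Surjectivity gives a cycle `m''` whose image corrects the first coordinate to a boundary; the
  -- second coordinate stays a cycle and bounds because `I` is projective.
  obtain ⟨m'', hm'', n', hn'⟩ := hsurj _ h3
  obtain ⟨i', hi'⟩ := isExactMod_of_projective ha (i - ι m' - ι m'') (by
    have := sub_mem h4 (map_mem_rhoTau ι hm'')
    rwa [map_smul, ← smul_sub] at this)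
  refine ⟨S.mkQ (n', i'), ?_⟩
  have h5 := add_mem (map_mem_rhoTau (LinearMap.inl A1 N I) hn')
    (map_mem_rhoTau (LinearMap.inr A1 N I) hi')
  have h6 : S.mkQ (f.prod ι (m' + m'')) = 0 :=
    (Submodule.Quotient.mk_eq_zero S).2 ⟨_, rfl⟩
  have h7 : ((n, i) : N × I) - a • (n', i') - f.prod ι (m' + m'') =
      LinearMap.inl A1 N I (n - f m' - f m'' - a • n') +
        LinearMap.inr A1 N I (i - ι m' - ι m'' - a • i') := by
    refine Prod.ext ?_ ?_
    · simp only [LinearMap.inl_apply, LinearMap.inr_apply, LinearMap.prod_apply, Function.prod,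
        Prod.fst_add, Prod.fst_sub, Prod.smul_fst, map_add]
      abel
    · simp only [LinearMap.inl_apply, LinearMap.inr_apply, LinearMap.prod_apply, Function.prod,
        Prod.snd_add, Prod.snd_sub, Prod.smul_snd, map_add]
      abel
  rw [← h7] at h5
  have h8 := map_mem_rhoTau S.mkQ h5
  rwa [map_sub, map_sub, h6, sub_zero, map_smul] at h8

/-- The map `(f, ι) : M → N ⊕ Hom(𝒜(1)^ℝ, M)`. -/
noncomputable def stabilize {M N : FreeMod.{u}} (f : Hom M N) : Hom M (N.prod M.coind) where
  toLin := f.toLin.prod M.coindUnit.toLin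
  map_deg d x hx := ⟨f.map_deg d x hx, M.coindUnit.map_deg d x hx⟩

section Stabilize

variable {M N : FreeMod.{u}} (f : Hom M N)

/-- The retraction of `stabilize f` over the coefficients. -/
noncomputable def stabilizeRetraction : N.prod M.coind →ₗ[M2R] M :=
  M.coindEval ∘ₗ LinearMap.snd M2R N M.coind

theorem stabilizeRetraction_apply (m : M) :
    stabilizeRetraction ((stabilize f).toLin m : N.prod M.coind) = m := coindEval_coindUnit m

theorem comp_stabilize (d : ℤ × ℤ) (m : M) :
    (N.prod M.coind).comp d ((stabilize f).toLin m) = (stabilize f).toLin (M.comp d m) := by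
  have := gradedComp_map M.isInternal (N.prod M.coind).isInternal
    (stabilize f).toLin.toAddMonoidHom 0
    (fun d x hx => by rw [add_zero]; exact (stabilize f).map_deg d x hx) d m
  rwa [sub_zero] at this

/-- The cokernel of `stabilize f`. -/
noncomputable def cokernel : FreeMod.{u} :=
  quotient (N.prod M.coind) (LinearMap.range (stabilize f).toLin)
    (by rintro d _ ⟨m, rfl⟩; exact ⟨M.comp d m, (comp_stabilize f d m).symm⟩)
    -- The projection over the coefficients that kills the image of `M`; it splits the cokernel off
    -- and makes it projective over the coefficients.
    (LinearMap.id - coeffLinear (stabilize f).toLin ∘ₗ stabilizeRetraction)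
    (by
      rintro _ ⟨m, rfl⟩
      change (stabilize f).toLin m - (stabilize f).toLin (stabilizeRetraction _) = 0
      rw [stabilizeRetraction_apply, sub_self])
    (fun x => ⟨stabilizeRetraction x, (sub_sub_self x _).symm⟩)

/-- The projection to the cokernel of `stabilize f`. -/
noncomputable def cokernelProj : Hom (N.prod M.coind) (cokernel f) where
  toLin := (LinearMap.range (stabilize f).toLin).mkQ
  map_deg _ x hx := ⟨x, hx, rfl⟩

theorem cokernelProj_surjective : Function.Surjective (cokernelProj f).toLin :=
  Submodule.mkQ_surjective _

theorem cokernelProj_eq_zero {x : N.prod M.coind} (hx : (cokernelProj f).toLin x = 0) :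
    ∃ m, (stabilize f).toLin m = x :=
  (Submodule.Quotient.mk_eq_zero (LinearMap.range (stabilize f).toLin)).1 hx

theorem cokernelProj_stabilize (m : M) : (cokernelProj f).toLin ((stabilize f).toLin m) = 0 :=
  (Submodule.Quotient.mk_eq_zero (LinearMap.range (stabilize f).toLin)).2 ⟨m, rfl⟩

theorem stabilize_injective : Function.Injective (stabilize f).toLin :=
  Function.LeftInverse.injective (stabilizeRetraction_apply f)

variable {f}

theorem projective_cokernel (hf : ∀ a ∈ ({Q0, Q1, Sq2} : Set A1),
    Function.Bijective (margolisMap (redMap f.toLin) a)) : Module.Projective A1 (cokernel f) :=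
  have := M.coind_projective
  projective_of_isExactMod fun a ha =>
    isExactMod_cokernel f.toLin M.coindUnit.toLin M.coindEval coindEval_coindUnit ha (hf a ha)

/-- The element `x - s (p x)`, with `p` the projection, lies in the image of the injective map
`stabilize f`; its unique preimage is `r x`, and uniqueness gives linearity and compatibility with
degrees. -/
theorem exists_graded_retraction [Module.Projective A1 (cokernel f)] :
    ∃ (s : Hom (cokernel f) (N.prod M.coind)) (r : Hom (N.prod M.coind) M),
      ∀ x, (stabilize f).toLin (r.toLin x) = x - s.toLin ((cokernelProj f).toLin x) := by
  obtain ⟨s, hs⟩ := exists_graded_section (cokernelProj f) (cokernelProj_surjective f)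
  have hex (x : N.prod M.coind) : ∃ m, (stabilize f).toLin m =
      x - s.toLin ((cokernelProj f).toLin x) :=
    cokernelProj_eq_zero f (by rw [map_sub, hs, sub_self])
  choose r hr using hex
  refine ⟨s, ⟨{ toFun := r, map_add' := fun x y => ?_, map_smul' := fun a x => ?_ },
    fun d x hx => ?_⟩, hr⟩
  · apply stabilize_injective f
    rw [map_add (stabilize f).toLin, hr, hr, hr, map_add, map_add]
    abel
  · apply stabilize_injective f
    rw [RingHom.id_apply, map_smul (stabilize f).toLin, hr, hr, map_smul, map_smul, smul_sub]
  · change r x ∈ M.deg d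
    have h1 : (stabilize f).toLin (r x) ∈ (N.prod M.coind).deg d := by
      rw [hr]
      exact sub_mem hx (s.map_deg d _ ((cokernelProj f).map_deg d x hx))
    have h2 : M.comp d (r x) = r x := by
      apply stabilize_injective f
      rw [← comp_stabilize, gradedComp_of_mem _ h1]
    rw [← h2]
    exact gradedComp_mem _ _ _

end Stabilize

end FreeMod

-- The inverse is `r` restricted to `N`. On `M`, `r` retracts `(f, ι)`, so `g f - id` is minus `r`
-- on the coinduced part after `ι` and factors through `M.coind`. On `N`, the first coordinate of `x
-- - s (p x)` shows that `f g - id` factors through the projective cokernel.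
open FreeMod in
theorem isStableEquivalence_of_bijective {M N : FreeMod.{u}} {f : FreeMod.Hom M N}
    (hf : ∀ a ∈ ({Q0, Q1, Sq2} : Set A1),
      Function.Bijective (margolisMap (redMap f.toLin) a)) : IsStableEquivalence f := by
  have hC := projective_cokernel hf
  obtain ⟨s, r, hr⟩ := exists_graded_retraction (f := f)
  let inl : Hom N (N.prod M.coind) := ⟨LinearMap.inl A1 N M.coind, fun _ _ hx => ⟨hx, zero_mem _⟩⟩
  let inr : Hom M.coind (N.prod M.coind) :=
    ⟨LinearMap.inr A1 N M.coind, fun _ _ hx => ⟨zero_mem _, hx⟩⟩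
  let fst : Hom (N.prod M.coind) N := ⟨LinearMap.fst A1 N M.coind, fun _ _ hx => hx.1⟩
  refine ⟨⟨r.toLin ∘ₗ inl.toLin, fun d x hx => r.map_deg d _ (inl.map_deg d x hx)⟩, ?_, ?_⟩
  · refine ⟨M.coind, M.coindUnit, ⟨-(r.toLin ∘ₗ inr.toLin), fun d x hx =>
      neg_mem (r.map_deg d _ (inr.map_deg d x hx))⟩, M.coind_projective, LinearMap.ext fun m => ?_⟩
    change r.toLin (inl.toLin (f.toLin m)) - m = -r.toLin (inr.toLin (M.coindUnit.toLin m))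
    have h1 : r.toLin ((stabilize f).toLin m) = m := by
      apply stabilize_injective f
      rw [hr, cokernelProj_stabilize, map_zero, sub_zero]
    have h2 : (stabilize f).toLin m =
        inl.toLin (f.toLin m) + inr.toLin (M.coindUnit.toLin m) :=
      Prod.ext (add_zero (f.toLin m)).symm (zero_add (M.coindUnit.toLin m)).symm
    rw [h2, map_add] at h1
    rw [sub_eq_iff_eq_add, ← sub_eq_neg_add, eq_sub_iff_add_eq, h1]
  · refine ⟨cokernel f, ⟨(cokernelProj f).toLin ∘ₗ inl.toLin, fun d x hx =>
      (cokernelProj f).map_deg d _ (inl.map_deg d x hx)⟩, ⟨-(fst.toLin ∘ₗ s.toLin), fun d x hx =>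
      neg_mem (fst.map_deg d _ (s.map_deg d x hx))⟩, hC, LinearMap.ext fun n => ?_⟩
    change fst.toLin ((stabilize f).toLin (r.toLin (inl.toLin n))) - n =
      -fst.toLin (s.toLin ((cokernelProj f).toLin (inl.toLin n)))
    rw [hr, map_sub]
    change n - _ - n = _
    abel

end RMotivic

theorem mainTheorem5 (M N : RMotivic.FreeMod.{u}) (f : RMotivic.FreeMod.Hom M N) :
    RMotivic.IsStableEquivalence f ↔
      ∀ α ∈ ({RMotivic.Q0, RMotivic.Q1, RMotivic.Sq2} : Set RMotivic.A1),
        Function.Bijective (RMotivic.margolisMap (RMotivic.redMap f.toLin) α) :=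
  ⟨fun h _ hα => RMotivic.bijective_of_isStableEquivalence h hα,
    RMotivic.isStableEquivalence_of_bijective⟩
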